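/- Fix integers $k,k^\star\ge 0$, constants $\gamma,R,K,\alpha>0$ and a function $K_r:\mathbb R_{\ge0}\to\mathbb R_{>0}$, and let $p=p(n)$ satisfy $p(n)/n\to\gamma$ as $n\to\infty$. All data below may depend on $n$, as long as the stated bounds hold with these fixed constants (so that the conclusion is uniform over such data). Here $\|X\|_{\psi_2}=\inf\{t>0:\mathbb E\exp(X^2/t^2)\le 2\}$, $\|\cdot\|_F$ is the Frobenius norm, and Lipschitz constants are with respect to Euclidean norms. **Features.** Let $\Sigma\in\mathbb R^{p\times p}$ be symmetric positive semidefinite with $\|\Sigma\|_{\mathrm{op}}\le K$. Let $x_i=\Sigma^{1/2}\bar x_i\in\mathbb R^p$, $i\le n$, where the $np$ entries of $\bar x_1,\dots,\bar x_n$ are i.i.d. with mean $0$ and $\psi_2$-norm at most $K$. Let $\nu$ be the variance of an entry of $\bar x_1$, and let $g_1,\dots,g_n$ be i.i.d. $N(0,\nu\Sigma)$. Let $\varepsilon_1,\dots,\varepsilon_n$ be i.i.d. real random variables with $\|\varepsilon_i\|_{\psi_2}\le K$, independent of $(\bar x_i)_{i\le n}$ and independent of $(g_i)_{i\le n}$.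 Put $$\mathcal S_p=\{\theta\in\mathbb R^p:\ \|\Sigma^{1/2}\theta\|_\infty\le R\,p^{-\alpha},\ \|\theta\|_2\le R\}.$$ **Risk.** Let $\ell:\mathbb R^{k+1}\to[0,\infty)$ and $\eta:\mathbb R^{k^\star+1}\to\mathbb R$ be $K$-Lipschitz. Let $r:\mathbb R^{p\times k}\to\mathbb R$ satisfy $|r(\Theta_0)-r(\Theta_1)|\le K_r(B)\|\Theta_0-\Theta_1\|_F$ whenever $B>0$ and $\|\Theta_0\|_F,\|\Theta_1\|_F\le B$. Let $\Theta^\star\in\mathbb R^{p\times k^\star}$ have all its columns in $\mathcal S_p$, and let $\mathcal C_p\subseteq\mathcal S_p$ be any nonempty compact set. For $Z=(z_1,\dots,z_n)$ with $z_i\in\mathbb R^p$, put $y_i(Z)=\eta(\Theta^{\star\mathsf T}z_i,\varepsilon_i)$ and $$\widehat R_n^\star(Z)=\inf_{\Theta=(\theta_1,\dots,\theta_k),\ \theta_a\in\mathcal C_p}\Big\{\frac1n\sum_{i=1}^n\ell\big(\Theta^{\mathsf T}z_i;\,y_i(Z)\big)+r(\Theta)\Big\}.$$ Write $X=(x_1,\dots,x_n)$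 and $G=(g_1,\dots,g_n)$. **Conclusion.** 1. For every bounded Lipschitz $\psi:\mathbb R\to\mathbb R$, $$\lim_{n\to\infty}\big|\mathbb E\,\psi(\widehat R_n^\star(X))-\mathbb E\,\psi(\widehat R_n^\star(G))\big|=0.$$ 2. For all $\rho\in\mathbb R$, $\delta>0$ and $\tau>0$, for all sufficiently large $n$, $$\mathbb P(\widehat R_n^\star(X)\ge\rho+\delta)\le\mathbb P(\widehat R_n^\star(G)\ge\rho)+\tau\quad\text{and}\quad \mathbb P(\widehat R_n^\star(X)\le\rho-\delta)\le\mathbb P(\widehat R_n^\star(G)\le\rho)+\tau.$$ In particular, the same inequalities without $\tau$ hold between the $\limsup$s, between the $\liminf$s, and between the limits as $n\to\infty$ when these exist. 3. For every $\rho\in\mathbb R$, $\widehat R_n^\star(X)\to\rho$ in probability if and only if $\widehat R_n^\star(G)\to\rho$ in probability. -/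

import Mathlib

open MeasureTheory ProbabilityTheory Filter Topology
open scoped NNReal ENNReal MatrixOrder

noncomputable section

/-- The subgaussian (Orlicz `ψ₂`) norm `inf {t > 0 : E exp (X² / t²) ≤ 2}` of a real random
variable, with value `∞` when `X` is not subgaussian. -/
def psi2Norm {Ω : Type*} [MeasurableSpace Ω] (X : Ω → ℝ) (P : Measure Ω) : ℝ≥0∞ :=
  ⨅ t ∈ {t : ℝ | 0 < t ∧ ∫⁻ ω, ENNReal.ofReal (Real.exp (X ω ^ 2 / t ^ 2)) ∂P ≤ 2},
    ENNReal.ofReal t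

/-- The symmetric positive semidefinite square root of `S` (for `S` positive semidefinite), as an
operator on Euclidean space. -/
def sqrtOp {p : ℕ} (S : Matrix (Fin p) (Fin p) ℝ) :
    EuclideanSpace ℝ (Fin p) →L[ℝ] EuclideanSpace ℝ (Fin p) :=
  Matrix.toEuclideanCLM (𝕜 := ℝ) (CFC.sqrt S)

/-- The `ℓ₂` operator norm of a matrix. -/
def matrixOpNorm {p : ℕ} (S : Matrix (Fin p) (Fin p) ℝ) : ℝ :=
  ‖(Matrix.toEuclideanCLM (𝕜 := ℝ) S : EuclideanSpace ℝ (Fin p) →L[ℝ] EuclideanSpace ℝ (Fin p))‖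

/-- The set of `θ ∈ ℝᵖ` with `‖S^{1/2} θ‖_∞ ≤ R p^{-α}` and `‖θ‖₂ ≤ R`. -/
def delocalizedSet {p : ℕ} (S : Matrix (Fin p) (Fin p) ℝ) (R α : ℝ) :
    Set (EuclideanSpace ℝ (Fin p)) :=
  {θ | (∀ j, |sqrtOp S θ j| ≤ R * (p : ℝ) ^ (-α)) ∧ ‖θ‖ ≤ R}

/-- The vector `Θᵀ x ∈ ℝᵏ`, where `Θ` is the `p × k` matrix with columns `Θ 0, …, Θ (k - 1)`. -/
def project {p k : ℕ} (Θ : Fin k → EuclideanSpace ℝ (Fin p)) (x : EuclideanSpace ℝ (Fin p)) :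
    Fin k → ℝ :=
  fun a => inner ℝ (Θ a) x

/-- The Frobenius norm of the matrix with columns `Θ 0, …, Θ (k - 1)`. -/
def frobNorm {p k : ℕ} (Θ : Fin k → EuclideanSpace ℝ (Fin p)) : ℝ :=
  Real.sqrt (∑ a, ∑ j, Θ a j ^ 2)

/-- The point `(u, v)` of `ℝᵏ⁺¹`, with its Euclidean norm, for `u ∈ ℝᵏ` and `v ∈ ℝ`. -/
def appendCoord {k : ℕ} (u : Fin k → ℝ) (v : ℝ) : EuclideanSpace ℝ (Fin (k + 1)) :=
  WithLp.toLp 2 (Fin.snoc u v : Fin (k + 1) → ℝ)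

/-- The responses `y_i = η (Θ*ᵀ x_i, ε_i)`. -/
def responses {n p k : ℕ} (η : EuclideanSpace ℝ (Fin (k + 1)) → ℝ)
    (Θstar : Fin k → EuclideanSpace ℝ (Fin p))
    (x : Fin n → EuclideanSpace ℝ (Fin p)) (ε : Fin n → ℝ) : Fin n → ℝ :=
  fun i => η (appendCoord (project Θstar (x i)) (ε i))

/-- The regularized empirical risk `n⁻¹ ∑ i, ℓ (Θᵀ x_i; y_i) + r Θ`. -/
def empiricalRisk {n p k : ℕ} (ℓ : EuclideanSpace ℝ (Fin (k + 1)) → ℝ)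
    (r : (Fin k → EuclideanSpace ℝ (Fin p)) → ℝ)
    (x : Fin n → EuclideanSpace ℝ (Fin p)) (y : Fin n → ℝ)
    (Θ : Fin k → EuclideanSpace ℝ (Fin p)) : ℝ :=
  (n : ℝ)⁻¹ * ∑ i, ℓ (appendCoord (project Θ (x i)) (y i)) + r Θ

/-- The training error: the infimum of the empirical risk over matrices `Θ` whose `k` columns all
lie in `C`. -/
def trainingError {n p k : ℕ} (ℓ : EuclideanSpace ℝ (Fin (k + 1)) → ℝ)
    (r : (Fin k → EuclideanSpace ℝ (Fin p)) → ℝ) (C : Set (EuclideanSpace ℝ (Fin p)))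
    (x : Fin n → EuclideanSpace ℝ (Fin p)) (y : Fin n → ℝ) : ℝ :=
  sInf (empiricalRisk ℓ r x y '' {Θ | ∀ a, Θ a ∈ C})

/-- Convergence in probability to a constant, for random variables that may live on different
probability spaces. -/
def TendstoInProb {Ω : ℕ → Type*} [∀ n, MeasurableSpace (Ω n)] (P : ∀ n, Measure (Ω n))
    (Z : ∀ n, Ω n → ℝ) (ρ : ℝ) : Prop :=
  ∀ δ : ℝ, 0 < δ → Tendsto (fun n => (P n).real {ω | δ ≤ |Z n ω - ρ|}) atTop (𝓝 0)

end

/-! The training error is approximated by a smooth free energy, and the entries of the design are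
exchanged one at a time by Lindeberg's method.

Moving `Σ^{1/2}` onto the parameters turns the risk into an average of losses evaluated at `∑ j, Y i
j • a j`. Here `Y` has i.i.d. entries, and `a j` is the `j`-th row of the matrix with columns
`Σ^{1/2} θ_a` and `Σ^{1/2} θ*_a`. In the Gaussian model the same holds in law, with `N(0, ν)`
entries. The noise is frozen by independence, so only the law of the entries changes, and the two
laws share their mean and variance.

For a `δ`-net of `C` and an inverse temperature `β`, the infimum is compared with `-(β n)⁻¹ log ∑ m,
exp (-β n r m) ∏ i, W i (…)`, where `m` runs over `k`-tuples of net points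
(`abs_designError_add_log_le`). The loss is only Lipschitz, so `exp (-β loss)` is replaced by a
convolution `W i` with an exponentially decaying kernel (`exists_smooth_weight`). This moves `log`
by a constant that does not depend on `β`, and makes three derivatives of `W i` bounded relative to
`W i` itself. The net costs `O(δ)` in expectation, by a bound on `v ↦ n⁻¹ ∑ i, |⟨Σ^{1/2} v, Y i⟩|`
uniform over directions (`exists_seminorm_bound`). Smoothing and the entropy of the net, at most `k
p log (1 + 2R/δ)`, cost `O_δ(1/β)`.

Exchanging the entry `Y i j` costs `1/N`, with `N = β n`, times a Gibbs average of `‖a j‖³`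
(`freeEnergy_taylor`). The Gibbs measure depends on the entries, so it is first dominated by weights
that do not involve the row being exchanged, at the price of exponential moments
(`gibbs_average_le`). Then one may sum over `j` inside the average: `∑ j ‖a j‖³ ≤ max ‖a j‖ · ∑ j ‖a
j‖² = O(p^{-α})`. This is where delocalization enters. The `n` rows cancel against `N`, and the
total is `O_β(p^{-α})` (`freeEnergy_swap`).

Choosing `δ` small, then `β` large, then `n` large proves the claim for test functions with three
bounded derivatives. Repeated averaging reaches bounded Lipschitz ones, and piecewise linear ramps
turn expectations into probabilities. -/

/-! ### Relatively smooth functions -/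

/-- A positive function on the line whose first three derivatives are bounded, relative to the
function, by powers of `a`. -/
def RelSmooth (a : ℝ) (f : ℝ → ℝ) : Prop :=
  (∀ t, 0 < f t) ∧ ∃ f1 f2 f3 : ℝ → ℝ, (∀ t, HasDerivAt f (f1 t) t) ∧
    (∀ t, HasDerivAt f1 (f2 t) t) ∧ (∀ t, HasDerivAt f2 (f3 t) t) ∧
    ∀ t, |f1 t| ≤ a * f t ∧ |f2 t| ≤ a ^ 2 * f t ∧ |f3 t| ≤ a ^ 3 * f t

/-- The hypotheses say that `log f` is `a`-Lipschitz. This supplies both the dominating functions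
for differentiation under the integral and the comparison of Gibbs weights at nearby points. -/
theorem le_exp_mul_of_abs_deriv_le {a : ℝ} {f f1 : ℝ → ℝ} (hpos : ∀ t, 0 < f t)
    (hf : ∀ t, HasDerivAt f (f1 t) t) (hb : ∀ t, |f1 t| ≤ a * f t) (s t : ℝ) :
    f t ≤ Real.exp (a * |t - s|) * f s := by
  have h1 : ∀ t, HasDerivAt (fun t => Real.log (f t)) (f1 t / f t) t := fun t =>
    (hf t).log (hpos t).ne'
  have h2 := Convex.norm_image_sub_le_of_norm_hasDerivWithin_le (f := fun t => Real.log (f t))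
    (C := a) (s := Set.univ) (x := s) (y := t) (fun x _ => (h1 x).hasDerivWithinAt)
    (fun x _ => by
      rw [norm_div, Real.norm_eq_abs, Real.norm_eq_abs, abs_of_pos (hpos x),
        div_le_iff₀ (hpos x)]
      exact hb x) convex_univ (Set.mem_univ _) (Set.mem_univ _)
  rw [Real.norm_eq_abs, Real.norm_eq_abs] at h2
  have h3 := (abs_le.mp h2).2
  calc f t = Real.exp (Real.log (f t)) := (Real.exp_log (hpos t)).symm
    _ ≤ Real.exp (a * |t - s| + Real.log (f s)) := Real.exp_le_exp.mpr (by linarith)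
    _ = _ := by rw [Real.exp_add, Real.exp_log (hpos s)]

theorem RelSmooth.le_exp {a : ℝ} {f : ℝ → ℝ} (h : RelSmooth a f) (s t : ℝ) :
    f t ≤ Real.exp (a * |t - s|) * f s := by
  obtain ⟨hpos, f1, f2, f3, h1, -, -, hb⟩ := h
  exact le_exp_mul_of_abs_deriv_le hpos h1 (fun t => (hb t).1) s t

/-- Relative bounds are linear in `F`, hence survive superposition. On the unit ball around `t`
every derivative is dominated by a multiple of `exp a * F t`, so integrability of `F t` alone
justifies all three differentiations. -/
theorem RelSmooth.integral {V : Type*} [MeasurableSpace V] {μ : Measure V} (hμ : μ ≠ 0) {a : ℝ}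
    (ha : 0 ≤ a) {F F1 F2 F3 : ℝ → V → ℝ}
    (hm : ∀ t, AEStronglyMeasurable (F t) μ) (hm1 : ∀ t, AEStronglyMeasurable (F1 t) μ)
    (hm2 : ∀ t, AEStronglyMeasurable (F2 t) μ) (hm3 : ∀ t, AEStronglyMeasurable (F3 t) μ)
    (hint : ∀ t, Integrable (F t) μ) (hpos : ∀ t v, 0 < F t v)
    (hd : ∀ t v, HasDerivAt (fun t => F t v) (F1 t v) t)
    (hd1 : ∀ t v, HasDerivAt (fun t => F1 t v) (F2 t v) t)
    (hd2 : ∀ t v, HasDerivAt (fun t => F2 t v) (F3 t v) t)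
    (hb1 : ∀ t v, |F1 t v| ≤ a * F t v) (hb2 : ∀ t v, |F2 t v| ≤ a ^ 2 * F t v)
    (hb3 : ∀ t v, |F3 t v| ≤ a ^ 3 * F t v) :
    RelSmooth a (fun t => ∫ v, F t v ∂μ) := by
  have key : ∀ (c : ℝ) (G G1 : ℝ → V → ℝ), 0 ≤ c → (∀ t, AEStronglyMeasurable (G t) μ) →
      (∀ t, AEStronglyMeasurable (G1 t) μ) → (∀ t, Integrable (G t) μ) →
      (∀ t v, HasDerivAt (fun t => G t v) (G1 t v) t) → (∀ t v, |G1 t v| ≤ c * F t v) →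
      ∀ t, HasDerivAt (fun t => ∫ v, G t v ∂μ) (∫ v, G1 t v ∂μ) t := by
    intro c G G1 hc hG hG1 hGi hGd hGb t
    refine (hasDerivAt_integral_of_dominated_loc_of_deriv_le (s := Metric.ball t 1)
      (bound := fun v => c * (Real.exp a * F t v)) (Metric.ball_mem_nhds t one_pos)
      (Eventually.of_forall hG) (hGi t) (hG1 t) (Eventually.of_forall fun v s hs => ?_)
      (((hint t).const_mul _).const_mul _) (Eventually.of_forall fun v s _ => hGd s v)).2
    rw [Real.norm_eq_abs]
    refine (hGb s v).trans (mul_le_mul_of_nonneg_left ?_ hc)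
    refine (le_exp_mul_of_abs_deriv_le (fun t => hpos t v) (fun t => hd t v)
      (fun t => hb1 t v) t s).trans (mul_le_mul_of_nonneg_right ?_ (hpos t v).le)
    rw [Metric.mem_ball, Real.dist_eq] at hs
    exact Real.exp_le_exp.mpr (mul_le_of_le_one_right ha hs.le)
  have bint : ∀ (c : ℝ) (G : ℝ → V → ℝ), (∀ t, AEStronglyMeasurable (G t) μ) →
      (∀ t v, |G t v| ≤ c * F t v) → ∀ t, Integrable (G t) μ ∧
        |∫ v, G t v ∂μ| ≤ c * ∫ v, F t v ∂μ := by
    intro c G hG hb t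
    have hi : Integrable (G t) μ := ((hint t).const_mul c).mono' (hG t)
      (Eventually.of_forall fun v => hb t v)
    refine ⟨hi, ?_⟩
    rw [← integral_const_mul]
    exact (abs_integral_le_integral_abs).trans
      (integral_mono hi.abs ((hint t).const_mul c) (fun v => hb t v))
  refine ⟨fun t => ?_, fun t => ∫ v, F1 t v ∂μ, fun t => ∫ v, F2 t v ∂μ, fun t => ∫ v, F3 t v ∂μ,
    key a F F1 ha hm hm1 hint hd hb1,
    key (a ^ 2) F1 F2 (by positivity) hm1 hm2 (fun t => (bint a F1 hm1 hb1 t).1) hd1 hb2,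
    key (a ^ 3) F2 F3 (by positivity) hm2 hm3 (fun t => (bint _ F2 hm2 hb2 t).1) hd2 hb3,
    fun t => ⟨(bint a F1 hm1 hb1 t).2, (bint _ F2 hm2 hb2 t).2, (bint _ F3 hm3 hb3 t).2⟩⟩
  rw [integral_pos_iff_support_of_nonneg (fun v => (hpos t v).le) (hint t)]
  have : Function.support (F t) = Set.univ := by
    ext v; simpa using (hpos t v).ne'
  rw [this]
  exact (Measure.measure_univ_pos).mpr hμ

/-! ### Smooth approximation of `exp (-L)` for Lipschitz `L` -/

section Kernel

variable {E : Type*} [NormedAddCommGroup E]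

/-- A smooth kernel which decays exponentially. -/
noncomputable def expKernel (x : E) : ℝ := Real.exp (-2 * Real.sqrt (1 + ‖x‖ ^ 2))

theorem one_le_bracket (x : E) : 1 ≤ Real.sqrt (1 + ‖x‖ ^ 2) := by
  rw [Real.one_le_sqrt]; nlinarith [sq_nonneg ‖x‖]

theorem norm_le_bracket (x : E) : ‖x‖ ≤ Real.sqrt (1 + ‖x‖ ^ 2) :=
  Real.le_sqrt_of_sq_le (by linarith)

theorem expKernel_pos (x : E) : 0 < expKernel x := Real.exp_pos _

theorem continuous_expKernel : Continuous (expKernel : E → ℝ) := by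
  unfold expKernel; fun_prop

variable [InnerProductSpace ℝ E]

/-- The first derivative of `√(1 + ‖x‖²)` in direction `w`. -/
noncomputable def bracketD1 (x w : E) : ℝ := inner ℝ x w / Real.sqrt (1 + ‖x‖ ^ 2)
/-- The second derivative of `√(1 + ‖x‖²)` in direction `w`. -/
noncomputable def bracketD2 (x w : E) : ℝ :=
  (‖w‖ ^ 2 - bracketD1 x w ^ 2) / Real.sqrt (1 + ‖x‖ ^ 2)
/-- The third derivative of `√(1 + ‖x‖²)` in direction `w`. -/
noncomputable def bracketD3 (x w : E) : ℝ :=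
  -3 * bracketD1 x w * bracketD2 x w / Real.sqrt (1 + ‖x‖ ^ 2)

theorem hasDerivAt_line (x w : E) (t : ℝ) : HasDerivAt (fun t : ℝ => x + t • w) w t := by
  simpa using ((hasDerivAt_id t).smul_const w).const_add x

theorem hasDerivAt_bracket (x w : E) (t : ℝ) :
    HasDerivAt (fun t : ℝ => Real.sqrt (1 + ‖x + t • w‖ ^ 2)) (bracketD1 (x + t • w) w) t := by
  have h := ((hasDerivAt_line x w t).norm_sq.const_add 1).sqrt (by positivity)
  refine h.congr_deriv ?_
  unfold bracketD1
  have := one_le_bracket (x + t • w)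
  field_simp

theorem hasDerivAt_bracketD1 (x w : E) (t : ℝ) :
    HasDerivAt (fun t : ℝ => bracketD1 (x + t • w) w) (bracketD2 (x + t • w) w) t := by
  have h0 : HasDerivAt (fun t : ℝ => inner ℝ (x + t • w) w) (‖w‖ ^ 2) t := by
    have := (hasDerivAt_line x w t).inner ℝ (hasDerivAt_const t w)
    simpa using this
  have h := h0.div (hasDerivAt_bracket x w t) (by have := one_le_bracket (x + t • w); positivity)
  refine h.congr_deriv ?_
  have := one_le_bracket (x + t • w)
  simp only [bracketD2, bracketD1]
  field_simp

theorem hasDerivAt_bracketD2 (x w : E) (t : ℝ) :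
    HasDerivAt (fun t : ℝ => bracketD2 (x + t • w) w) (bracketD3 (x + t • w) w) t := by
  have h0 := ((hasDerivAt_bracketD1 x w t).pow 2).const_sub (‖w‖ ^ 2)
  have h := h0.div (hasDerivAt_bracket x w t) (by have := one_le_bracket (x + t • w); positivity)
  refine h.congr_deriv ?_
  have := one_le_bracket (x + t • w)
  simp only [bracketD3, bracketD2, Pi.pow_apply, Nat.cast_ofNat]
  field_simp
  ring

theorem abs_bracketD1_le (x w : E) : |bracketD1 x w| ≤ ‖w‖ := by
  have := one_le_bracket x
  rw [bracketD1, abs_div, abs_of_nonneg (Real.sqrt_nonneg _), div_le_iff₀ (by positivity), mul_comm]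
  exact (abs_real_inner_le_norm x w).trans
    (mul_le_mul_of_nonneg_right (norm_le_bracket x) (norm_nonneg _))

theorem abs_bracketD2_le (x w : E) : |bracketD2 x w| ≤ ‖w‖ ^ 2 := by
  have h1 := one_le_bracket x
  have h2 : bracketD1 x w ^ 2 ≤ ‖w‖ ^ 2 := sq_le_sq' (abs_le.mp (abs_bracketD1_le x w)).1
    (abs_le.mp (abs_bracketD1_le x w)).2
  rw [bracketD2, abs_div, abs_of_nonneg (Real.sqrt_nonneg _), div_le_iff₀ (by positivity),
    abs_of_nonneg (by linarith)]
  nlinarith [sq_nonneg (bracketD1 x w), sq_nonneg ‖w‖]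

theorem abs_bracketD3_le (x w : E) : |bracketD3 x w| ≤ 3 * ‖w‖ ^ 3 := by
  have h1 := one_le_bracket x
  rw [bracketD3, abs_div, abs_of_nonneg (Real.sqrt_nonneg _), div_le_iff₀ (by positivity),
    abs_mul, abs_mul]
  have h2 := mul_le_mul (abs_bracketD1_le x w) (abs_bracketD2_le x w) (abs_nonneg _) (norm_nonneg _)
  have h3 : 0 ≤ 3 * ‖w‖ ^ 3 := by positivity
  norm_num
  nlinarith

/-- The first directional derivative of `expKernel`. -/
noncomputable def expKernelD1 (x w : E) : ℝ := -2 * bracketD1 x w * expKernel x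
/-- The second directional derivative of `expKernel`. -/
noncomputable def expKernelD2 (x w : E) : ℝ :=
  (4 * bracketD1 x w ^ 2 - 2 * bracketD2 x w) * expKernel x
/-- The third directional derivative of `expKernel`. -/
noncomputable def expKernelD3 (x w : E) : ℝ :=
  (-8 * bracketD1 x w ^ 3 + 12 * bracketD1 x w * bracketD2 x w - 2 * bracketD3 x w) * expKernel x

theorem hasDerivAt_expKernel (x w : E) (t : ℝ) :
    HasDerivAt (fun t : ℝ => expKernel (x + t • w)) (expKernelD1 (x + t • w) w) t := by
  have h := ((hasDerivAt_bracket x w t).const_mul (-2)).exp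
  refine h.congr_deriv ?_
  simp only [expKernelD1, expKernel]; ring

theorem hasDerivAt_expKernelD1 (x w : E) (t : ℝ) :
    HasDerivAt (fun t : ℝ => expKernelD1 (x + t • w) w) (expKernelD2 (x + t • w) w) t := by
  have h := ((hasDerivAt_bracketD1 x w t).const_mul (-2)).mul (hasDerivAt_expKernel x w t)
  refine h.congr_deriv ?_
  simp only [expKernelD2, expKernelD1]; ring

theorem hasDerivAt_expKernelD2 (x w : E) (t : ℝ) :
    HasDerivAt (fun t : ℝ => expKernelD2 (x + t • w) w) (expKernelD3 (x + t • w) w) t := by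
  have h := ((((hasDerivAt_bracketD1 x w t).pow 2).const_mul 4).sub
    ((hasDerivAt_bracketD2 x w t).const_mul 2)).mul (hasDerivAt_expKernel x w t)
  refine h.congr_deriv ?_
  simp only [expKernelD3, expKernelD1, Pi.pow_apply, Pi.sub_apply, Nat.cast_ofNat]; ring

/-- The three derivatives have relative size at most `2‖w‖`, `6‖w‖²` and `26‖w‖³`; the single rate
`6‖w‖` covers all of them. -/
theorem abs_expKernelD1_le (x w : E) : |expKernelD1 x w| ≤ 6 * ‖w‖ * expKernel x := by
  rw [expKernelD1, abs_mul, abs_of_pos (expKernel_pos x)]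
  refine mul_le_mul_of_nonneg_right ?_ (expKernel_pos x).le
  rw [abs_mul]
  norm_num
  linarith [abs_bracketD1_le x w, norm_nonneg w]

theorem abs_expKernelD2_le (x w : E) : |expKernelD2 x w| ≤ (6 * ‖w‖) ^ 2 * expKernel x := by
  rw [expKernelD2, abs_mul, abs_of_pos (expKernel_pos x)]
  refine mul_le_mul_of_nonneg_right ?_ (expKernel_pos x).le
  have h1 := pow_le_pow_left₀ (abs_nonneg _) (abs_bracketD1_le x w) 2
  rw [sq_abs] at h1
  have h2 := abs_le.mp (abs_bracketD2_le x w)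
  rw [abs_le]
  constructor <;> nlinarith [sq_nonneg (bracketD1 x w), sq_nonneg ‖w‖]

theorem abs_expKernelD3_le (x w : E) : |expKernelD3 x w| ≤ (6 * ‖w‖) ^ 3 * expKernel x := by
  rw [expKernelD3, abs_mul, abs_of_pos (expKernel_pos x)]
  refine mul_le_mul_of_nonneg_right ?_ (expKernel_pos x).le
  have h1 := pow_le_pow_left₀ (abs_nonneg _) (abs_bracketD1_le x w) 3
  rw [← abs_pow] at h1
  have h2 := mul_le_mul (abs_bracketD1_le x w) (abs_bracketD2_le x w) (abs_nonneg _) (norm_nonneg _)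
  rw [← abs_mul] at h2
  have h3 := abs_le.mp (abs_bracketD3_le x w)
  have h4 := abs_le.mp h1
  have h5 := abs_le.mp h2
  have h6 : 0 ≤ ‖w‖ ^ 3 := by positivity
  rw [abs_le]
  constructor <;> nlinarith

theorem continuous_bracketD1 (w : E) : Continuous fun x : E => bracketD1 x w := by
  unfold bracketD1
  refine Continuous.div (by fun_prop) (by fun_prop) fun x => ?_
  have := one_le_bracket x; positivity

theorem continuous_bracketD2 (w : E) : Continuous fun x : E => bracketD2 x w := by
  unfold bracketD2
  have := continuous_bracketD1 w
  refine Continuous.div (by fun_prop) (by fun_prop) fun x => ?_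
  have := one_le_bracket x; positivity

theorem continuous_bracketD3 (w : E) : Continuous fun x : E => bracketD3 x w := by
  unfold bracketD3
  have := continuous_bracketD1 w
  have := continuous_bracketD2 w
  refine Continuous.div (by fun_prop) (by fun_prop) fun x => ?_
  have := one_le_bracket x; positivity

variable [FiniteDimensional ℝ E] [MeasurableSpace E] [BorelSpace E]

/-- The factor `2` in the exponent of the kernel absorbs the growth `exp ‖x‖` of the exponential of
a `1`-Lipschitz function and still leaves `exp (-‖x‖)`, which beats `(1 + ‖x‖)` to the power minus
`dim + 1`. -/
theorem integrable_exp_norm_mul_expKernel :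
    Integrable (fun x : E => Real.exp ‖x‖ * expKernel x) := by
  set d := Module.finrank ℝ E + 1
  have h0 := integrable_one_add_norm (E := E) (μ := volume) (r := (d : ℝ)) (by simp [d])
  refine (h0.const_mul (d.factorial * Real.exp 1)).mono'
    (by have := continuous_expKernel (E := E)
        exact (by fun_prop : Continuous fun x : E => Real.exp ‖x‖ * expKernel x).aestronglyMeasurable)
    (Eventually.of_forall fun x => ?_)
  rw [Real.norm_eq_abs, abs_of_pos (mul_pos (Real.exp_pos _) (expKernel_pos x))]
  have h1 : Real.exp ‖x‖ * expKernel x ≤ Real.exp (-‖x‖) := by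
    rw [expKernel, ← Real.exp_add, Real.exp_le_exp]
    linarith [norm_le_bracket x]
  have h2 := Real.pow_div_factorial_le_exp (1 + ‖x‖) (by positivity) d
  rw [Real.exp_add] at h2
  refine h1.trans ?_
  rw [Real.exp_neg, Real.rpow_neg (by positivity), Real.rpow_natCast]
  have : 0 < (d.factorial : ℝ) := by positivity
  rw [div_le_iff₀ this] at h2
  rw [← div_eq_mul_inv, le_div_iff₀ (by positivity), inv_mul_le_iff₀ (Real.exp_pos _)]
  linarith

/-- A smooth positive approximation of `exp (-L)` for a Lipschitz function `L`. -/
theorem exists_smooth_weight_one : ∃ C : ℝ, 0 ≤ C ∧ ∀ L : E → ℝ, LipschitzWith 1 L → ∃ W : E → ℝ,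
    (∀ u w, RelSmooth (6 * ‖w‖) fun t => W (u + t • w)) ∧ ∀ u, |Real.log (W u) + L u| ≤ C := by
  have hI := integrable_exp_norm_mul_expKernel (E := E)
  have hI' : Integrable (fun x : E => Real.exp (-‖x‖) * expKernel x) := by
    refine hI.mono' (by have := continuous_expKernel (E := E)
                        exact (by fun_prop : Continuous fun x : E =>
                          Real.exp (-‖x‖) * expKernel x).aestronglyMeasurable)
      (Eventually.of_forall fun x => ?_)
    rw [Real.norm_eq_abs, abs_of_pos (mul_pos (Real.exp_pos _) (expKernel_pos x))]
    exact mul_le_mul_of_nonneg_right (Real.exp_le_exp.mpr (by linarith [norm_nonneg x]))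
      (expKernel_pos x).le
  have hne : (volume : Measure E) ≠ 0 := by
    intro h
    have := Metric.measure_ball_pos (volume : Measure E) 0 one_pos
    simp [h] at this
  have hp : ∀ f : E → ℝ, (∀ x, 0 < f x) → Integrable f → 0 < ∫ x, f x := by
    intro f hf hfi
    rw [integral_pos_iff_support_of_nonneg (fun v => (hf v).le) hfi]
    have : Function.support f = Set.univ := by
      ext v; simpa using (hf v).ne'
    rw [this]
    exact (Measure.measure_univ_pos).mpr hne
  set c1 := ∫ x : E, Real.exp ‖x‖ * expKernel x
  set c2 := ∫ x : E, Real.exp (-‖x‖) * expKernel x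
  have hc1 : 0 < c1 := hp _ (fun x => mul_pos (Real.exp_pos _) (expKernel_pos x)) hI
  have hc2 : 0 < c2 := hp _ (fun x => mul_pos (Real.exp_pos _) (expKernel_pos x)) hI'
  refine ⟨|Real.log c1| + |Real.log c2|, by positivity, fun L hL => ?_⟩
  have hLc := hL.continuous
  have hLd : ∀ u x, |L (u - x) - L u| ≤ ‖x‖ := fun u x => by
    have := hL.dist_le_mul (u - x) u
    simpa [Real.dist_eq, dist_eq_norm] using this
  have hint0 : ∀ u : E, Integrable (fun x => Real.exp (-L (u - x)) * expKernel x) := by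
    intro u
    refine (hI.const_mul (Real.exp (-L u))).mono'
      (by have := continuous_expKernel (E := E)
          exact (by fun_prop : Continuous fun x : E =>
            Real.exp (-L (u - x)) * expKernel x).aestronglyMeasurable)
      (Eventually.of_forall fun x => ?_)
    rw [Real.norm_eq_abs, abs_of_pos (mul_pos (Real.exp_pos _) (expKernel_pos x)), ← mul_assoc,
      ← Real.exp_add]
    exact mul_le_mul_of_nonneg_right (Real.exp_le_exp.mpr (by linarith [(abs_le.mp (hLd u x)).1]))
      (expKernel_pos x).le
  have hswap : ∀ u : E, (fun v => Real.exp (-L v) * expKernel (u - v)) =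
      fun v => (fun x => Real.exp (-L (u - x)) * expKernel x) (u - v) := by
    intro u; ext v; simp
  have hint : ∀ u : E, Integrable (fun v => Real.exp (-L v) * expKernel (u - v)) := by
    intro u
    rw [hswap u]
    exact (hint0 u).comp_sub_left u
  -- In this convolution all derivatives fall on the kernel. Since `|L (u - x) - L u| ≤ ‖x‖`, its
  -- ratio to `exp (-L u)` lies between `c2` and `c1`, whatever `L` is.
  refine ⟨fun u => ∫ v, Real.exp (-L v) * expKernel (u - v), fun u w => ?_, fun u => ?_⟩
  · have hae : ∀ f : E → ℝ, Continuous f → ∀ t : ℝ,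
        AEStronglyMeasurable (fun v => Real.exp (-L v) * f (u - v + t • w)) volume := by
      intro f hf t
      exact (by fun_prop : Continuous fun v => Real.exp (-L v) * f (u - v + t • w)).aestronglyMeasurable
    have hab : ∀ (v : E) (a b c : ℝ), |a| ≤ b * c →
        |Real.exp (-L v) * a| ≤ b * (Real.exp (-L v) * c) := by
      intro v a b c h
      rw [abs_mul, abs_of_pos (Real.exp_pos _)]
      nlinarith [Real.exp_pos (-L v)]
    have hre : ∀ (t : ℝ) (v : E), u + t • w - v = u - v + t • w := fun t v => by abel
    simp_rw [hre]
    refine RelSmooth.integral hne (by positivity)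
      (F1 := fun t v => Real.exp (-L v) * expKernelD1 (u - v + t • w) w)
      (F2 := fun t v => Real.exp (-L v) * expKernelD2 (u - v + t • w) w)
      (F3 := fun t v => Real.exp (-L v) * expKernelD3 (u - v + t • w) w)
      (hae _ continuous_expKernel) (hae (fun x => expKernelD1 x w) ?_)
      (hae (fun x => expKernelD2 x w) ?_) (hae (fun x => expKernelD3 x w) ?_)
      (fun t => ?_) (fun t v => mul_pos (Real.exp_pos _) (expKernel_pos _))
      (fun t v => (hasDerivAt_expKernel _ w t).const_mul _)
      (fun t v => (hasDerivAt_expKernelD1 _ w t).const_mul _)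
      (fun t v => (hasDerivAt_expKernelD2 _ w t).const_mul _)
      (fun t v => hab _ _ _ _ (abs_expKernelD1_le _ _))
      (fun t v => hab _ _ _ _ (abs_expKernelD2_le _ _))
      (fun t v => hab _ _ _ _ (abs_expKernelD3_le _ _))
    · have := continuous_expKernel (E := E)
      have := continuous_bracketD1 w
      unfold expKernelD1; fun_prop
    · have := continuous_expKernel (E := E)
      have := continuous_bracketD1 w
      have := continuous_bracketD2 w
      unfold expKernelD2; fun_prop
    · have := continuous_expKernel (E := E)
      have := continuous_bracketD1 w
      have := continuous_bracketD2 w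
      have := continuous_bracketD3 w
      unfold expKernelD3; fun_prop
    · simp_rw [← hre]
      exact hint _
  · beta_reduce
    have e1 : ∫ v, Real.exp (-L v) * expKernel (u - v) =
        ∫ x, Real.exp (-L (u - x)) * expKernel x := by
      rw [hswap u]
      exact integral_sub_left_eq_self (fun x => Real.exp (-L (u - x)) * expKernel x) volume u
    rw [e1]
    have hup : ∫ x, Real.exp (-L (u - x)) * expKernel x ≤ Real.exp (-L u) * c1 := by
      rw [← integral_const_mul]
      refine integral_mono (hint0 u) (hI.const_mul _) fun x => ?_
      simp only
      rw [← mul_assoc, ← Real.exp_add]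
      exact mul_le_mul_of_nonneg_right (Real.exp_le_exp.mpr (by linarith [(abs_le.mp (hLd u x)).1]))
        (expKernel_pos x).le
    have hlo : Real.exp (-L u) * c2 ≤ ∫ x, Real.exp (-L (u - x)) * expKernel x := by
      rw [← integral_const_mul]
      refine integral_mono (hI'.const_mul _) (hint0 u) fun x => ?_
      simp only
      rw [← mul_assoc, ← Real.exp_add]
      exact mul_le_mul_of_nonneg_right (Real.exp_le_exp.mpr (by linarith [(abs_le.mp (hLd u x)).2]))
        (expKernel_pos x).le
    have hpos : 0 < Real.exp (-L u) * c2 := mul_pos (Real.exp_pos _) hc2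
    have h1 := Real.log_le_log hpos hlo
    have h2 := Real.log_le_log (hpos.trans_le hlo) hup
    rw [Real.log_mul (Real.exp_pos _).ne' hc2.ne', Real.log_exp] at h1
    rw [Real.log_mul (Real.exp_pos _).ne' hc1.ne', Real.log_exp] at h2
    rw [abs_le]
    constructor
    · linarith [neg_abs_le (Real.log c2), abs_nonneg (Real.log c1)]
    · linarith [le_abs_self (Real.log c1), abs_nonneg (Real.log c2)]

/-- Rescaling space by `Λ` reduces to Lipschitz constant one. The point is that `C` does not depend
on `Λ`: with `L` equal to `β` times a loss, the error per observation is `C / β` after division by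
`β`. -/
theorem exists_smooth_weight : ∃ C : ℝ, 0 ≤ C ∧ ∀ (Λ : ℝ≥0) (L : E → ℝ), 0 < Λ → LipschitzWith Λ L →
    ∃ W : E → ℝ, (∀ u w, RelSmooth (6 * Λ * ‖w‖) fun t => W (u + t • w)) ∧
      ∀ u, |Real.log (W u) + L u| ≤ C := by
  obtain ⟨C, hC, h⟩ := exists_smooth_weight_one (E := E)
  refine ⟨C, hC, fun Λ L hΛ hL => ?_⟩
  have hΛ' : (0 : ℝ) < Λ := hΛ
  have hL1 : LipschitzWith 1 (fun u : E => L ((Λ : ℝ)⁻¹ • u)) := by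
    refine LipschitzWith.of_dist_le_mul fun x y => ?_
    refine (hL.dist_le_mul _ _).trans (le_of_eq ?_)
    rw [dist_smul₀, Real.norm_eq_abs, abs_of_pos (by positivity)]
    simp [hΛ'.ne']
  obtain ⟨W, hW, hWL⟩ := h _ hL1
  refine ⟨fun u => W ((Λ : ℝ) • u), fun u w => ?_, fun u => ?_⟩
  · have := hW ((Λ : ℝ) • u) ((Λ : ℝ) • w)
    rw [norm_smul, Real.norm_eq_abs, abs_of_pos hΛ', ← mul_assoc] at this
    convert this using 3 with t
    rw [smul_add, smul_comm]
  · have := hWL ((Λ : ℝ) • u)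
    rwa [smul_smul, inv_mul_cancel₀ hΛ'.ne', one_smul] at this

end Kernel

/-! ### Taylor expansion of a smooth function of a free energy -/

/-- A bounded function on the line with three bounded derivatives. -/
def SmoothBounded (B : ℝ) (ψ : ℝ → ℝ) : Prop :=
  (∀ x, |ψ x| ≤ B) ∧ ∃ ψ1 ψ2 ψ3 : ℝ → ℝ, (∀ x, HasDerivAt ψ (ψ1 x) x) ∧
    (∀ x, HasDerivAt ψ1 (ψ2 x) x) ∧ (∀ x, HasDerivAt ψ2 (ψ3 x) x) ∧
    ∀ x, |ψ1 x| ≤ B ∧ |ψ2 x| ≤ B ∧ |ψ3 x| ≤ B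

theorem abs_sub_le_of_abs_deriv_le {f f1 : ℝ → ℝ} {M t : ℝ} (hf : ∀ s, HasDerivAt f (f1 s) s)
    (hb : ∀ s, |s| ≤ |t| → |f1 s| ≤ M) {s : ℝ} (hs : |s| ≤ |t|) : |f s - f 0| ≤ M * |s| := by
  have h := Convex.norm_image_sub_le_of_norm_hasDerivWithin_le (f := f) (f' := f1)
    (C := M) (s := Set.Icc (-|t|) |t|) (x := 0) (y := s) (fun x _ => (hf x).hasDerivWithinAt)
    (fun x hx => hb x (abs_le.mpr hx)) (convex_Icc _ _)
    ⟨by linarith [abs_nonneg t], abs_nonneg t⟩ (abs_le.mp hs)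
  simpa using h

/-- Three applications of the mean value inequality, which give the constant `1` in place of `1/6`.
The bound on `f3` is needed only between `-|t|` and `|t|`. -/
theorem abs_taylor_two_remainder_le {f f1 f2 f3 : ℝ → ℝ} {M t : ℝ} (hM : 0 ≤ M)
    (h0 : ∀ s, HasDerivAt f (f1 s) s) (h1 : ∀ s, HasDerivAt f1 (f2 s) s)
    (h2 : ∀ s, HasDerivAt f2 (f3 s) s) (hb : ∀ s, |s| ≤ |t| → |f3 s| ≤ M) :
    |f t - f 0 - t * f1 0 - t ^ 2 / 2 * f2 0| ≤ M * |t| ^ 3 := by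
  have a2 : ∀ s, |s| ≤ |t| → |f2 s - f2 0| ≤ M * |t| := fun s hs =>
    (abs_sub_le_of_abs_deriv_le h2 hb hs).trans (mul_le_mul_of_nonneg_left hs hM)
  have d1 : ∀ s, HasDerivAt (fun s => f1 s - s * f2 0) (f2 s - f2 0) s := fun s =>
    ((h1 s).sub ((hasDerivAt_id s).mul_const (f2 0))).congr_deriv (by simp)
  have a1 : ∀ s, |s| ≤ |t| → |f1 s - f1 0 - s * f2 0| ≤ M * |t| * |t| := fun s hs => by
    have := abs_sub_le_of_abs_deriv_le d1 a2 hs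
    have h : f1 s - f1 0 - s * f2 0 = f1 s - s * f2 0 - (f1 0 - 0 * f2 0) := by ring
    rw [h]
    exact this.trans (mul_le_mul_of_nonneg_left hs (by positivity))
  have d0 : ∀ s, HasDerivAt (fun s => f s - s * f1 0 - s ^ 2 / 2 * f2 0)
      (f1 s - f1 0 - s * f2 0) s := fun s => by
    have := ((h0 s).sub ((hasDerivAt_id s).mul_const (f1 0))).sub
      ((((hasDerivAt_id s).pow 2).div_const 2).mul_const (f2 0))
    refine this.congr_deriv ?_
    simp
  have := abs_sub_le_of_abs_deriv_le d0 a1 (s := t) le_rfl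
  simp only [zero_mul, sub_zero] at this
  calc _ = |f t - t * f1 0 - t ^ 2 / 2 * f2 0 - (f 0 - 0 ^ 2 / 2 * f2 0)| := by
        congr 1; ring
    _ ≤ _ := this
    _ = _ := by ring

section Gibbs

variable {M : Type*} [Fintype M] {w a : M → ℝ}

theorem weighted_pow_three_le (hw : ∀ m, 0 ≤ w m) (hw1 : ∑ m, w m = 1) (ha : ∀ m, 0 ≤ a m) :
    (∑ m, w m * a m) ^ 3 ≤ ∑ m, w m * a m ^ 3 :=
  Real.pow_arith_mean_le_arith_mean_pow Finset.univ w a (fun m _ => hw m) hw1 (fun m _ => ha m) 3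

/-- Expand into a double sum and use `x y² ≤ x³/3 + 2y³/3`. -/
theorem weighted_mul_sq_le (hw : ∀ m, 0 ≤ w m) (hw1 : ∑ m, w m = 1) (ha : ∀ m, 0 ≤ a m) :
    (∑ m, w m * a m) * (∑ m, w m * a m ^ 2) ≤ ∑ m, w m * a m ^ 3 := by
  rw [Finset.sum_mul_sum]
  have h : ∀ m m', w m * a m * (w m' * a m' ^ 2) ≤
      (w m * a m ^ 3) * w m' / 3 + 2 * (w m * (w m' * a m' ^ 3)) / 3 := by
    intro m m'
    have hx := ha m
    have hy := ha m'
    have : a m * a m' ^ 2 ≤ a m ^ 3 / 3 + 2 * a m' ^ 3 / 3 := by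
      nlinarith [mul_nonneg (add_nonneg hx (mul_nonneg zero_le_two hy)) (sq_nonneg (a m - a m'))]
    nlinarith [mul_le_mul_of_nonneg_left this (mul_nonneg (hw m) (hw m'))]
  refine (Finset.sum_le_sum fun m _ => Finset.sum_le_sum fun m' _ => h m m').trans (le_of_eq ?_)
  simp_rw [Finset.sum_add_distrib, ← Finset.sum_div, ← Finset.mul_sum, ← Finset.sum_mul]
  rw [hw1]
  ring

end Gibbs

/-- The left side is the third derivative of `ψ (-(log Z) / N)`, with `rⱼ` for `Z⁽ʲ⁾ / Z` and `pⱼ`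
for the derivatives of `ψ`. As `N ≥ 1`, the powers `N⁻²` and `N⁻³` are at most `N⁻¹`; the constant
is `13 = 1 + 3 · 2 + 6`. -/
theorem abs_logDeriv_chain_le {B N A1 A2 A3 r1 r2 r3 p1 p2 p3 : ℝ} (hB : 0 ≤ B) (hN : 1 ≤ N)
    (hr1 : |r1| ≤ A1) (hr2 : |r2| ≤ A2) (hr3 : |r3| ≤ A3) (h12 : A1 * A2 ≤ A3) (h13 : A1 ^ 3 ≤ A3)
    (hp1 : |p1| ≤ B) (hp2 : |p2| ≤ B) (hp3 : |p3| ≤ B) :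
    |-(p3 * (r1 / N) ^ 3) + 3 * p2 * (r1 / N) * ((r2 - r1 ^ 2) / N)
      - p1 * ((r3 - 3 * r1 * r2 + 2 * r1 ^ 3) / N)| ≤ 13 * B / N * A3 := by
  have hA1 : 0 ≤ A1 := (abs_nonneg _).trans hr1
  have hA3 : 0 ≤ A3 := (abs_nonneg _).trans hr3
  have e1 : |r1 ^ 3| ≤ A3 := by
    rw [abs_pow]; exact (pow_le_pow_left₀ (abs_nonneg _) hr1 3).trans h13
  have e2 : |r1 * r2| ≤ A3 := by
    rw [abs_mul]; exact (mul_le_mul hr1 hr2 (abs_nonneg _) hA1).trans h12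
  have b1 := abs_le.mp e1
  have b2 := abs_le.mp e2
  have b3 := abs_le.mp hr3
  have u1 : |p3 * r1 ^ 3| ≤ B * A3 := by
    rw [abs_mul]; exact mul_le_mul hp3 e1 (abs_nonneg _) hB
  have u2 : |p2 * (r1 * r2 - r1 ^ 3)| ≤ B * (2 * A3) := by
    rw [abs_mul]
    exact mul_le_mul hp2 (abs_le.mpr ⟨by linarith, by linarith⟩) (abs_nonneg _) hB
  have u3 : |p1 * (r3 - 3 * r1 * r2 + 2 * r1 ^ 3)| ≤ B * (6 * A3) := by
    rw [abs_mul]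
    exact mul_le_mul hp1 (abs_le.mpr ⟨by linarith, by linarith⟩) (abs_nonneg _) hB
  have hN0 : 0 < N := by linarith
  have hi : N⁻¹ ≤ 1 := inv_le_one_of_one_le₀ hN
  have hi0 : 0 < N⁻¹ := by positivity
  have hi2 : N⁻¹ ^ 2 ≤ N⁻¹ := by nlinarith
  have hi3 : N⁻¹ ^ 3 ≤ N⁻¹ := by nlinarith
  have eq : -(p3 * (r1 / N) ^ 3) + 3 * p2 * (r1 / N) * ((r2 - r1 ^ 2) / N)
      - p1 * ((r3 - 3 * r1 * r2 + 2 * r1 ^ 3) / N) =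
      -(N⁻¹ ^ 3 * (p3 * r1 ^ 3)) + 3 * (N⁻¹ ^ 2 * (p2 * (r1 * r2 - r1 ^ 3)))
      - N⁻¹ * (p1 * (r3 - 3 * r1 * r2 + 2 * r1 ^ 3)) := by
    simp only [div_eq_mul_inv]; ring
  have v1 : |N⁻¹ ^ 3 * (p3 * r1 ^ 3)| ≤ N⁻¹ * (B * A3) := by
    rw [abs_mul, abs_of_pos (by positivity : 0 < N⁻¹ ^ 3)]
    exact mul_le_mul hi3 u1 (abs_nonneg _) hi0.le
  have v2 : |N⁻¹ ^ 2 * (p2 * (r1 * r2 - r1 ^ 3))| ≤ N⁻¹ * (B * (2 * A3)) := by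
    rw [abs_mul, abs_of_pos (by positivity : 0 < N⁻¹ ^ 2)]
    exact mul_le_mul hi2 u2 (abs_nonneg _) hi0.le
  have v3 : |N⁻¹ * (p1 * (r3 - 3 * r1 * r2 + 2 * r1 ^ 3))| ≤ N⁻¹ * (B * (6 * A3)) := by
    rw [abs_mul, abs_of_pos hi0]
    exact mul_le_mul_of_nonneg_left u3 hi0.le
  rw [eq]
  have w1 := abs_le.mp v1
  have w2 := abs_le.mp v2
  have w3 := abs_le.mp v3
  have : 13 * B / N * A3 = N⁻¹ * (B * A3) + 3 * (N⁻¹ * (B * (2 * A3))) + N⁻¹ * (B * (6 * A3)) := by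
    rw [div_eq_mul_inv]; ring
  rw [this, abs_le]
  constructor <;> linarith

/-- Second-order Taylor expansion of a smooth function of a free energy; the remainder is controlled
by a Gibbs average of the cubes of the smoothness parameters. -/
theorem freeEnergy_taylor {M : Type*} [Fintype M] [Nonempty M] {B N abar : ℝ} {ψ : ℝ → ℝ}
    (hB : 0 ≤ B) (hψ : SmoothBounded B ψ) (hN : 1 ≤ N) {c a : M → ℝ} (hc : ∀ m, 0 < c m)
    (ha : ∀ m, 0 ≤ a m) (hab : ∀ m, a m ≤ abar) {f : M → ℝ → ℝ} (hf : ∀ m, RelSmooth (a m) (f m)) :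
    ∃ h1 h2 : ℝ, ∀ t, |ψ (-(Real.log (∑ m, c m * f m t) / N))
        - ψ (-(Real.log (∑ m, c m * f m 0) / N)) - t * h1 - t ^ 2 / 2 * h2| ≤
      13 * B / N * (Real.exp (2 * abar * |t|) *
        ((∑ m, c m * f m 0 * a m ^ 3) / ∑ m, c m * f m 0)) * |t| ^ 3 := by
  obtain ⟨-, ψ1, ψ2, ψ3, dψ, dψ1, dψ2, bψ⟩ := hψ
  have hpos := fun m => (hf m).1
  choose f1 f2 f3 d0 d1 d2 hb using fun m => (hf m).2
  set Z := fun t => ∑ m, c m * f m t with hZ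
  set Z1 := fun t => ∑ m, c m * f1 m t with hZ1
  set Z2 := fun t => ∑ m, c m * f2 m t with hZ2
  set Z3 := fun t => ∑ m, c m * f3 m t with hZ3
  have hZpos : ∀ t, 0 < Z t := fun t =>
    Finset.sum_pos (fun m _ => mul_pos (hc m) (hpos m t)) Finset.univ_nonempty
  have dZ : ∀ t, HasDerivAt Z (Z1 t) t := fun t =>
    HasDerivAt.fun_sum fun m _ => (d0 m t).const_mul (c m)
  have dZ1 : ∀ t, HasDerivAt Z1 (Z2 t) t := fun t =>
    HasDerivAt.fun_sum fun m _ => (d1 m t).const_mul (c m)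
  have dZ2 : ∀ t, HasDerivAt Z2 (Z3 t) t := fun t =>
    HasDerivAt.fun_sum fun m _ => (d2 m t).const_mul (c m)
  set r1 := fun t => Z1 t / Z t with hr1
  set r2 := fun t => Z2 t / Z t with hr2
  set r3 := fun t => Z3 t / Z t with hr3
  have dr1 : ∀ t, HasDerivAt r1 (r2 t - r1 t ^ 2) t := fun t => by
    refine ((dZ1 t).div (dZ t) (hZpos t).ne').congr_deriv ?_
    have := (hZpos t).ne'
    simp only [hr1, hr2]
    field_simp
  have dr2 : ∀ t, HasDerivAt r2 (r3 t - r2 t * r1 t) t := fun t => by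
    refine ((dZ2 t).div (dZ t) (hZpos t).ne').congr_deriv ?_
    have := (hZpos t).ne'
    simp only [hr1, hr2, hr3]
    field_simp
  set F := fun t => -(Real.log (Z t) / N) with hF
  have dF : ∀ t, HasDerivAt F (-(r1 t / N)) t := fun t =>
    (((dZ t).log (hZpos t).ne').div_const N).neg
  set h0 := fun t => ψ (F t) with hh0
  set h1 := fun t => -(ψ1 (F t) * (r1 t / N)) with hh1
  set h2 := fun t => ψ2 (F t) * (r1 t / N) ^ 2 - ψ1 (F t) * ((r2 t - r1 t ^ 2) / N) with hh2
  set h3 := fun t => -(ψ3 (F t) * (r1 t / N) ^ 3) + 3 * ψ2 (F t) * (r1 t / N) *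
    ((r2 t - r1 t ^ 2) / N) - ψ1 (F t) * ((r3 t - 3 * r1 t * r2 t + 2 * r1 t ^ 3) / N) with hh3
  have dh0 : ∀ t, HasDerivAt h0 (h1 t) t := fun t => by
    refine ((dψ (F t)).comp t (dF t)).congr_deriv ?_
    simp only [hh1]; ring
  have dψ1F : ∀ t, HasDerivAt (fun t => ψ1 (F t)) (ψ2 (F t) * -(r1 t / N)) t := fun t =>
    (dψ1 (F t)).comp t (dF t)
  have dψ2F : ∀ t, HasDerivAt (fun t => ψ2 (F t)) (ψ3 (F t) * -(r1 t / N)) t := fun t =>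
    (dψ2 (F t)).comp t (dF t)
  have dh1 : ∀ t, HasDerivAt h1 (h2 t) t := fun t => by
    refine ((dψ1F t).mul ((dr1 t).div_const N)).neg.congr_deriv ?_
    simp only [hh2]; ring
  have dh2 : ∀ t, HasDerivAt h2 (h3 t) t := fun t => by
    refine (((dψ2F t).mul (((dr1 t).div_const N).pow 2)).sub ((dψ1F t).mul
      (((dr2 t).sub ((dr1 t).pow 2)).div_const N))).congr_deriv ?_
    simp only [hh3, Pi.pow_apply, Pi.sub_apply, Nat.cast_ofNat]; ring
  refine ⟨h1 0, h2 0, fun t => ?_⟩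
  set D := (∑ m, c m * f m 0 * a m ^ 3) / ∑ m, c m * f m 0 with hD
  have hD0 : 0 ≤ D := div_nonneg (Finset.sum_nonneg fun m _ =>
    mul_nonneg (mul_pos (hc m) (hpos m 0)).le (pow_nonneg (ha m) 3)) (hZpos 0).le
  have habar : 0 ≤ abar := (ha (Classical.arbitrary M)).trans (hab _)
  refine abs_taylor_two_remainder_le (by positivity) dh0 dh1 dh2 fun s hs => ?_
  -- The Gibbs weights at `s`: each `Z⁽ʲ⁾ / Z` is at most the Gibbs average of `a m ^ j`.
  set w := fun m => c m * f m s / Z s with hw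
  have hw0 : ∀ m, 0 ≤ w m := fun m => (div_pos (mul_pos (hc m) (hpos m s)) (hZpos s)).le
  have hw1 : ∑ m, w m = 1 := by
    simp only [hw]
    rw [← Finset.sum_div]; exact div_self (hZpos s).ne'
  have hrb : ∀ (g : M → ℝ → ℝ) (j : ℕ), (∀ m, |g m s| ≤ a m ^ j * f m s) →
      |(∑ m, c m * g m s) / Z s| ≤ ∑ m, w m * a m ^ j := by
    intro g j hg
    rw [Finset.sum_div]
    refine (Finset.abs_sum_le_sum_abs _ _).trans (Finset.sum_le_sum fun m _ => ?_)
    rw [abs_div, abs_mul, abs_of_pos (hc m), abs_of_pos (hZpos s)]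
    simp only [hw]
    rw [div_mul_eq_mul_div]
    refine div_le_div_of_nonneg_right ?_ (hZpos s).le
    have := mul_le_mul_of_nonneg_left (hg m) (hc m).le
    linarith
  -- Passing from `s` back to `0` costs `exp (abar * |t|)` in the numerator and again in the
  -- partition function.
  have hA3 : ∑ m, w m * a m ^ 3 ≤ Real.exp (2 * abar * |t|) * D := by
    have hst : ∀ m, a m * |s| ≤ abar * |t| := fun m =>
      mul_le_mul (hab m) hs (abs_nonneg _) habar
    have n1 : ∀ m, f m s ≤ Real.exp (abar * |t|) * f m 0 := fun m => by
      refine ((hf m).le_exp 0 s).trans (mul_le_mul_of_nonneg_right ?_ (hpos m 0).le)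
      rw [sub_zero]; exact Real.exp_le_exp.mpr (hst m)
    have n2 : ∀ m, f m 0 ≤ Real.exp (abar * |t|) * f m s := fun m => by
      refine ((hf m).le_exp s 0).trans (mul_le_mul_of_nonneg_right ?_ (hpos m s).le)
      rw [zero_sub, abs_neg]; exact Real.exp_le_exp.mpr (hst m)
    have z : Z 0 ≤ Real.exp (abar * |t|) * Z s := by
      simp only [hZ, Finset.mul_sum]
      refine Finset.sum_le_sum fun m _ => ?_
      have := mul_le_mul_of_nonneg_left (n2 m) (hc m).le
      linarith
    have y : ∑ m, c m * f m s * a m ^ 3 ≤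
        Real.exp (abar * |t|) * ∑ m, c m * f m 0 * a m ^ 3 := by
      rw [Finset.mul_sum]
      refine Finset.sum_le_sum fun m _ => ?_
      have := mul_le_mul_of_nonneg_right (mul_le_mul_of_nonneg_left (n1 m) (hc m).le)
        (pow_nonneg (ha m) 3)
      linarith
    have e : ∑ m, w m * a m ^ 3 = (∑ m, c m * f m s * a m ^ 3) / Z s := by
      rw [Finset.sum_div]; exact Finset.sum_congr rfl fun m _ => by simp only [hw]; ring
    have hS0 : 0 ≤ ∑ m, c m * f m 0 * a m ^ 3 := Finset.sum_nonneg fun m _ =>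
      mul_nonneg (mul_pos (hc m) (hpos m 0)).le (pow_nonneg (ha m) 3)
    rw [e, hD, div_le_iff₀ (hZpos s)]
    have hexp : Real.exp (2 * abar * |t|) = Real.exp (abar * |t|) * Real.exp (abar * |t|) := by
      rw [← Real.exp_add]; ring_nf
    refine y.trans ?_
    rw [hexp, mul_assoc, mul_assoc]
    refine mul_le_mul_of_nonneg_left ?_ (Real.exp_pos _).le
    have : 0 < ∑ m, c m * f m 0 := hZpos 0
    rw [div_mul_eq_mul_div, mul_div_assoc', le_div_iff₀ this]
    have := mul_le_mul_of_nonneg_left z hS0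
    linarith
  refine (abs_logDeriv_chain_le hB hN (hrb f1 1 fun m => by simpa using (hb m s).1)
    (hrb f2 2 fun m => (hb m s).2.1)
    (hrb f3 3 fun m => (hb m s).2.2) (by simpa using weighted_mul_sq_le hw0 hw1 ha)
    (by simpa using weighted_pow_three_le hw0 hw1 ha) (bψ (F s)).1 (bψ (F s)).2.1
    (bψ (F s)).2.2).trans ?_
  exact mul_le_mul_of_nonneg_left hA3 (by positivity)

/-! ### Lindeberg exchange in a product measure -/

section Lindeberg

variable {ι E : Type*} [DecidableEq ι] [MeasurableSpace E]

theorem isProbabilityMeasure_update (ν : ι → Measure E) [∀ i, IsProbabilityMeasure (ν i)]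
    (k : ι) (ρ : Measure E) [IsProbabilityMeasure ρ] (i : ι) :
    IsProbabilityMeasure (Function.update ν k ρ i) := by
  rcases eq_or_ne i k with rfl | h
  · simpa
  · rw [Function.update_of_ne h]; infer_instance

variable [Fintype ι]

theorem map_update_prod_pi (ν : ι → Measure E) [∀ i, IsProbabilityMeasure (ν i)]
    (k : ι) (ρ : Measure E) [IsProbabilityMeasure ρ] :
    ((Measure.pi ν).prod ρ).map (fun p => Function.update p.1 k p.2) =
      Measure.pi (Function.update ν k ρ) := by
  have := isProbabilityMeasure_update ν k ρ
  symm
  refine Measure.pi_eq fun s hs => ?_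
  rw [Measure.map_apply measurable_update' (MeasurableSet.univ_pi hs)]
  -- The overwritten coordinate is unconstrained, so it contributes mass one, and the condition on
  -- it passes to the fresh sample.
  have hpre : (fun p : (ι → E) × E => Function.update p.1 k p.2) ⁻¹' (Set.univ.pi s) =
      (Set.univ.pi (Function.update s k Set.univ)) ×ˢ s k := by
    ext ⟨y, t⟩
    simp only [Set.mem_preimage, Set.mem_pi, Set.mem_univ, true_implies, Set.mem_prod]
    constructor
    · intro h
      refine ⟨fun i => ?_, by simpa using h k⟩
      rcases eq_or_ne i k with rfl | hi
      · simp
      · simpa [Function.update_of_ne hi] using h i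
    · rintro ⟨h1, h2⟩ i
      rcases eq_or_ne i k with rfl | hi
      · simpa using h2
      · simpa [Function.update_of_ne hi] using h1 i
  rw [hpre, Measure.prod_prod, Measure.pi_pi, ← Finset.mul_prod_erase _ _ (Finset.mem_univ k),
    ← Finset.mul_prod_erase _ _ (Finset.mem_univ k)]
  simp only [Function.update_self, measure_univ, one_mul]
  rw [mul_comm]
  congr 1
  refine Finset.prod_congr rfl fun i hi => ?_
  rw [Function.update_of_ne (Finset.ne_of_mem_erase hi),
    Function.update_of_ne (Finset.ne_of_mem_erase hi)]

theorem integral_pi_update (ν : ι → Measure E) [∀ i, IsProbabilityMeasure (ν i)]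
    (k : ι) (ρ : Measure E) [IsProbabilityMeasure ρ] {f : (ι → E) → ℝ} (hf : Measurable f)
    {B : ℝ} (hB : ∀ y, |f y| ≤ B) :
    ∫ y, f y ∂Measure.pi (Function.update ν k ρ) =
      ∫ y, ∫ t, f (Function.update y k t) ∂ρ ∂Measure.pi ν := by
  rw [← map_update_prod_pi, integral_map measurable_update'.aemeasurable hf.aestronglyMeasurable,
    integral_prod]
  exact Integrable.of_bound (hf.comp measurable_update').aestronglyMeasurable B
    (Eventually.of_forall fun p => hB _)

/-- Replacing the factors of a product measure one at a time. -/
theorem lindeberg_swap {μ γ : Measure E} [IsProbabilityMeasure μ] [IsProbabilityMeasure γ]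
    {f : (ι → E) → ℝ} (hf : Measurable f) {B : ℝ} (hB : ∀ y, |f y| ≤ B) {b : ι → ℝ}
    (h : ∀ (k : ι) (ν : ι → Measure E), (∀ i, ν i = μ ∨ ν i = γ) →
      |(∫ y, ∫ t, f (Function.update y k t) ∂μ ∂Measure.pi ν) -
        ∫ y, ∫ t, f (Function.update y k t) ∂γ ∂Measure.pi ν| ≤ b k) :
    |(∫ y, f y ∂Measure.pi (fun _ => μ)) - ∫ y, f y ∂Measure.pi (fun _ => γ)| ≤ ∑ k, b k := by
  -- Induction on the set `s` of coordinates already switched to `γ`; a new `k ∉ s` still has law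
  -- `μ`, so both sides of the step are updates of the same family at `k`.
  have key : ∀ s : Finset ι, |(∫ y, f y ∂Measure.pi (fun _ => μ)) -
      ∫ y, f y ∂Measure.pi (fun i => if i ∈ s then γ else μ)| ≤ ∑ k ∈ s, b k := by
    intro s
    induction s using Finset.induction_on with
    | empty => simp
    | insert k s hk ih =>
      set ν : ι → Measure E := fun i => if i ∈ s then γ else μ with hν
      have hνp : ∀ i, IsProbabilityMeasure (ν i) := fun i => by
        simp only [hν]; split_ifs <;> infer_instance
      have e1 : ν = Function.update ν k μ := by
        rw [eq_comm, Function.update_eq_self_iff]; simp [hν, hk]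
      have e2 : (fun i => if i ∈ insert k s then γ else μ) = Function.update ν k γ := by
        ext1 i
        rcases eq_or_ne i k with rfl | hi
        · simp
        · simp [hν, hi]
      have h1 := h k ν fun i => by
        simp only [hν]; split_ifs <;> simp
      rw [← integral_pi_update ν k μ hf hB, ← integral_pi_update ν k γ hf hB, ← e1, ← e2] at h1
      rw [Finset.sum_insert hk, add_comm]
      refine (abs_sub_le _ (∫ y, f y ∂Measure.pi ν) _).trans (add_le_add ih h1)
  simpa using key Finset.univ

end Lindeberg

/-! ### Exponential moments of linear forms in independent centered variables -/

/-- A centered law on the line with exponential moments bounded by `A`. -/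
structure ExpBounded (A : ℝ → ℝ) (μ : Measure ℝ) : Prop where
  prob : IsProbabilityMeasure μ
  integrable : ∀ Λ, 0 ≤ Λ → Integrable (fun x => Real.exp (Λ * |x|)) μ
  le : ∀ Λ, 0 ≤ Λ → ∫ x, Real.exp (Λ * |x|) ∂μ ≤ A Λ
  mean : ∫ x, x ∂μ = 0

theorem Real.abs_exp_sub_one_sub_le (x : ℝ) : |Real.exp x - 1 - x| ≤ x ^ 2 * Real.exp |x| := by
  have h := Complex.norm_exp_sub_sum_le_norm_mul_exp (x : ℂ) 2
  simp only [Finset.sum_range_succ, Finset.sum_range_zero] at h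
  norm_num at h
  rw [← sub_sub] at h
  have e : (Complex.exp x - 1 - x) = ((Real.exp x - 1 - x : ℝ) : ℂ) := by push_cast; rfl
  rw [e, Complex.norm_real] at h
  simpa using h

theorem sq_le_two_mul_exp_abs (x : ℝ) : x ^ 2 ≤ 2 * Real.exp |x| := by
  have := Real.pow_div_factorial_le_exp |x| (abs_nonneg x) 2
  rw [sq_abs] at this
  norm_num [Nat.factorial] at this
  linarith

theorem abs_pow_three_le_exp (x : ℝ) : |x| ^ 3 ≤ 6 * Real.exp |x| := by
  have := Real.pow_div_factorial_le_exp |x| (abs_nonneg x) 3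
  norm_num [Nat.factorial] at this
  linarith

namespace ExpBounded

variable {A : ℝ → ℝ} {μ : Measure ℝ}

theorem nonneg (h : ExpBounded A μ) {Λ : ℝ} (hΛ : 0 ≤ Λ) : 0 ≤ A Λ :=
  (integral_nonneg fun _ => (Real.exp_pos _).le).trans (h.le Λ hΛ)

theorem integrable_of_le (h : ExpBounded A μ) {f : ℝ → ℝ} (hf : Continuous f) {c Λ : ℝ}
    (hΛ : 0 ≤ Λ) (hb : ∀ x, |f x| ≤ c * Real.exp (Λ * |x|)) : Integrable f μ :=
  ((h.integrable Λ hΛ).const_mul c).mono' hf.aestronglyMeasurable (Eventually.of_forall hb)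

theorem integrable_id (h : ExpBounded A μ) : Integrable (fun x => x) μ :=
  h.integrable_of_le continuous_id (c := 1) (Λ := 1) zero_le_one fun x => by
    have := Real.add_one_le_exp (1 * |x|); linarith

theorem integrable_sq (h : ExpBounded A μ) : Integrable (fun x => x ^ 2) μ :=
  h.integrable_of_le (by fun_prop) (c := 2) (Λ := 1) zero_le_one fun x => by
    rw [abs_of_nonneg (sq_nonneg x), one_mul]; exact sq_le_two_mul_exp_abs x

theorem integrable_exp_mul (h : ExpBounded A μ) (a : ℝ) : Integrable (fun x => Real.exp (a * x)) μ :=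
  h.integrable_of_le (by fun_prop) (c := 1) (Λ := |a|) (abs_nonneg a) fun x => by
    rw [one_mul, abs_of_pos (Real.exp_pos _), ← abs_mul]; exact Real.exp_le_exp.mpr (le_abs_self _)

/-- Centering removes the linear term, so the exponent is quadratic in `a`. This is what makes the
bounds for sums depend on `∑ a i ^ 2` and not on the number of terms. -/
theorem integral_exp_mul_le (h : ExpBounded A μ) {a Λ : ℝ} (ha : |a| ≤ Λ) :
    ∫ x, Real.exp (a * x) ∂μ ≤ Real.exp (a ^ 2 * (2 * A (Λ + 1))) := by
  have := h.prob
  have hΛ : 0 ≤ Λ + 1 := by linarith [abs_nonneg a]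
  have hb : ∀ x, Real.exp (a * x) ≤ 1 + a * x + a ^ 2 * (2 * Real.exp ((Λ + 1) * |x|)) := fun x => by
    have h1 := (abs_le.mp (Real.abs_exp_sub_one_sub_le (a * x))).2
    have h2 : Real.exp |a * x| ≤ Real.exp (Λ * |x|) := Real.exp_le_exp.mpr (by
      rw [abs_mul]; exact mul_le_mul_of_nonneg_right ha (abs_nonneg x))
    have h3 : (a * x) ^ 2 * Real.exp |a * x| ≤ a ^ 2 * (2 * Real.exp ((Λ + 1) * |x|)) := by
      rw [mul_pow, mul_assoc]
      refine mul_le_mul_of_nonneg_left ?_ (sq_nonneg a)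
      refine (mul_le_mul (sq_le_two_mul_exp_abs x) h2 (Real.exp_pos _).le (by positivity)).trans
        (le_of_eq ?_)
      rw [mul_assoc, ← Real.exp_add]; ring_nf
    linarith
  have hi2 := ((h.integrable (Λ + 1) hΛ).const_mul 2).const_mul (a ^ 2)
  have hi1 : Integrable (fun x => 1 + a * x) μ := (integrable_const 1).add (h.integrable_id.const_mul a)
  calc ∫ x, Real.exp (a * x) ∂μ
      ≤ ∫ x, (1 + a * x + a ^ 2 * (2 * Real.exp ((Λ + 1) * |x|))) ∂μ :=
        integral_mono (h.integrable_exp_mul a) (hi1.add hi2) hb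
    _ = 1 + a ^ 2 * (2 * ∫ x, Real.exp ((Λ + 1) * |x|) ∂μ) := by
        rw [integral_add hi1 hi2, integral_add (integrable_const 1) (h.integrable_id.const_mul a)]
        have e : ∫ x, a * x ∂μ = 0 := by rw [integral_const_mul, h.mean, mul_zero]
        rw [e, integral_const_mul, integral_const_mul]
        simp
    _ ≤ 1 + a ^ 2 * (2 * A (Λ + 1)) := by
        have := h.le (Λ + 1) hΛ
        gcongr
    _ ≤ _ := by linarith [Real.add_one_le_exp (a ^ 2 * (2 * A (Λ + 1)))]

/-- The two laws agree on polynomials of degree at most two, so only the cubic remainder survives.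
The constant is `12 = 6 + 6`, from `|t|³ ≤ 6 exp |t|` applied under each law. -/
theorem abs_integral_sub_le {γ : Measure ℝ} (h : ExpBounded A μ) (hγ : ExpBounded A γ)
    (hvar : ∫ x, x ^ 2 ∂μ = ∫ x, x ^ 2 ∂γ) {f : ℝ → ℝ} (hf : Continuous f) {B : ℝ}
    (hB : ∀ t, |f t| ≤ B) {h0 h1 h2 Q Λ : ℝ} (hΛ : 0 ≤ Λ) (hQ : 0 ≤ Q)
    (hR : ∀ t, |f t - h0 - t * h1 - t ^ 2 / 2 * h2| ≤ Q * Real.exp (Λ * |t|) * |t| ^ 3) :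
    |(∫ t, f t ∂μ) - ∫ t, f t ∂γ| ≤ 12 * A (Λ + 1) * Q := by
  set R := fun t => f t - h0 - t * h1 - t ^ 2 / 2 * h2 with hRdef
  have hb : ∀ t, |R t| ≤ 6 * Q * Real.exp ((Λ + 1) * |t|) := fun t => by
    refine (hR t).trans ?_
    have := mul_le_mul_of_nonneg_left (abs_pow_three_le_exp t)
      (mul_nonneg hQ (Real.exp_pos (Λ * |t|)).le)
    refine this.trans (le_of_eq ?_)
    rw [add_mul, one_mul, Real.exp_add]; ring
  have key : ∀ ρ : Measure ℝ, ExpBounded A ρ →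
      |(∫ t, f t ∂ρ) - (h0 + (∫ x, x ^ 2 ∂ρ) / 2 * h2)| ≤ 6 * Q * A (Λ + 1) := by
    intro ρ hρ
    have := hρ.prob
    have i0 : Integrable f ρ := Integrable.of_bound hf.aestronglyMeasurable B
      (Eventually.of_forall fun t => hB t)
    have i1 : Integrable (fun t => f t - h0) ρ := i0.sub (integrable_const h0)
    have i2 : Integrable (fun t : ℝ => t * h1) ρ := hρ.integrable_id.mul_const h1
    have i3 : Integrable (fun t : ℝ => t ^ 2 / 2 * h2) ρ := (hρ.integrable_sq.div_const 2).mul_const h2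
    have i12 : Integrable (fun t => f t - h0 - t * h1) ρ := i1.sub i2
    have e : ∫ t, R t ∂ρ = (∫ t, f t ∂ρ) - (h0 + (∫ x, x ^ 2 ∂ρ) / 2 * h2) := by
      simp only [hRdef]
      rw [integral_sub i12 i3, integral_sub i1 i2, integral_sub i0 (integrable_const h0),
        integral_mul_const, integral_mul_const, integral_div, hρ.mean]
      simp; ring
    rw [← e]
    refine (abs_integral_le_integral_abs).trans ?_
    have hl := hρ.le (Λ + 1) (by linarith)
    calc ∫ t, |R t| ∂ρ ≤ ∫ t, 6 * Q * Real.exp ((Λ + 1) * |t|) ∂ρ :=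
          integral_mono (i12.sub i3).abs ((hρ.integrable _ (by linarith)).const_mul _) hb
      _ = 6 * Q * ∫ t, Real.exp ((Λ + 1) * |t|) ∂ρ := integral_const_mul _ _
      _ ≤ _ := mul_le_mul_of_nonneg_left hl (by positivity)
  have k1 := abs_le.mp (key μ h)
  have k2 := abs_le.mp (key γ hγ)
  rw [hvar] at k1
  rw [abs_le]
  constructor <;> linarith

variable {ι : Type*} [Fintype ι] {ν : ι → Measure ℝ}

theorem integrable_exp_sum (h : ∀ i, ExpBounded A (ν i)) (a : ι → ℝ) :
    Integrable (fun y : ι → ℝ => Real.exp (∑ i, a i * y i)) (Measure.pi ν) := by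
  have := fun i => (h i).prob
  simp_rw [Real.exp_sum]
  exact Integrable.fintype_prod (f := fun i x => Real.exp (a i * x))
    fun i => (h i).integrable_exp_mul (a i)

theorem integral_exp_sum_le (h : ∀ i, ExpBounded A (ν i)) {a : ι → ℝ} {Λ V : ℝ}
    (ha : ∀ i, |a i| ≤ Λ) (hV : ∑ i, a i ^ 2 ≤ V) (hA : 0 ≤ A (Λ + 1)) :
    ∫ y, Real.exp (∑ i, a i * y i) ∂Measure.pi ν ≤ Real.exp (V * (2 * A (Λ + 1))) := by
  have := fun i => (h i).prob
  simp_rw [Real.exp_sum]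
  rw [integral_fintype_prod_eq_prod (f := fun i x => Real.exp (a i * x))]
  calc ∏ i, ∫ x, Real.exp (a i * x) ∂ν i ≤ ∏ i, Real.exp (a i ^ 2 * (2 * A (Λ + 1))) :=
        Finset.prod_le_prod (fun i _ => integral_nonneg fun _ => (Real.exp_pos _).le)
          fun i _ => (h i).integral_exp_mul_le (ha i)
    _ = Real.exp ((∑ i, a i ^ 2) * (2 * A (Λ + 1))) := by rw [← Real.exp_sum, Finset.sum_mul]
    _ ≤ _ := Real.exp_le_exp.mpr (mul_le_mul_of_nonneg_right hV (by positivity))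

theorem integrable_exp_abs_sum (h : ∀ i, ExpBounded A (ν i)) (a : ι → ℝ) :
    Integrable (fun y : ι → ℝ => Real.exp |∑ i, a i * y i|) (Measure.pi ν) := by
  refine ((integrable_exp_sum h a).add (integrable_exp_sum h (fun i => -a i))).mono'
    (by fun_prop : Continuous fun y : ι → ℝ => Real.exp |∑ i, a i * y i|).aestronglyMeasurable
    (Eventually.of_forall fun y => ?_)
  rw [Real.norm_eq_abs, abs_of_pos (Real.exp_pos _)]
  refine (Real.exp_abs_le _).trans (le_of_eq ?_)
  simp

theorem integral_exp_abs_sum_le (h : ∀ i, ExpBounded A (ν i)) {a : ι → ℝ} {Λ V : ℝ}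
    (ha : ∀ i, |a i| ≤ Λ) (hV : ∑ i, a i ^ 2 ≤ V) (hA : 0 ≤ A (Λ + 1)) :
    ∫ y, Real.exp |∑ i, a i * y i| ∂Measure.pi ν ≤ 2 * Real.exp (V * (2 * A (Λ + 1))) := by
  have h1 := integral_exp_sum_le h ha hV hA
  have h2 := integral_exp_sum_le h (a := fun i => -a i) (by simpa using ha) (by simpa using hV) hA
  have i1 := integrable_exp_sum h a
  have i2 := integrable_exp_sum h (fun i => -a i)
  calc _ ≤ ∫ y, (Real.exp (∑ i, a i * y i) + Real.exp (∑ i, -a i * y i)) ∂Measure.pi ν :=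
        integral_mono (integrable_exp_abs_sum h a) (i1.add i2) fun y => by
          refine (Real.exp_abs_le _).trans (le_of_eq ?_)
          simp
    _ ≤ _ := by rw [integral_add i1 i2]; linarith

variable {κ : Type*} [Fintype κ]

/-- The norm is at most the dimension times the largest coordinate, and a maximum is bounded by a
sum. The summand `1` covers an empty index type. -/
theorem exp_norm_le (c : ℝ) (hc : 0 ≤ c) (u : EuclideanSpace ℝ κ) :
    Real.exp (c * ‖u‖) ≤ 1 + ∑ a, Real.exp |c * Fintype.card κ * u a| := by
  rcases isEmpty_or_nonempty κ with hκ | hκ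
  · have : u = 0 := by ext a; exact hκ.elim a
    simp [this]
  obtain ⟨a0, -, ha0⟩ := Finset.exists_max_image Finset.univ (fun a => |u a|) Finset.univ_nonempty
  have h1 : ‖u‖ ≤ Fintype.card κ * |u a0| := by
    have h2 : ‖u‖ ≤ ∑ a, |u a| := by
      have := norm_sum_le Finset.univ fun a => u a • EuclideanSpace.basisFun κ ℝ a
      have e := (EuclideanSpace.basisFun κ ℝ).sum_repr u
      simp only [EuclideanSpace.basisFun_repr] at e
      rw [e] at this
      simpa [norm_smul] using this
    refine h2.trans ((Finset.sum_le_sum fun a ha => ha0 a ha).trans (le_of_eq ?_))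
    simp
  have h3 : Real.exp (c * ‖u‖) ≤ Real.exp |c * Fintype.card κ * u a0| := by
    refine Real.exp_le_exp.mpr ?_
    rw [abs_mul, abs_mul, abs_of_nonneg hc, Nat.abs_cast, mul_assoc]
    exact mul_le_mul_of_nonneg_left h1 hc
  have h4 := Finset.single_le_sum (f := fun a => Real.exp |c * Fintype.card κ * u a|)
    (fun a _ => (Real.exp_pos _).le) (Finset.mem_univ a0)
  linarith

theorem integral_exp_norm_sum_le (h : ∀ i, ExpBounded A (ν i)) {a : ι → EuclideanSpace ℝ κ}
    {c b V : ℝ} (hc : 0 ≤ c) (ha : ∀ i, ‖a i‖ ≤ b) (hV : ∑ i, ‖a i‖ ^ 2 ≤ V)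
    (hA : 0 ≤ A (c * Fintype.card κ * b + 1)) :
    Integrable (fun y : ι → ℝ => Real.exp (c * ‖∑ i, y i • a i‖)) (Measure.pi ν) ∧
    ∫ y, Real.exp (c * ‖∑ i, y i • a i‖) ∂Measure.pi ν ≤
      1 + Fintype.card κ * (2 * Real.exp ((c * Fintype.card κ) ^ 2 * V *
        (2 * A (c * Fintype.card κ * b + 1)))) := by
  have := fun i => (h i).prob
  set q := (Fintype.card κ : ℝ) with hq
  have hco : ∀ (l : κ) (y : ι → ℝ), c * q * (∑ i, y i • a i : EuclideanSpace ℝ κ) l =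
      ∑ i, c * q * a i l * y i := fun l y => by
    simp only [WithLp.ofLp_sum, Finset.sum_apply, PiLp.smul_apply, smul_eq_mul, Finset.mul_sum]
    exact Finset.sum_congr rfl fun i _ => by ring
  have hle : ∀ y : ι → ℝ, Real.exp (c * ‖∑ i, y i • a i‖) ≤
      1 + ∑ l, Real.exp |∑ i, c * q * a i l * y i| := fun y => by
    refine (exp_norm_le c hc _).trans (le_of_eq ?_)
    simp_rw [← hco]; rfl
  have hint : Integrable (fun y : ι → ℝ => 1 + ∑ l, Real.exp |∑ i, c * q * a i l * y i|)
      (Measure.pi ν) :=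
    (integrable_const 1).add (integrable_finsetSum _ fun l _ => integrable_exp_abs_sum h _)
  have hint1 : Integrable (fun y : ι → ℝ => Real.exp (c * ‖∑ i, y i • a i‖)) (Measure.pi ν) := by
    refine hint.mono' (by fun_prop : Continuous fun y : ι → ℝ =>
      Real.exp (c * ‖∑ i, y i • a i‖)).aestronglyMeasurable (Eventually.of_forall fun y => ?_)
    rw [Real.norm_eq_abs, abs_of_pos (Real.exp_pos _)]
    exact hle y
  refine ⟨hint1, (integral_mono hint1 hint hle).trans ?_⟩
  rw [integral_add (integrable_const 1)
    (integrable_finsetSum _ fun l _ => integrable_exp_abs_sum h _), integral_finsetSum _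
    fun l _ => integrable_exp_abs_sum h _]
  have hq0 : 0 ≤ q := Nat.cast_nonneg _
  have hal : ∀ i l, |a i l| ≤ ‖a i‖ := fun i l => by
    simpa using PiLp.norm_apply_le (a i) l
  have hl : ∀ l, ∫ y, Real.exp |∑ i, c * q * a i l * y i| ∂Measure.pi ν ≤
      2 * Real.exp ((c * q) ^ 2 * V * (2 * A (c * q * b + 1))) := fun l => by
    refine integral_exp_abs_sum_le h (fun i => ?_) ?_ hA
    · rw [abs_mul, abs_of_nonneg (by positivity : 0 ≤ c * q)]
      exact mul_le_mul_of_nonneg_left ((hal i l).trans (ha i)) (by positivity)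
    · simp_rw [mul_pow (c * q), ← Finset.mul_sum]
      refine mul_le_mul_of_nonneg_left ((Finset.sum_le_sum fun i _ => ?_).trans hV) (by positivity)
      rw [← sq_abs]
      exact pow_le_pow_left₀ (abs_nonneg _) (hal i l) 2
  refine add_le_add (by simp) ((Finset.sum_le_sum fun l _ => hl l).trans (le_of_eq ?_))
  simp [hq]

end ExpBounded

/-! ### Exchanging the entries in the free energy -/

theorem SmoothBounded.continuous {B : ℝ} {ψ : ℝ → ℝ} (h : SmoothBounded B ψ) : Continuous ψ := by
  obtain ⟨-, ψ1, -, -, h1, -⟩ := h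
  exact continuous_iff_continuousAt.mpr fun x => (h1 x).continuousAt

section Weight

variable {E : Type*} [NormedAddCommGroup E] [NormedSpace ℝ E] {W : E → ℝ} {C : ℝ}

theorem weight_pos (hW : ∀ u w, RelSmooth (C * ‖w‖) fun t => W (u + t • w)) (u : E) : 0 < W u := by
  simpa using (hW u 0).1 0

theorem weight_le_exp (hW : ∀ u w, RelSmooth (C * ‖w‖) fun t => W (u + t • w)) (u v : E) :
    W v ≤ Real.exp (C * ‖v - u‖) * W u := by
  simpa using (hW u (v - u)).le_exp 0 1

/-- Smoothness is assumed only along lines, but uniformly, so `log W` is `C`-Lipschitz. -/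
theorem continuous_weight (hC : 0 ≤ C) (hW : ∀ u w, RelSmooth (C * ‖w‖) fun t => W (u + t • w)) :
    Continuous W := by
  have hl : ∀ u v, Real.log (W v) - Real.log (W u) ≤ C * ‖v - u‖ := fun u v => by
    have := Real.log_le_log (weight_pos hW v) (weight_le_exp hW u v)
    rw [Real.log_mul (Real.exp_pos _).ne' (weight_pos hW u).ne', Real.log_exp] at this
    linarith
  have : LipschitzWith (Real.toNNReal C) fun u => Real.log (W u) := by
    refine LipschitzWith.of_dist_le_mul fun u v => ?_
    rw [Real.coe_toNNReal C hC, Real.dist_eq, abs_le, dist_eq_norm]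
    have h1 := hl u v
    have h2 := hl v u
    rw [norm_sub_rev] at h1
    constructor <;> linarith
  have h := Real.continuous_exp.comp this.continuous
  refine h.congr fun u => ?_
  simp [Real.exp_log (weight_pos hW u)]

end Weight

/-- Decouples the Gibbs measure from the row being exchanged: on the right only the weights `c`
remain, and the row enters through `e`, whose square has bounded expectation. The partition function
is bounded below by Cauchy–Schwarz, `(∑ c)² ≤ (∑ c w) (∑ c / w)`, and products `e m * e m'` by sums
of squares. -/
theorem gibbs_average_le {M : Type*} [Fintype M] [Nonempty M] {c w e α : M → ℝ} {w0 : ℝ}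
    (hc : ∀ m, 0 < c m) (hw : ∀ m, 0 < w m) (hα : ∀ m, 0 ≤ α m) (hw0 : 0 < w0)
    (h1 : ∀ m, w m ≤ e m * w0) (h2 : ∀ m, w0 ≤ e m * w m) :
    (∑ m, c m * w m * α m) / ∑ m, c m * w m ≤
      ∑ m, ∑ m', (c m / ∑ i, c i) * (c m' / ∑ i, c i) * α m * (e m ^ 2 + e m' ^ 2) := by
  set S := ∑ i, c i with hS
  have hS0 : 0 < S := Finset.sum_pos (fun m _ => hc m) Finset.univ_nonempty
  set D := ∑ m, c m * w m with hD
  have hD0 : 0 < D := Finset.sum_pos (fun m _ => mul_pos (hc m) (hw m)) Finset.univ_nonempty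
  have he : ∀ m, 0 < e m := fun m => by
    have := hw0.trans_le (h2 m)
    exact pos_of_mul_pos_left this (hw m).le
  have hCS : S ^ 2 * w0 ≤ D * ∑ m, c m * e m := by
    have h := Finset.sum_mul_sq_le_sq_mul_sq Finset.univ (fun m => Real.sqrt (c m * w m))
      (fun m => Real.sqrt (c m / w m))
    have e1 : ∀ m, Real.sqrt (c m * w m) * Real.sqrt (c m / w m) = c m := fun m => by
      rw [← Real.sqrt_mul (mul_pos (hc m) (hw m)).le]
      have : c m * w m * (c m / w m) = c m ^ 2 := by
        have := (hw m).ne'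
        field_simp
      rw [this, Real.sqrt_sq (hc m).le]
    simp_rw [e1, Real.sq_sqrt (mul_pos (hc _) (hw _)).le, Real.sq_sqrt (div_pos (hc _) (hw _)).le] at h
    calc S ^ 2 * w0 ≤ D * (∑ m, c m / w m) * w0 := mul_le_mul_of_nonneg_right h hw0.le
      _ = D * ∑ m, c m / w m * w0 := by rw [mul_assoc D, Finset.sum_mul _ (fun m => c m / w m)]
      _ ≤ D * ∑ m, c m * e m := by
        refine mul_le_mul_of_nonneg_left (Finset.sum_le_sum fun m _ => ?_) hD0.le
        rw [div_mul_eq_mul_div, div_le_iff₀ (hw m), mul_assoc]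
        exact mul_le_mul_of_nonneg_left (h2 m) (hc m).le
  have hnum : ∑ m, c m * w m * α m ≤ w0 * ∑ m, c m * e m * α m := by
    rw [Finset.mul_sum]
    refine Finset.sum_le_sum fun m _ => ?_
    have := mul_le_mul_of_nonneg_right (mul_le_mul_of_nonneg_left (h1 m) (hc m).le) (hα m)
    linarith
  have hT0 : 0 ≤ ∑ m, c m * e m * α m := Finset.sum_nonneg fun m _ =>
    mul_nonneg (mul_pos (hc m) (he m)).le (hα m)
  have h3 : (∑ m, c m * w m * α m) / D ≤ (∑ m, c m * e m * α m) * (∑ m, c m * e m) / S ^ 2 := by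
    rw [div_le_div_iff₀ hD0 (by positivity)]
    have a := mul_le_mul_of_nonneg_right hnum (sq_nonneg S)
    have b := mul_le_mul_of_nonneg_left hCS hT0
    linarith
  refine h3.trans ?_
  rw [Finset.sum_mul_sum, Finset.sum_div]
  refine Finset.sum_le_sum fun m _ => ?_
  rw [Finset.sum_div]
  refine Finset.sum_le_sum fun m' _ => ?_
  have h4 : e m * e m' ≤ e m ^ 2 + e m' ^ 2 := by nlinarith [sq_nonneg (e m - e m'), sq_nonneg (e m)]
  have h5 : c m * e m * α m * (c m' * e m') / S ^ 2 = c m / S * (c m' / S) * α m * (e m * e m') := by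
    field_simp
  rw [h5]
  refine mul_le_mul_of_nonneg_left h4 ?_
  have := hc m
  have := hc m'
  have := hα m
  positivity

theorem abs_integral_sub_integral_le {Y : Type*} [MeasurableSpace Y] {P : Measure Y}
    {f g D : Y → ℝ} (hf : Integrable f P) (hg : Integrable g P) (hD : Integrable D P)
    (h : ∀ y, |f y - g y| ≤ D y) : |(∫ y, f y ∂P) - ∫ y, g y ∂P| ≤ ∫ y, D y ∂P := by
  rw [← integral_sub hf hg]
  exact abs_integral_le_integral_abs.trans (integral_mono (hf.sub hg).abs hD h)

theorem integrable_integral_update {ι E : Type*} [Fintype ι] [DecidableEq ι] [MeasurableSpace E]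
    {ν : ι → Measure E} [∀ i, IsProbabilityMeasure (ν i)] {ρ : Measure E} [IsProbabilityMeasure ρ]
    {f : (ι → E) → ℝ} (hf : Measurable f) {B : ℝ} (hB : ∀ y, |f y| ≤ B) (k : ι) :
    Integrable (fun y => ∫ t, f (Function.update y k t) ∂ρ) (Measure.pi ν) := by
  refine Integrable.of_bound (C := B)
    ((hf.comp (measurable_update' (a := k))).stronglyMeasurable.integral_prod_right'
      (ν := ρ)).aestronglyMeasurable (Eventually.of_forall fun y => ?_)
  have := norm_integral_le_of_norm_le_const (μ := ρ) (f := fun t => f (Function.update y k t))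
    (C := B) (Eventually.of_forall fun t => hB _)
  simpa using this

/-- The constant in the bound for exchanging a row. -/
noncomputable def swapConst (A : ℝ → ℝ) (q B C b₀ V : ℝ) : ℝ :=
  13 * B * (12 * A (2 * (C * b₀) + 1)) *
    (2 * (1 + q * (2 * Real.exp ((2 * C * q) ^ 2 * V * (2 * A (2 * C * q * b₀ + 1)))))) *
    (C ^ 3 * V)

theorem sum_update_smul {ι V : Type*} [Fintype ι] [DecidableEq ι] [AddCommGroup V] [Module ℝ V]
    (y : ι → ℝ) (k : ι) (t : ℝ) (a : ι → V) :
    ∑ j, Function.update y k t j • a j = (∑ j, y j • Function.update a k 0 j) + t • a k := by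
  rw [← Finset.add_sum_erase _ _ (Finset.mem_univ k),
    ← Finset.add_sum_erase _ (fun j => y j • Function.update a k 0 j) (Finset.mem_univ k)]
  simp only [Function.update_self, smul_zero, zero_add]
  rw [add_comm]
  congr 1
  refine Finset.sum_congr rfl fun j hj => ?_
  rw [Function.update_of_ne (Finset.ne_of_mem_erase hj), Function.update_of_ne (Finset.ne_of_mem_erase hj)]

section Swap

variable {κ ι M : Type*} [Fintype κ] [Fintype ι] [DecidableEq ι] [Fintype M] [Nonempty M]
  {A : ℝ → ℝ} {μ γ : Measure ℝ} {B N C b b₀ V : ℝ} {ψ : ℝ → ℝ} {c : M → ℝ}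
  {a : M → ι → EuclideanSpace ℝ κ}

/-- The prior `c` is arbitrary and does not appear in the bound, so it can carry the contribution of
all other rows. Exchanging coordinate `k` costs the `c`-average of `‖a m k‖³`; this average is the
same for every `k`, so the cubes can be summed over `k` for each fixed `m`. -/
theorem freeEnergy_row_swap (hB : 0 ≤ B) (hψ : SmoothBounded B ψ) (hN : 1 ≤ N)
    (hμ : ExpBounded A μ) (hγ : ExpBounded A γ) (hvar : ∫ x, x ^ 2 ∂μ = ∫ x, x ^ 2 ∂γ)
    (hC : 0 ≤ C) {W : EuclideanSpace ℝ κ → ℝ}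
    (hW : ∀ u w, RelSmooth (C * ‖w‖) fun t => W (u + t • w)) (hc : ∀ m, 0 < c m)
    (hb : 0 ≤ b) (hb₀ : b ≤ b₀) (ha : ∀ m j, ‖a m j‖ ≤ b) (hV : ∀ m, ∑ j, ‖a m j‖ ^ 2 ≤ V) :
    |(∫ y, ψ (-(Real.log (∑ m, c m * W (∑ j, y j • a m j)) / N)) ∂Measure.pi (fun _ : ι => μ)) -
      ∫ y, ψ (-(Real.log (∑ m, c m * W (∑ j, y j • a m j)) / N)) ∂Measure.pi (fun _ : ι => γ)| ≤
    swapConst A (Fintype.card κ) B C b₀ V * b / N := by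
  have hμp := hμ.prob
  have hγp := hγ.prob
  have hWc := continuous_weight hC hW
  have hWp := weight_pos hW
  have hψc := hψ.continuous
  have hb₀' : 0 ≤ b₀ := hb.trans hb₀
  set q := (Fintype.card κ : ℝ) with hq
  have hq0 : 0 ≤ q := Nat.cast_nonneg _
  set f : (ι → ℝ) → ℝ := fun y => ψ (-(Real.log (∑ m, c m * W (∑ j, y j • a m j)) / N)) with hf
  have hfc : Continuous f := by
    have : Continuous fun y : ι → ℝ => Real.log (∑ m, c m * W (∑ j, y j • a m j)) :=
      Continuous.log (by fun_prop) fun y =>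
        (Finset.sum_pos (fun m _ => mul_pos (hc m) (hWp _)) Finset.univ_nonempty).ne'
    fun_prop
  have hfB : ∀ y, |f y| ≤ B := fun y => hψ.1 _
  set S := ∑ i, c i with hS
  have hS0 : 0 < S := Finset.sum_pos (fun m _ => hc m) Finset.univ_nonempty
  have hcS : ∑ m, c m / S = 1 := by rw [← Finset.sum_div]; exact div_self hS0.ne'
  set X := 1 + q * (2 * Real.exp ((2 * C * q) ^ 2 * V * (2 * A (2 * C * q * b₀ + 1)))) with hX
  have hX0 : 0 ≤ X := by positivity
  set T := 12 * A (2 * (C * b₀) + 1) with hT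
  have hT0 : 0 ≤ T := mul_nonneg (by norm_num) (hμ.nonneg (by positivity))
  have step : ∀ (k : ι) (ν : ι → Measure ℝ), (∀ i, ν i = μ ∨ ν i = γ) →
      |(∫ y, ∫ t, f (Function.update y k t) ∂μ ∂Measure.pi ν) -
        ∫ y, ∫ t, f (Function.update y k t) ∂γ ∂Measure.pi ν| ≤
      13 * B / N * T * (2 * X) * ∑ m, c m / S * (C * ‖a m k‖) ^ 3 := by
    intro k ν hν
    have hνE : ∀ i, ExpBounded A (ν i) := fun i => by
      rcases hν i with h | h <;> rw [h] <;> assumption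
    have := fun i => (hνE i).prob
    -- The linear form with coordinate `k` deleted: it does not depend on the exchanged entry `t`,
    -- and the full form is `u m y + t • a m k`.
    set u : M → (ι → ℝ) → EuclideanSpace ℝ κ := fun m y => ∑ j, y j • Function.update (a m) k 0 j
      with hu
    set e : M → (ι → ℝ) → ℝ := fun m y => Real.exp (2 * C * ‖u m y‖) with he
    have hE : ∀ m, Integrable (e m) (Measure.pi ν) ∧ ∫ y, e m y ∂Measure.pi ν ≤ X := fun m => by
      have hle : ∀ i, ‖Function.update (a m) k 0 i‖ ≤ ‖a m i‖ := fun i => by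
        rcases eq_or_ne i k with rfl | h
        · simp
        · rw [Function.update_of_ne h]
      refine ExpBounded.integral_exp_norm_sum_le hνE (by positivity)
        (fun i => (hle i).trans ((ha m i).trans hb₀))
        ((Finset.sum_le_sum fun i _ => pow_le_pow_left₀ (norm_nonneg _) (hle i) 2).trans (hV m))
        (hμ.nonneg (by positivity))
    set D : (ι → ℝ) → ℝ := fun y => ∑ m, ∑ m', (c m / S) * (c m' / S) * (C * ‖a m k‖) ^ 3 *
      (e m y + e m' y) with hD
    have hDi1 : ∀ m m', Integrable (fun y => (c m / S) * (c m' / S) * (C * ‖a m k‖) ^ 3 *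
        (e m y + e m' y)) (Measure.pi ν) := fun m m' => ((hE m).1.add (hE m').1).const_mul _
    have hDi2 : ∀ m, Integrable (fun y => ∑ m', (c m / S) * (c m' / S) * (C * ‖a m k‖) ^ 3 *
        (e m y + e m' y)) (Measure.pi ν) := fun m => integrable_finsetSum _ fun m' _ => hDi1 m m'
    have hDi : Integrable D (Measure.pi ν) := integrable_finsetSum _ fun m _ => hDi2 m
    have hDle : ∫ y, D y ∂Measure.pi ν ≤ 2 * X * ∑ m, c m / S * (C * ‖a m k‖) ^ 3 := by
      rw [integral_finsetSum _ fun m _ => hDi2 m]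
      calc _ ≤ ∑ m, ∑ m', (c m / S) * (c m' / S) * (C * ‖a m k‖) ^ 3 * (2 * X) := by
            refine Finset.sum_le_sum fun m _ => ?_
            rw [integral_finsetSum _ fun m' _ => hDi1 m m']
            refine Finset.sum_le_sum fun m' _ => ?_
            rw [integral_const_mul, integral_add (hE m).1 (hE m').1]
            refine mul_le_mul_of_nonneg_left (by linarith [(hE m).2, (hE m').2]) ?_
            have := hc m
            have := hc m'
            positivity
        _ = ∑ m, (∑ m', c m' / S) * (c m / S * (C * ‖a m k‖) ^ 3 * (2 * X)) := by
            refine Finset.sum_congr rfl fun m _ => ?_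
            rw [Finset.sum_mul]
            exact Finset.sum_congr rfl fun m' _ => by ring
        _ = _ := by
            rw [hcS]
            simp only [one_mul]
            rw [← Finset.sum_mul, mul_comm]
    have hpt : ∀ y, |(∫ t, f (Function.update y k t) ∂μ) - ∫ t, f (Function.update y k t) ∂γ| ≤
        13 * B / N * T * D y := by
      intro y
      obtain ⟨h1, h2, hh⟩ := freeEnergy_taylor (abar := C * b₀) hB hψ hN hc
        (a := fun m => C * ‖a m k‖) (fun m => by positivity)
        (fun m => mul_le_mul_of_nonneg_left ((ha m k).trans hb₀) hC)
        (f := fun m t => W (u m y + t • a m k)) (fun m => hW _ _)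
      simp only [zero_smul, add_zero] at hh
      set G := (∑ m, c m * W (u m y) * (C * ‖a m k‖) ^ 3) / ∑ m, c m * W (u m y) with hG
      have hG0 : 0 ≤ G := div_nonneg (Finset.sum_nonneg fun m _ =>
        mul_nonneg (mul_pos (hc m) (hWp _)).le (by positivity))
        (Finset.sum_nonneg fun m _ => (mul_pos (hc m) (hWp _)).le)
      -- The reference weight is `W 0`: the ratio of `W (u m y)` to `W 0` is at most `exp (C * ‖u m
      -- y‖)` in either direction, and its square is `e m y`.
      have hGD : G ≤ D y := by
        have := gibbs_average_le (c := c) (w := fun m => W (u m y))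
          (e := fun m => Real.exp (C * ‖u m y‖)) (α := fun m => (C * ‖a m k‖) ^ 3) (w0 := W 0)
          hc (fun m => hWp _) (fun m => by positivity) (hWp 0)
          (fun m => by simpa using weight_le_exp hW 0 (u m y))
          (fun m => by simpa using weight_le_exp hW (u m y) 0)
        refine this.trans (le_of_eq ?_)
        simp only [hD, he, ← Real.exp_nat_mul]
        push_cast
        simp only [mul_assoc]
        rfl
      have hfu : ∀ t, f (Function.update y k t) =
          ψ (-(Real.log (∑ m, c m * W (u m y + t • a m k)) / N)) := fun t => by
        simp only [hf, hu, sum_update_smul]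
      have hfuc : Continuous fun t => f (Function.update y k t) :=
        hfc.comp (continuous_const.update k continuous_id)
      have := hμ.abs_integral_sub_le hγ hvar hfuc (fun t => hfB _) (h0 := ψ (-(Real.log
        (∑ m, c m * W (u m y)) / N))) (h1 := h1) (h2 := h2) (Q := 13 * B / N * G)
        (Λ := 2 * (C * b₀)) (by positivity) (by positivity) (fun t => by
          rw [hfu]
          refine (hh t).trans (le_of_eq ?_)
          ring)
      refine this.trans ?_
      rw [← hT]
      have h3 := mul_le_mul_of_nonneg_left hGD (by positivity : 0 ≤ 13 * B / N * T)
      linarith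
    refine (abs_integral_sub_integral_le
      (integrable_integral_update hfc.measurable hfB k)
      (integrable_integral_update hfc.measurable hfB k) (hDi.const_mul _) hpt).trans ?_
    rw [integral_const_mul]
    have := mul_le_mul_of_nonneg_left hDle (by positivity : 0 ≤ 13 * B / N * T)
    linarith
  refine (lindeberg_swap hfc.measurable hfB step).trans ?_
  rw [← Finset.mul_sum, Finset.sum_comm]
  -- One factor of each cube is bounded by the maximum `b`, the other two are summed to `V`.
  have hm : ∀ m, ∑ k, c m / S * (C * ‖a m k‖) ^ 3 ≤ c m / S * (C ^ 3 * (b * V)) := fun m => by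
    rw [← Finset.mul_sum]
    refine mul_le_mul_of_nonneg_left ?_ (div_pos (hc m) hS0).le
    calc ∑ k, (C * ‖a m k‖) ^ 3 ≤ ∑ k, C ^ 3 * (b * ‖a m k‖ ^ 2) := by
          refine Finset.sum_le_sum fun k _ => ?_
          rw [mul_pow]
          refine mul_le_mul_of_nonneg_left ?_ (by positivity)
          rw [pow_succ, mul_comm]
          exact mul_le_mul_of_nonneg_right (ha m k) (by positivity)
      _ = C ^ 3 * (b * ∑ k, ‖a m k‖ ^ 2) := by rw [← Finset.mul_sum, ← Finset.mul_sum]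
      _ ≤ _ := mul_le_mul_of_nonneg_left (mul_le_mul_of_nonneg_left (hV m) hb) (by positivity)
  have hsum : ∑ m, ∑ k, c m / S * (C * ‖a m k‖) ^ 3 ≤ C ^ 3 * (b * V) := by
    refine (Finset.sum_le_sum fun m _ => hm m).trans (le_of_eq ?_)
    rw [← Finset.sum_mul, hcS, one_mul]
  refine (mul_le_mul_of_nonneg_left hsum (by positivity)).trans (le_of_eq ?_)
  simp only [swapConst, hX, hT]
  ring

/-- Exchanging all rows: the law of the free energy is insensitive to the law of the entries. -/
theorem freeEnergy_swap {n : Type*} [Fintype n] [DecidableEq n] (hB : 0 ≤ B)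
    (hψ : SmoothBounded B ψ) (hN : 1 ≤ N)
    (hμ : ExpBounded A μ) (hγ : ExpBounded A γ) (hvar : ∫ x, x ^ 2 ∂μ = ∫ x, x ^ 2 ∂γ)
    (hC : 0 ≤ C) {W : n → EuclideanSpace ℝ κ → ℝ}
    (hW : ∀ i u w, RelSmooth (C * ‖w‖) fun t => W i (u + t • w)) (hc : ∀ m, 0 < c m)
    (hb : 0 ≤ b) (hb₀ : b ≤ b₀) (ha : ∀ m j, ‖a m j‖ ≤ b) (hV : ∀ m, ∑ j, ‖a m j‖ ^ 2 ≤ V) :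
    |(∫ Y, ψ (-(Real.log (∑ m, c m * ∏ i, W i (∑ j, Y i j • a m j)) / N))
        ∂Measure.pi (fun _ : n => Measure.pi (fun _ : ι => μ))) -
      ∫ Y, ψ (-(Real.log (∑ m, c m * ∏ i, W i (∑ j, Y i j • a m j)) / N))
        ∂Measure.pi (fun _ : n => Measure.pi (fun _ : ι => γ))| ≤
    Fintype.card n * (swapConst A (Fintype.card κ) B C b₀ V * b / N) := by
  have hμp := hμ.prob
  have hγp := hγ.prob
  have hWc := fun i => continuous_weight hC (hW i)
  have hWp := fun i => weight_pos (hW i)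
  have hψc := hψ.continuous
  set f : (n → ι → ℝ) → ℝ := fun Y =>
    ψ (-(Real.log (∑ m, c m * ∏ i, W i (∑ j, Y i j • a m j)) / N)) with hf
  have hfc : Continuous f := by
    have : Continuous fun Y : n → ι → ℝ => Real.log (∑ m, c m * ∏ i, W i (∑ j, Y i j • a m j)) :=
      Continuous.log (by fun_prop) fun y =>
        (Finset.sum_pos (fun m _ => mul_pos (hc m) (Finset.prod_pos fun i _ => hWp i _))
          Finset.univ_nonempty).ne'
    fun_prop
  have hfB : ∀ y, |f y| ≤ B := fun y => hψ.1 _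
  refine (lindeberg_swap (b := fun _ => swapConst A (Fintype.card κ) B C b₀ V * b / N)
    hfc.measurable hfB fun i ν hν => ?_).trans (le_of_eq (by simp))
  have : ∀ i, IsProbabilityMeasure (ν i) := fun i => by
    rcases hν i with h | h <;> rw [h] <;> infer_instance
  refine (abs_integral_sub_integral_le
      (integrable_integral_update hfc.measurable hfB i)
      (integrable_integral_update hfc.measurable hfB i)
      (integrable_const (swapConst A (Fintype.card κ) B C b₀ V * b / N)) fun Y => ?_).trans
      (le_of_eq (by simp))
  -- With the other rows fixed, their factors join the prior, and the row estimate applies to the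
  -- new positive weights.
  have hfu : ∀ t, f (Function.update Y i t) = ψ (-(Real.log (∑ m,
      (c m * ∏ i' ∈ Finset.univ.erase i, W i' (∑ j, Y i' j • a m j)) * W i (∑ j, t j • a m j)) / N)) :=
      fun t => by
    simp only [hf]
    congr 4
    refine Finset.sum_congr rfl fun m _ => ?_
    rw [← Finset.mul_prod_erase _ _ (Finset.mem_univ i), Function.update_self, mul_assoc]
    congr 1
    rw [mul_comm]
    congr 1
    refine Finset.prod_congr rfl fun i' hi' => ?_
    rw [Function.update_of_ne (Finset.ne_of_mem_erase hi')]
  simp_rw [hfu]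
  exact freeEnergy_row_swap hB hψ hN hμ hγ hvar hC (hW i)
    (fun m => mul_pos (hc m) (Finset.prod_pos fun i _ => hWp i _)) hb hb₀ ha hV

end Swap

/-! ### Nets and a uniform bound over directions -/

section Net

variable {E : Type*} [NormedAddCommGroup E] [NormedSpace ℝ E] [FiniteDimensional ℝ E]

open Metric in
-- Volume comparison: the disjoint balls of radius `δ / 2` lie in the ball of radius `R + δ / 2`.
theorem card_le_of_separated {R δ : ℝ} (hR : 0 ≤ R) (hδ : 0 < δ) (s : Finset E)
    (hs : ∀ c ∈ s, ‖c‖ ≤ R) (h : ∀ c ∈ s, ∀ d ∈ s, c ≠ d → δ ≤ ‖c - d‖) :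
    (s.card : ℝ) ≤ (1 + 2 * R / δ) ^ Module.finrank ℝ E := by
  borelize E
  let μ : Measure E := Measure.addHaar
  have D : Set.Pairwise (s : Set E) (Function.onFun Disjoint fun c => ball (c : E) (δ / 2)) := by
    rintro c hc d hd hcd
    apply ball_disjoint_ball
    rw [dist_eq_norm, add_halves]
    exact h c hc d hd hcd
  have A_subset : (⋃ c ∈ s, ball (c : E) (δ / 2)) ⊆ ball (0 : E) (R + δ / 2) := by
    refine Set.iUnion₂_subset fun x hx => ball_subset_ball' ?_
    rw [dist_zero_right]
    linarith [hs x hx]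
  have ρpos : 0 < R + δ / 2 := by positivity
  have I : (s.card : ℝ≥0∞) * ENNReal.ofReal ((δ / 2) ^ Module.finrank ℝ E) * μ (ball 0 1) ≤
      ENNReal.ofReal ((R + δ / 2) ^ Module.finrank ℝ E) * μ (ball 0 1) :=
    calc
      _ = μ (⋃ c ∈ s, ball (c : E) (δ / 2)) := by
        rw [measure_biUnion_finset D fun c _ => measurableSet_ball]
        simp only [μ.addHaar_ball_of_pos _ (half_pos hδ)]
        simp only [Finset.sum_const, nsmul_eq_mul, mul_assoc]
      _ ≤ μ (ball (0 : E) (R + δ / 2)) := measure_mono A_subset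
      _ = _ := by simp only [μ.addHaar_ball_of_pos _ ρpos]
  have J := (ENNReal.mul_le_mul_iff_left (measure_ball_pos μ _ zero_lt_one).ne'
    measure_ball_lt_top.ne).1 I
  have K := ENNReal.toReal_le_of_le_ofReal (pow_nonneg ρpos.le _) J
  rw [ENNReal.toReal_mul, ENNReal.toReal_natCast, ENNReal.toReal_ofReal (by positivity),
    ← le_div_iff₀ (by positivity), ← div_pow] at K
  refine K.trans (le_of_eq ?_)
  congr 1
  field_simp
  ring

theorem exists_net {R δ : ℝ} (hR : 0 ≤ R) (hδ : 0 < δ) (s : Set E) (hs : ∀ x ∈ s, ‖x‖ ≤ R) :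
    ∃ T : Finset E, (∀ x ∈ T, x ∈ s) ∧ (∀ x ∈ s, ∃ y ∈ T, ‖x - y‖ ≤ δ) ∧
      (T.card : ℝ) ≤ (1 + 2 * R / δ) ^ Module.finrank ℝ E := by
  classical
  let Sep : Finset E → Prop := fun T => (∀ x ∈ T, x ∈ s) ∧ ∀ c ∈ T, ∀ d ∈ T, c ≠ d → δ ≤ ‖c - d‖
  let P : ℕ → Prop := fun m => ∃ T, Sep T ∧ T.card = m
  set N := ⌊(1 + 2 * R / δ) ^ Module.finrank ℝ E⌋₊
  have hbd : ∀ T, Sep T → (T.card : ℝ) ≤ (1 + 2 * R / δ) ^ Module.finrank ℝ E := fun T hT =>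
    card_le_of_separated hR hδ T (fun c hc => hs c (hT.1 c hc)) hT.2
  have hP0 : P 0 := ⟨∅, ⟨by simp, by simp⟩, rfl⟩
  -- A `δ`-separated subset of maximal cardinality is a `δ`-net, since an uncovered point could be
  -- added to it. The packing bound makes the maximum exist.
  obtain ⟨T, hT, hcard⟩ := Nat.findGreatest_spec (P := P) (n := N) (Nat.zero_le _) hP0
  refine ⟨T, hT.1, fun x hx => ?_, hbd T hT⟩
  by_contra! hcon
  have hxT : x ∉ T := fun h => by
    have := hcon x h
    simp at this
    linarith
  have hins : Sep (insert x T) := by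
    refine ⟨fun y hy => ?_, fun c hc d hd hcd => ?_⟩
    · rcases Finset.mem_insert.mp hy with rfl | h
      · exact hx
      · exact hT.1 y h
    · rcases Finset.mem_insert.mp hc with hc' | hc' <;>
        rcases Finset.mem_insert.mp hd with hd' | hd'
      · exact absurd (hc'.trans hd'.symm) hcd
      · rw [hc']; exact (hcon d hd').le
      · rw [hd', norm_sub_rev]; exact (hcon c hc').le
      · exact hT.2 c hc' d hd' hcd
  have h1 : P (T.card + 1) := ⟨_, hins, Finset.card_insert_of_notMem hxT⟩
  have h2 : T.card + 1 ≤ N := by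
    refine Nat.le_floor ?_
    have := hbd _ hins
    rwa [Finset.card_insert_of_notMem hxT] at this
  have h3 := Nat.le_findGreatest h2 h1
  omega

/-- At a maximizer `x` of `N` on the unit ball with nearest net point `y`, `N x ≤ N y + N (x - y) ≤
B + N x / 2`. -/
theorem seminorm_le_of_net {N : E → ℝ} (hc : Continuous N) (hadd : ∀ u v, N (u + v) ≤ N u + N v)
    (hsmul : ∀ (c : ℝ) v, N (c • v) = |c| * N v) {U : Finset E}
    (hU : ∀ x : E, ‖x‖ ≤ 1 → ∃ y ∈ U, ‖x - y‖ ≤ 1 / 2) {B : ℝ} (hB : ∀ u ∈ U, N u ≤ B) (v : E) :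
    N v ≤ 2 * B * ‖v‖ := by
  obtain ⟨x, hx, hmax⟩ := (isCompact_closedBall (0 : E) 1).exists_isMaxOn
    ⟨0, by simp⟩ hc.continuousOn
  rw [mem_closedBall_zero_iff] at hx
  have hball : ∀ v : E, ‖v‖ ≤ 1 → N v ≤ N x := fun v hv => hmax (by simpa using hv)
  obtain ⟨y, hy, hxy⟩ := hU x hx
  have h1 : N (x - y) ≤ 1 / 2 * N x := by
    have h2 : N ((2 : ℝ) • (x - y)) ≤ N x := hball _ (by rw [norm_smul]; norm_num; linarith)
    rw [hsmul] at h2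
    norm_num at h2
    linarith
  have h3 : N x ≤ N y + N (x - y) := by simpa using hadd y (x - y)
  have hx2 : N x ≤ 2 * B := by linarith [hB y hy]
  rcases eq_or_ne v 0 with rfl | hv
  · have := hsmul 0 0
    simp at this
    simp [this]
  · have hv' : 0 < ‖v‖ := norm_pos_iff.mpr hv
    have h4 : N (‖v‖⁻¹ • v) ≤ N x := hball _ (by rw [norm_smul]; simp [hv'.ne'])
    rw [hsmul, abs_of_pos (by positivity), inv_mul_le_iff₀ hv'] at h4
    nlinarith

end Net

theorem ExpBounded.integral_exp_sum_abs_le {A : ℝ → ℝ} {μ : Measure ℝ} (h : ExpBounded A μ)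
    {ι n : Type*} [Fintype ι] [Fintype n] {a : ι → ℝ} {Λ V : ℝ} (ha : ∀ i, |a i| ≤ Λ)
    (hV : ∑ i, a i ^ 2 ≤ V) (hA : 0 ≤ A (Λ + 1)) :
    Integrable (fun Y : n → ι → ℝ => Real.exp (∑ i, |∑ j, a j * Y i j|))
      (Measure.pi fun _ => Measure.pi fun _ => μ) ∧
    ∫ Y : n → ι → ℝ, Real.exp (∑ i, |∑ j, a j * Y i j|)
      ∂(Measure.pi fun _ => Measure.pi fun _ => μ) ≤
      Real.exp (Fintype.card n * (Real.log 2 + V * (2 * A (Λ + 1)))) := by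
  have := h.prob
  simp_rw [Real.exp_sum]
  refine ⟨Integrable.fintype_prod (f := fun _ (y : ι → ℝ) => Real.exp |∑ j, a j * y j|)
    fun _ => ExpBounded.integrable_exp_abs_sum (fun _ => h) a, ?_⟩
  rw [integral_fintype_prod_eq_prod (f := fun _ (y : ι → ℝ) => Real.exp |∑ j, a j * y j|),
    Real.exp_nat_mul, Real.exp_add, Real.exp_log two_pos, Finset.prod_const, Finset.card_univ]
  exact pow_le_pow_left₀ (integral_nonneg fun _ => (Real.exp_pos _).le)
    (ExpBounded.integral_exp_abs_sum_le (fun _ => h) ha hV hA) _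

/-- A bound, in expectation, for the seminorm `v ↦ n⁻¹ ∑ i, |⟨T v, Y i⟩|`. -/
theorem exists_seminorm_bound {n p : ℕ} (hn : 0 < n) {A : ℝ → ℝ} {s : ℝ} (hs : 0 ≤ s)
    (hA : 0 ≤ A (s + 1))
    (T : EuclideanSpace ℝ (Fin p) →L[ℝ] EuclideanSpace ℝ (Fin p)) (hT : ∀ v, ‖T v‖ ≤ s * ‖v‖) :
    ∃ H : (Fin n → Fin p → ℝ) → ℝ,
      (∀ Y v, (n : ℝ)⁻¹ * ∑ i, |∑ j, T v j * Y i j| ≤ H Y * ‖v‖) ∧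
      ∀ μ, ExpBounded A μ → Integrable H (Measure.pi fun _ => Measure.pi fun _ => μ) ∧
        ∫ Y, H Y ∂(Measure.pi fun _ => Measure.pi fun _ => μ) ≤
          2 * ((p : ℝ) / n * Real.log 5 + (Real.log 2 + s ^ 2 * (2 * A (s + 1))) + 1) := by
  -- This net of the unit ball has at most `5 ^ p` points, whence the `log 5`.
  obtain ⟨U, hU1, hU2, hU3⟩ := exists_net (E := EuclideanSpace ℝ (Fin p)) (R := 1) (δ := 1 / 2)
    zero_le_one (by norm_num) {x | ‖x‖ ≤ 1} fun x hx => hx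
  norm_num at hU3
  set c := Real.log 2 + s ^ 2 * (2 * A (s + 1)) with hc
  set t := (p : ℝ) / n * Real.log 5 + c with ht
  have hn' : (0 : ℝ) < n := by exact_mod_cast hn
  have hn1 : (1 : ℝ) ≤ n := by exact_mod_cast hn
  -- A union bound in expectation, from `z ≤ n t + exp (z - n t)` at each net point. The level `t`
  -- is chosen so that `exp (-(n * t))` cancels both the moment bound `exp (n * c)` and the
  -- cardinality `5 ^ p`, leaving a sum of expectation at most one.
  refine ⟨fun Y => 2 * (t + ∑ u ∈ U, (n : ℝ)⁻¹ * (Real.exp (-(n * t)) *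
    Real.exp (∑ i, |∑ j, T u j * Y i j|))), fun Y v => ?_, fun μ hμ => ?_⟩
  · refine seminorm_le_of_net (N := fun v => (n : ℝ)⁻¹ * ∑ i, |∑ j, T v j * Y i j|) (U := U)
      (by fun_prop) (fun u v => ?_) (fun a v => ?_) hU2 (fun u hu => ?_) v
    · rw [← mul_add, ← Finset.sum_add_distrib]
      refine mul_le_mul_of_nonneg_left (Finset.sum_le_sum fun i _ => ?_) (by positivity)
      refine le_trans (le_of_eq ?_) (abs_add_le _ _)
      rw [← Finset.sum_add_distrib]
      congr 1
      exact Finset.sum_congr rfl fun j _ => by rw [map_add, PiLp.add_apply, add_mul]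
    · rw [mul_left_comm |a|, Finset.mul_sum _ _ |a|]
      congr 1
      refine Finset.sum_congr rfl fun i _ => ?_
      rw [← abs_mul, Finset.mul_sum]
      congr 1
      exact Finset.sum_congr rfl fun j _ => by rw [map_smul, PiLp.smul_apply, smul_eq_mul, mul_assoc]
    · have h1 := Finset.single_le_sum (f := fun u => (n : ℝ)⁻¹ * (Real.exp (-(n * t)) *
        Real.exp (∑ i, |∑ j, T u j * Y i j|))) (fun u _ => by positivity) hu
      refine le_trans ?_ (add_le_add_right h1 t)
      simp only
      rw [← Real.exp_add]
      set z := ∑ i, |∑ j, T u j * Y i j|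
      have h2 := Real.add_one_le_exp (-(n * t) + z)
      have h3 : z ≤ n * t + Real.exp (-(n * t) + z) := by linarith
      calc (n : ℝ)⁻¹ * z ≤ (n : ℝ)⁻¹ * (n * t + Real.exp (-(n * t) + z)) :=
            mul_le_mul_of_nonneg_left h3 (by positivity)
        _ = _ := by field_simp
  · have hp := hμ.prob
    have hu : ∀ u ∈ U, Integrable (fun Y : Fin n → Fin p → ℝ => Real.exp (∑ i, |∑ j, T u j * Y i j|))
        (Measure.pi fun _ => Measure.pi fun _ => μ) ∧
        ∫ Y : Fin n → Fin p → ℝ, Real.exp (∑ i, |∑ j, T u j * Y i j|)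
        ∂(Measure.pi fun _ => Measure.pi fun _ => μ) ≤ Real.exp (n * c) := fun u hu => by
      have h1 : ‖T u‖ ≤ s := (hT u).trans (mul_le_of_le_one_right hs (hU1 u hu))
      have := hμ.integral_exp_sum_abs_le (n := Fin n) (a := fun j => T u j) (Λ := s) (V := s ^ 2)
        (fun j => (by simpa using PiLp.norm_apply_le (T u) j : |T u j| ≤ ‖T u‖).trans h1)
        (by
          have := EuclideanSpace.norm_sq_eq (T u)
          simp only [Real.norm_eq_abs, sq_abs] at this
          rw [← this]
          exact pow_le_pow_left₀ (norm_nonneg _) h1 2) hA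
      simpa using this
    have hi : ∀ u ∈ U, Integrable (fun Y : Fin n → Fin p → ℝ => (n : ℝ)⁻¹ * (Real.exp (-(n * t)) *
        Real.exp (∑ i, |∑ j, T u j * Y i j|))) (Measure.pi fun _ => Measure.pi fun _ => μ) :=
      fun u h => ((hu u h).1.const_mul _).const_mul _
    have hsi := integrable_finsetSum U hi
    refine ⟨((integrable_const t).add hsi).const_mul 2, ?_⟩
    rw [integral_const_mul, integral_add (integrable_const t) hsi, integral_finsetSum U hi]
    have h1 : ∑ u ∈ U, ∫ Y : Fin n → Fin p → ℝ, (n : ℝ)⁻¹ * (Real.exp (-(n * t)) *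
        Real.exp (∑ i, |∑ j, T u j * Y i j|)) ∂(Measure.pi fun _ => Measure.pi fun _ => μ) ≤ 1 := by
      calc _ ≤ ∑ u ∈ U, (n : ℝ)⁻¹ * (Real.exp (-(n * t)) * Real.exp (n * c)) := by
            refine Finset.sum_le_sum fun u h => ?_
            rw [integral_const_mul, integral_const_mul]
            exact mul_le_mul_of_nonneg_left (mul_le_mul_of_nonneg_left (hu u h).2
              (Real.exp_pos _).le) (by positivity)
        _ = (n : ℝ)⁻¹ * (U.card * Real.exp (-(p * Real.log 5))) := by
            rw [Finset.sum_const, nsmul_eq_mul, ← Real.exp_add]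
            have : -(n * t) + n * c = -(p * Real.log 5) := by
              simp only [ht]; field_simp; ring
            rw [this]; ring
        _ ≤ 1 * 1 := by
            refine mul_le_mul (inv_le_one_of_one_le₀ hn1) ?_ (by positivity) zero_le_one
            rw [Real.exp_neg, Real.exp_nat_mul, Real.exp_log (by norm_num),
              mul_inv_le_iff₀ (by positivity), one_mul]
            exact hU3
        _ = 1 := one_mul 1
    simp
    linarith

/-! ### The infimum as a limit of free energies -/

section Infimum

variable {α : Type*} {s : Set α}

theorem abs_sInf_image_sub_le (hs : s.Nonempty) {f g : α → ℝ} (hf : BddBelow (f '' s))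
    (hg : BddBelow (g '' s)) {d : ℝ} (h : ∀ x ∈ s, |f x - g x| ≤ d) :
    |sInf (f '' s) - sInf (g '' s)| ≤ d := by
  have key : ∀ {f g : α → ℝ}, BddBelow (f '' s) → (∀ x ∈ s, |f x - g x| ≤ d) →
      sInf (f '' s) - d ≤ sInf (g '' s) := by
    intro f g hf h
    refine le_csInf (hs.image g) ?_
    rintro _ ⟨x, hx, rfl⟩
    have h1 := csInf_le hf (Set.mem_image_of_mem f hx)
    have h2 := (abs_le.mp (h x hx)).2
    linarith
  have h1 := key hf h
  have h2 := key hg fun x hx => by rw [abs_sub_comm]; exact h x hx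
  rw [abs_le]
  constructor <;> linarith

/-- A sum of positive weights lies between its largest term and the number of terms times a bound
for that term. Here `ρ` is the error of the net, `D` that of `log w m` against `-N f`, and `log
(card M)` the entropy. -/
theorem abs_sInf_image_add_log_le {M : Type*} [Fintype M] [Nonempty M] {f : α → ℝ} {θ : M → α}
    {w : M → ℝ} {ρ N D : ℝ} (hθ : ∀ m, θ m ∈ s) (hcover : ∀ x ∈ s, ∃ m, f (θ m) ≤ f x + ρ)
    (hw : ∀ m, 0 < w m) (hN : 0 < N) (hwf : ∀ m, |Real.log (w m) + N * f (θ m)| ≤ D) :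
    |sInf (f '' s) + Real.log (∑ m, w m) / N| ≤ ρ + (D + Real.log (Fintype.card M)) / N := by
  obtain ⟨m0, -, hm0⟩ := Finset.exists_min_image Finset.univ (fun m => f (θ m))
    Finset.univ_nonempty
  have hlow : ∀ x ∈ s, f (θ m0) - ρ ≤ f x := fun x hx => by
    obtain ⟨m, hm⟩ := hcover x hx
    linarith [hm0 m (Finset.mem_univ m)]
  have hbdd : BddBelow (f '' s) := ⟨f (θ m0) - ρ, by rintro _ ⟨x, hx, rfl⟩; exact hlow x hx⟩
  have h1 : sInf (f '' s) ≤ f (θ m0) := csInf_le hbdd (Set.mem_image_of_mem f (hθ m0))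
  have h2 : f (θ m0) - ρ ≤ sInf (f '' s) :=
    le_csInf (Set.Nonempty.image f ⟨_, hθ m0⟩) (by rintro _ ⟨x, hx, rfl⟩; exact hlow x hx)
  have hS : 0 < ∑ m, w m := Finset.sum_pos (fun m _ => hw m) Finset.univ_nonempty
  have h3 : -N * f (θ m0) - D ≤ Real.log (∑ m, w m) := by
    have := Real.log_le_log (hw m0) (Finset.single_le_sum (fun m _ => (hw m).le) (Finset.mem_univ m0))
    linarith [(abs_le.mp (hwf m0)).1]
  have hcard : (0 : ℝ) < Fintype.card M := by exact_mod_cast Fintype.card_pos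
  have h4 : Real.log (∑ m, w m) ≤ Real.log (Fintype.card M) + (D - N * f (θ m0)) := by
    have : ∑ m, w m ≤ Fintype.card M * Real.exp (D - N * f (θ m0)) := by
      refine (Finset.sum_le_sum fun m _ => ?_).trans (le_of_eq
        (by rw [Finset.sum_const, nsmul_eq_mul, Finset.card_univ]))
      rw [← Real.exp_log (hw m)]
      refine Real.exp_le_exp.mpr ?_
      have := mul_le_mul_of_nonneg_left (hm0 m (Finset.mem_univ m)) hN.le
      linarith [(abs_le.mp (hwf m)).2]
    have := Real.log_le_log hS this
    rwa [Real.log_mul hcard.ne' (Real.exp_pos _).ne', Real.log_exp] at this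
  have hlc : 0 ≤ Real.log (Fintype.card M) :=
    Real.log_nonneg (by exact_mod_cast Fintype.card_pos)
  have h5 : -f (θ m0) - D / N ≤ Real.log (∑ m, w m) / N := by
    rw [le_div_iff₀ hN, sub_mul, div_mul_cancel₀ _ hN.ne']; linarith
  have h6 : Real.log (∑ m, w m) / N ≤ (D + Real.log (Fintype.card M)) / N - f (θ m0) := by
    rw [div_le_iff₀ hN, sub_mul, div_mul_cancel₀ _ hN.ne']; linarith
  have h7 : D / N ≤ (D + Real.log (Fintype.card M)) / N :=
    div_le_div_of_nonneg_right (by linarith) hN.le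
  have hD : 0 ≤ D := (abs_nonneg _).trans (hwf m0)
  have h8 : 0 ≤ (D + Real.log (Fintype.card M)) / N := by positivity
  rw [abs_le]
  constructor <;> linarith

end Infimum

/-! ### The covariance square root, Frobenius norm and continuity of the training error -/

section SqrtOp

variable {p : ℕ} {S : Matrix (Fin p) (Fin p) ℝ}

theorem star_sqrtOp (S : Matrix (Fin p) (Fin p) ℝ) : star (sqrtOp S) = sqrtOp S := by
  rw [sqrtOp, ← map_star]
  congr 1
  exact (CFC.sqrt_nonneg S).isSelfAdjoint

theorem inner_sqrtOp (S : Matrix (Fin p) (Fin p) ℝ) (v w : EuclideanSpace ℝ (Fin p)) :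
    inner ℝ v (sqrtOp S w) = inner ℝ (sqrtOp S v) w := by
  conv_lhs => rw [← star_sqrtOp S, ContinuousLinearMap.star_eq_adjoint]
  exact ContinuousLinearMap.adjoint_inner_right _ _ _

theorem norm_sqrtOp_sq (hS : S.PosSemidef) : ‖sqrtOp S‖ ^ 2 = matrixOpNorm S := by
  have h : star (sqrtOp S) * sqrtOp S =
      (Matrix.toEuclideanCLM (𝕜 := ℝ) S :
        EuclideanSpace ℝ (Fin p) →L[ℝ] EuclideanSpace ℝ (Fin p)) := by
    rw [star_sqrtOp, sqrtOp, ← map_mul, CFC.sqrt_mul_sqrt_self S (Matrix.nonneg_iff_posSemidef.mpr hS)]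
  rw [matrixOpNorm, ← h, sq]
  exact (CStarRing.norm_star_mul_self (x := sqrtOp S)).symm

theorem norm_sqrtOp_apply_le (hS : S.PosSemidef) {K : ℝ} (hK : matrixOpNorm S ≤ K)
    (v : EuclideanSpace ℝ (Fin p)) : ‖sqrtOp S v‖ ≤ Real.sqrt K * ‖v‖ := by
  refine ((sqrtOp S).le_opNorm v).trans (mul_le_mul_of_nonneg_right ?_ (norm_nonneg v))
  exact Real.le_sqrt_of_sq_le ((norm_sqrtOp_sq hS).le.trans hK)

theorem inner_sqrtOp_toLp (S : Matrix (Fin p) (Fin p) ℝ) (v : EuclideanSpace ℝ (Fin p))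
    (y : Fin p → ℝ) : inner ℝ v (sqrtOp S (WithLp.toLp 2 y)) = ∑ j, sqrtOp S v j * y j := by
  rw [inner_sqrtOp, PiLp.inner_apply]
  exact Finset.sum_congr rfl fun j _ => by simp [mul_comm]

end SqrtOp

theorem EuclideanSpace.norm_le_sum_abs {κ : Type*} [Fintype κ] (u : EuclideanSpace ℝ κ) :
    ‖u‖ ≤ ∑ a, |u a| := by
  have := norm_sum_le Finset.univ fun a => u a • EuclideanSpace.basisFun κ ℝ a
  have e := (EuclideanSpace.basisFun κ ℝ).sum_repr u
  simp only [EuclideanSpace.basisFun_repr] at e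
  rw [e] at this
  simpa [norm_smul] using this

theorem norm_appendCoord_sub_sq {k : ℕ} (u u' : Fin k → ℝ) (v v' : ℝ) :
    ‖appendCoord u v - appendCoord u' v'‖ ^ 2 = (∑ a, (u a - u' a) ^ 2) + (v - v') ^ 2 := by
  rw [EuclideanSpace.norm_sq_eq, Fin.sum_univ_castSucc]
  simp [appendCoord]

theorem norm_appendCoord_sub_le {k : ℕ} (u u' : Fin k → ℝ) (v v' : ℝ) {d : ℝ} (hd : 0 ≤ d)
    (h : ∑ a, (u a - u' a) ^ 2 ≤ d ^ 2) :
    ‖appendCoord u v - appendCoord u' v'‖ ≤ d + |v - v'| := by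
  refine abs_le_of_sq_le_sq' ?_ (by positivity) |>.2
  rw [norm_appendCoord_sub_sq, add_sq, sq_abs]
  have : 0 ≤ 2 * d * |v - v'| := by positivity
  linarith

section Frobenius

variable {p k : ℕ}

theorem frobNorm_le_sum (Θ : Fin k → EuclideanSpace ℝ (Fin p)) : frobNorm Θ ≤ ∑ a, ‖Θ a‖ := by
  have h : frobNorm Θ = ‖(WithLp.toLp 2 fun a => ‖Θ a‖ : EuclideanSpace ℝ (Fin k))‖ := by
    rw [frobNorm, EuclideanSpace.norm_eq]
    congr 1
    refine Finset.sum_congr rfl fun a _ => ?_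
    rw [norm_norm, EuclideanSpace.norm_sq_eq]
    simp
  rw [h]
  refine (EuclideanSpace.norm_le_sum_abs _).trans (le_of_eq ?_)
  simp

theorem frobNorm_le_of_forall {Θ : Fin k → EuclideanSpace ℝ (Fin p)} {d : ℝ} (h : ∀ a, ‖Θ a‖ ≤ d) :
    frobNorm Θ ≤ k * d := by
  refine (frobNorm_le_sum Θ).trans ((Finset.sum_le_sum fun a _ => h a).trans (le_of_eq ?_))
  simp

end Frobenius

section TrainingError

variable {n p k : ℕ} {K : ℝ≥0} {R B₀ κ : ℝ} {ℓ : EuclideanSpace ℝ (Fin (k + 1)) → ℝ}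
  {r : (Fin k → EuclideanSpace ℝ (Fin p)) → ℝ} {C : Set (EuclideanSpace ℝ (Fin p))}

/-- The loss is nonnegative, and `r` is Lipschitz on a bounded set. -/
theorem bddBelow_empiricalRisk (hℓ : ∀ u, 0 ≤ ℓ u) (hκ : 0 ≤ κ)
    (hr : ∀ Θ₀ Θ₁ : Fin k → EuclideanSpace ℝ (Fin p), (∀ a, ‖Θ₀ a‖ ≤ R) → (∀ a, ‖Θ₁ a‖ ≤ R) →
      |r Θ₀ - r Θ₁| ≤ κ * frobNorm (fun a => Θ₀ a - Θ₁ a))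
    (hC : C.Nonempty) (hCR : ∀ θ ∈ C, ‖θ‖ ≤ R) (x : Fin n → EuclideanSpace ℝ (Fin p))
    (y : Fin n → ℝ) : BddBelow (empiricalRisk ℓ r x y '' {Θ | ∀ a, Θ a ∈ C}) := by
  obtain ⟨θ₀, h₀⟩ := hC
  refine ⟨r (fun _ => θ₀) - κ * (k * (R + R)), ?_⟩
  rintro _ ⟨Θ, hΘ, rfl⟩
  have h1 := (abs_le.mp (hr Θ (fun _ => θ₀) (fun a => hCR _ (hΘ a)) fun _ => hCR _ h₀)).1
  have h2 : frobNorm (fun a => Θ a - θ₀) ≤ k * (R + R) := frobNorm_le_of_forall fun a =>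
    (norm_sub_le _ _).trans (add_le_add (hCR _ (hΘ a)) (hCR _ h₀))
  have h3 : 0 ≤ (n : ℝ)⁻¹ * ∑ i, ℓ (appendCoord (project Θ (x i)) (y i)) :=
    mul_nonneg (by positivity) (Finset.sum_nonneg fun i _ => hℓ _)
  have h4 := mul_le_mul_of_nonneg_left h2 hκ
  rw [empiricalRisk]
  linarith

/-- For bounded `Θ` the risks are Lipschitz in the data with a common constant, and so is their
infimum; `r` cancels in the differences. Continuity supplies measurability later. -/
theorem continuous_trainingError (hℓ : ∀ u, 0 ≤ ℓ u) (hℓK : LipschitzWith K ℓ) (hκ : 0 ≤ κ)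
    (hr : ∀ Θ₀ Θ₁ : Fin k → EuclideanSpace ℝ (Fin p), (∀ a, ‖Θ₀ a‖ ≤ R) → (∀ a, ‖Θ₁ a‖ ≤ R) →
      |r Θ₀ - r Θ₁| ≤ κ * frobNorm (fun a => Θ₀ a - Θ₁ a))
    (hC : C.Nonempty) (hCR : ∀ θ ∈ C, ‖θ‖ ≤ R) :
    Continuous fun q : (Fin n → EuclideanSpace ℝ (Fin p)) × (Fin n → ℝ) =>
      trainingError ℓ r C q.1 q.2 := by
  have hR : 0 ≤ R := by
    obtain ⟨θ₀, h₀⟩ := hC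
    exact (norm_nonneg _).trans (hCR _ h₀)
  have hb := bddBelow_empiricalRisk (n := n) hℓ hκ hr hC hCR
  have hne : {Θ : Fin k → EuclideanSpace ℝ (Fin p) | ∀ a, Θ a ∈ C}.Nonempty := by
    obtain ⟨θ₀, h₀⟩ := hC
    exact ⟨fun _ => θ₀, fun _ => h₀⟩
  have key : ∀ q q' : (Fin n → EuclideanSpace ℝ (Fin p)) × (Fin n → ℝ),
      |trainingError ℓ r C q.1 q.2 - trainingError ℓ r C q'.1 q'.2| ≤
        (n : ℝ)⁻¹ * ∑ i, K * (k * (R * ‖q.1 i - q'.1 i‖) + |q.2 i - q'.2 i|) := by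
    intro q q'
    refine abs_sInf_image_sub_le hne (hb _ _) (hb _ _) fun Θ hΘ => ?_
    rw [empiricalRisk, empiricalRisk, add_sub_add_right_eq_sub, ← mul_sub, ← Finset.sum_sub_distrib,
      abs_mul, abs_of_nonneg (by positivity : 0 ≤ (n : ℝ)⁻¹)]
    refine mul_le_mul_of_nonneg_left ((Finset.abs_sum_le_sum_abs _ _).trans
      (Finset.sum_le_sum fun i _ => ?_)) (by positivity)
    have h1 := hℓK.dist_le_mul (appendCoord (project Θ (q.1 i)) (q.2 i))
      (appendCoord (project Θ (q'.1 i)) (q'.2 i))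
    rw [Real.dist_eq, dist_eq_norm] at h1
    refine h1.trans (mul_le_mul_of_nonneg_left (norm_appendCoord_sub_le _ _ _ _ (by positivity) ?_)
      K.coe_nonneg)
    have h2 : ∀ a, (project Θ (q.1 i) a - project Θ (q'.1 i) a) ^ 2 ≤
        (R * ‖q.1 i - q'.1 i‖) ^ 2 := fun a => by
      rw [project, project, ← inner_sub_right, ← sq_abs]
      refine pow_le_pow_left₀ (abs_nonneg _) ((abs_real_inner_le_norm _ _).trans ?_) 2
      exact mul_le_mul_of_nonneg_right (hCR _ (hΘ a)) (norm_nonneg _)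
    refine (Finset.sum_le_sum fun a _ => h2 a).trans ?_
    rw [Finset.sum_const, Finset.card_univ, Fintype.card_fin, nsmul_eq_mul, mul_pow (k : ℝ)]
    refine mul_le_mul_of_nonneg_right ?_ (by positivity)
    -- `k ≤ k²`: the factor `k` is used in place of `√k`.
    exact_mod_cast Nat.le_self_pow (by norm_num) k
  refine continuous_iff_continuousAt.mpr fun q => ?_
  rw [ContinuousAt, tendsto_iff_dist_tendsto_zero]
  have hlim : Tendsto (fun q' : (Fin n → EuclideanSpace ℝ (Fin p)) × (Fin n → ℝ) =>
      (n : ℝ)⁻¹ * ∑ i, K * (k * (R * ‖q'.1 i - q.1 i‖) + |q'.2 i - q.2 i|)) (𝓝 q) (𝓝 0) := by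
    have hc : Continuous (fun q' : (Fin n → EuclideanSpace ℝ (Fin p)) × (Fin n → ℝ) =>
      (n : ℝ)⁻¹ * ∑ i, (K : ℝ) * (k * (R * ‖q'.1 i - q.1 i‖) + |q'.2 i - q.2 i|)) := by fun_prop
    have := hc.tendsto q
    simpa using this
  exact squeeze_zero (fun _ => dist_nonneg) (fun q' => by rw [Real.dist_eq]; exact key q' q) hlim

end TrainingError

/-! ### The risk as a function of linear forms in the white features -/

section CombinedLoss

variable {n p k kstar : ℕ}

/-- The loss as a function of the projections on the estimated and on the true parameters. -/
def combinedLoss (ℓ : EuclideanSpace ℝ (Fin (k + 1)) → ℝ)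
    (η : EuclideanSpace ℝ (Fin (kstar + 1)) → ℝ) (e : ℝ)
    (u : EuclideanSpace ℝ (Fin k ⊕ Fin kstar)) : ℝ :=
  ℓ (appendCoord (fun a => u (Sum.inl a)) (η (appendCoord (fun a => u (Sum.inr a)) e)))

/-- In `K * (1 + K)`, the outer `K` is that of `ℓ`, the `1` comes from the projections on the
estimate and the inner `K` from the response through `η`. -/
theorem lipschitzWith_combinedLoss {K : ℝ≥0} {ℓ : EuclideanSpace ℝ (Fin (k + 1)) → ℝ}
    {η : EuclideanSpace ℝ (Fin (kstar + 1)) → ℝ} (hℓ : LipschitzWith K ℓ) (hη : LipschitzWith K η)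
    (e : ℝ) : LipschitzWith (K * (1 + K)) (combinedLoss ℓ η e) := by
  refine LipschitzWith.of_dist_le_mul fun u u' => ?_
  have hsq := EuclideanSpace.norm_sq_eq (u - u')
  rw [Fintype.sum_sum_type] at hsq
  simp only [Real.norm_eq_abs, sq_abs, PiLp.sub_apply] at hsq
  have hl : 0 ≤ ∑ a, (u (Sum.inl a) - u' (Sum.inl a)) ^ 2 := Finset.sum_nonneg fun _ _ => sq_nonneg _
  have hr : 0 ≤ ∑ a, (u (Sum.inr a) - u' (Sum.inr a)) ^ 2 := Finset.sum_nonneg fun _ _ => sq_nonneg _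
  rw [dist_eq_norm u u']
  have h1 := norm_appendCoord_sub_le (fun a => u (Sum.inr a)) (fun a => u' (Sum.inr a)) e e
    (norm_nonneg (u - u')) (by linarith)
  rw [sub_self, abs_zero, add_zero] at h1
  have h2 := hη.dist_le_mul (appendCoord (fun a => u (Sum.inr a)) e)
    (appendCoord (fun a => u' (Sum.inr a)) e)
  rw [Real.dist_eq, dist_eq_norm] at h2
  have h3 := norm_appendCoord_sub_le (fun a => u (Sum.inl a)) (fun a => u' (Sum.inl a))
    (η (appendCoord (fun a => u (Sum.inr a)) e)) (η (appendCoord (fun a => u' (Sum.inr a)) e))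
    (norm_nonneg (u - u')) (by linarith)
  have h4 := hℓ.dist_le_mul (appendCoord (fun a => u (Sum.inl a))
    (η (appendCoord (fun a => u (Sum.inr a)) e))) (appendCoord (fun a => u' (Sum.inl a))
    (η (appendCoord (fun a => u' (Sum.inr a)) e)))
  rw [dist_eq_norm (appendCoord _ _)] at h4
  refine h4.trans ?_
  push_cast
  rw [mul_assoc]
  refine mul_le_mul_of_nonneg_left ?_ K.coe_nonneg
  have h5 := mul_le_mul_of_nonneg_left h1 K.coe_nonneg
  linarith

/-- The `j`-th row of the matrix with columns `T Θ`, followed by those of `T Θstar`. -/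
def loadings (T : EuclideanSpace ℝ (Fin p) →L[ℝ] EuclideanSpace ℝ (Fin p))
    (Θ : Fin k → EuclideanSpace ℝ (Fin p)) (Θstar : Fin kstar → EuclideanSpace ℝ (Fin p))
    (j : Fin p) : EuclideanSpace ℝ (Fin k ⊕ Fin kstar) :=
  WithLp.toLp 2 (Sum.elim (fun a => T (Θ a) j) (fun a => T (Θstar a) j))

theorem sum_smul_apply {ι κ : Type*} [Fintype ι] [Fintype κ] (y : ι → ℝ)
    (a : ι → EuclideanSpace ℝ κ) (l : κ) : (∑ j, y j • a j) l = ∑ j, a j l * y j := by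
  simp only [WithLp.ofLp_sum, Finset.sum_apply, PiLp.smul_apply, smul_eq_mul]
  exact Finset.sum_congr rfl fun j _ => mul_comm _ _

/-- Self-adjointness moves `Σ^{1/2}` from the features to the parameters. After this, only linear
forms in independent entries occur. -/
theorem empiricalRisk_eq (ℓ : EuclideanSpace ℝ (Fin (k + 1)) → ℝ)
    (r : (Fin k → EuclideanSpace ℝ (Fin p)) → ℝ) (η : EuclideanSpace ℝ (Fin (kstar + 1)) → ℝ)
    (S : Matrix (Fin p) (Fin p) ℝ) (Θ : Fin k → EuclideanSpace ℝ (Fin p))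
    (Θstar : Fin kstar → EuclideanSpace ℝ (Fin p)) (Y : Fin n → Fin p → ℝ) (e : Fin n → ℝ) :
    empiricalRisk ℓ r (fun i => sqrtOp S (WithLp.toLp 2 (Y i)))
      (responses η Θstar (fun i => sqrtOp S (WithLp.toLp 2 (Y i))) e) Θ =
    (n : ℝ)⁻¹ * ∑ i, combinedLoss ℓ η (e i) (∑ j, Y i j • loadings (sqrtOp S) Θ Θstar j) + r Θ := by
  rw [empiricalRisk]
  congr 2
  refine Finset.sum_congr rfl fun i _ => ?_
  rw [combinedLoss, responses]
  simp only [sum_smul_apply, loadings, Sum.elim_inl, Sum.elim_inr, ← inner_sqrtOp_toLp]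
  rfl

/-- In the application `b = R p^{-α}`: this is how delocalization, of the candidates and of the true
parameters alike, makes each single entry negligible. -/
theorem norm_loadings_le {T : EuclideanSpace ℝ (Fin p) →L[ℝ] EuclideanSpace ℝ (Fin p)}
    {Θ : Fin k → EuclideanSpace ℝ (Fin p)} {Θstar : Fin kstar → EuclideanSpace ℝ (Fin p)} {b : ℝ}
    (h : ∀ a j, |T (Θ a) j| ≤ b) (hstar : ∀ a j, |T (Θstar a) j| ≤ b) (j : Fin p) :
    ‖loadings T Θ Θstar j‖ ≤ (k + kstar) * b := by
  refine (EuclideanSpace.norm_le_sum_abs _).trans ?_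
  rw [Fintype.sum_sum_type, add_mul]
  refine add_le_add ((Finset.sum_le_sum fun a _ => h a j).trans (le_of_eq (by simp)))
    ((Finset.sum_le_sum fun a _ => hstar a j).trans (le_of_eq (by simp)))

theorem sum_norm_loadings_sq_le {T : EuclideanSpace ℝ (Fin p) →L[ℝ] EuclideanSpace ℝ (Fin p)}
    {Θ : Fin k → EuclideanSpace ℝ (Fin p)} {Θstar : Fin kstar → EuclideanSpace ℝ (Fin p)} {V : ℝ}
    (h : ∀ a, ‖T (Θ a)‖ ^ 2 ≤ V) (hstar : ∀ a, ‖T (Θstar a)‖ ^ 2 ≤ V) :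
    ∑ j, ‖loadings T Θ Θstar j‖ ^ 2 ≤ (k + kstar) * V := by
  have e : ∑ j, ‖loadings T Θ Θstar j‖ ^ 2 = ∑ a, ‖T (Θ a)‖ ^ 2 + ∑ a, ‖T (Θstar a)‖ ^ 2 := by
    simp only [EuclideanSpace.norm_sq_eq, Fintype.sum_sum_type, loadings, Sum.elim_inl, Sum.elim_inr,
      Finset.sum_add_distrib]
    rw [Finset.sum_comm]
    congr 1
    rw [Finset.sum_comm]
  rw [e, add_mul]
  refine add_le_add ((Finset.sum_le_sum fun a _ => h a).trans (le_of_eq (by simp)))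
    ((Finset.sum_le_sum fun a _ => hstar a).trans (le_of_eq (by simp)))

theorem norm_sum_loadings_sub_le (T : EuclideanSpace ℝ (Fin p) →L[ℝ] EuclideanSpace ℝ (Fin p))
    (Θ Θ' : Fin k → EuclideanSpace ℝ (Fin p)) (Θstar : Fin kstar → EuclideanSpace ℝ (Fin p))
    (y : Fin p → ℝ) :
    ‖∑ j, y j • loadings T Θ Θstar j - ∑ j, y j • loadings T Θ' Θstar j‖ ≤
      ∑ a, |∑ j, T (Θ a - Θ' a) j * y j| := by
  refine (EuclideanSpace.norm_le_sum_abs _).trans (le_of_eq ?_)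
  rw [Fintype.sum_sum_type]
  simp only [PiLp.sub_apply, sum_smul_apply, loadings, Sum.elim_inl, Sum.elim_inr, sub_self,
    abs_zero, Finset.sum_const_zero, add_zero]
  simp only [map_sub, PiLp.sub_apply, sub_mul, Finset.sum_sub_distrib]

end CombinedLoss

/-! ### Comparison of two entry laws for fixed noise -/

noncomputable section

theorem SmoothBounded.abs_sub_le {B : ℝ} {ψ : ℝ → ℝ} (h : SmoothBounded B ψ) (x y : ℝ) :
    |ψ x - ψ y| ≤ B * |x - y| := by
  obtain ⟨-, ψ1, ψ2, ψ3, h1, -, -, hb⟩ := h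
  simpa using Convex.norm_image_sub_le_of_norm_hasDerivWithin_le (f := ψ) (f' := ψ1)
    (C := B) (s := Set.univ) (x := y) (y := x) (fun x _ => (h1 x).hasDerivWithinAt)
    (fun x _ => (hb x).1) convex_univ (Set.mem_univ _) (Set.mem_univ _)

section DesignError

variable {n p k kstar : ℕ}

/-- The training error as a function of the white features `Y` and of the noise `e`. -/
def designError (ℓ : EuclideanSpace ℝ (Fin (k + 1)) → ℝ)
    (η : EuclideanSpace ℝ (Fin (kstar + 1)) → ℝ)
    (r : (Fin k → EuclideanSpace ℝ (Fin p)) → ℝ) (S : Matrix (Fin p) (Fin p) ℝ)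
    (Θstar : Fin kstar → EuclideanSpace ℝ (Fin p)) (C : Set (EuclideanSpace ℝ (Fin p)))
    (e : Fin n → ℝ) (Y : Fin n → Fin p → ℝ) : ℝ :=
  trainingError ℓ r C (fun i => sqrtOp S (WithLp.toLp 2 (Y i)))
    (responses η Θstar (fun i => sqrtOp S (WithLp.toLp 2 (Y i))) e)

/-- The error of the comparison of two designs at inverse temperature `β` and net scale `δ`. -/
def designErrorBound (A : ℝ → ℝ) (q B K R κ Cq : ℝ) (k : ℕ) (β δ b g : ℝ) : ℝ :=
  swapConst A q B (6 * (β * (K * (1 + K)))) (q * R) (q * (K * R ^ 2)) * (q * b) / β +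
    2 * (B * (κ * (k * δ) + K * (1 + K) * (k * δ) *
      (2 * (g * Real.log 5 + (Real.log 2 + Real.sqrt K ^ 2 * (2 * A (Real.sqrt K + 1))) + 1)) +
      (Cq + k * (g * Real.log (1 + 2 * R / δ))) / β))

variable {ℓ : EuclideanSpace ℝ (Fin (k + 1)) → ℝ}
  {η : EuclideanSpace ℝ (Fin (kstar + 1)) → ℝ}
  {r : (Fin k → EuclideanSpace ℝ (Fin p)) → ℝ} {S : Matrix (Fin p) (Fin p) ℝ}
  {Θstar : Fin kstar → EuclideanSpace ℝ (Fin p)} {C : Set (EuclideanSpace ℝ (Fin p))}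
  {K : ℝ≥0} {R α κ : ℝ}

theorem continuous_trainingError_responses (hℓ0 : ∀ u, 0 ≤ ℓ u) (hℓ : LipschitzWith K ℓ)
    (hη : LipschitzWith K η) (hκ : 0 ≤ κ)
    (hr : ∀ Θ₀ Θ₁ : Fin k → EuclideanSpace ℝ (Fin p), (∀ a, ‖Θ₀ a‖ ≤ R) → (∀ a, ‖Θ₁ a‖ ≤ R) →
      |r Θ₀ - r Θ₁| ≤ κ * frobNorm (fun a => Θ₀ a - Θ₁ a))
    (hC : C.Nonempty) (hCR : ∀ θ ∈ C, ‖θ‖ ≤ R) :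
    Continuous fun q : (Fin n → EuclideanSpace ℝ (Fin p)) × (Fin n → ℝ) =>
      trainingError ℓ r C q.1 (responses η Θstar q.1 q.2) := by
  have h := continuous_trainingError (n := n) hℓ0 hℓ hκ hr hC hCR
  have hηc := hη.continuous
  have happ : Continuous fun z : (Fin kstar → ℝ) × ℝ => appendCoord z.1 z.2 := by
    unfold appendCoord
    refine (PiLp.continuous_toLp 2 _).comp (continuous_pi fun i => ?_)
    refine Fin.lastCases ?_ (fun j => ?_) i
    · simpa using continuous_snd
    · simp only [Fin.snoc_castSucc]; fun_prop
  have hy : Continuous fun q : (Fin n → EuclideanSpace ℝ (Fin p)) × (Fin n → ℝ) =>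
      responses η Θstar q.1 q.2 := by
    refine continuous_pi fun i => hηc.comp (happ.comp (Continuous.prodMk ?_ (by fun_prop)))
    refine continuous_pi fun a => ?_
    fun_prop
  have hc := h.comp (continuous_fst.prodMk hy)
  simpa only [Function.comp_def] using hc

theorem continuous_designError (hℓ0 : ∀ u, 0 ≤ ℓ u) (hℓ : LipschitzWith K ℓ) (hη : LipschitzWith K η)
    (hκ : 0 ≤ κ)
    (hr : ∀ Θ₀ Θ₁ : Fin k → EuclideanSpace ℝ (Fin p), (∀ a, ‖Θ₀ a‖ ≤ R) → (∀ a, ‖Θ₁ a‖ ≤ R) →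
      |r Θ₀ - r Θ₁| ≤ κ * frobNorm (fun a => Θ₀ a - Θ₁ a))
    (hC : C.Nonempty) (hCR : ∀ θ ∈ C, ‖θ‖ ≤ R) :
    Continuous fun q : (Fin n → Fin p → ℝ) × (Fin n → ℝ) => designError ℓ η r S Θstar C q.2 q.1 := by
  have hx : Continuous fun q : (Fin n → Fin p → ℝ) × (Fin n → ℝ) =>
      ((fun i => sqrtOp S (WithLp.toLp 2 (q.1 i)), q.2) :
        (Fin n → EuclideanSpace ℝ (Fin p)) × (Fin n → ℝ)) := by fun_prop
  have hc := (continuous_trainingError_responses (n := n) (Θstar := Θstar) hℓ0 hℓ hη hκ hr hC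
    hCR).comp hx
  unfold designError
  simpa only [Function.comp_def] using hc

/-- Passing to the net changes the regularizer by `κ k δ` and the average loss by its Lipschitz
constant times `k δ h`. The last term collects the smoothing error `Cq` of each observation and the
entropy `D` of the net. -/
theorem abs_designError_add_log_le (hn : 0 < n) (hp : 0 < p) {K : ℝ≥0} {R κ : ℝ} (hκ : 0 ≤ κ)
    (hℓ : LipschitzWith K ℓ) (hη : LipschitzWith K η)
    (hr : ∀ Θ₀ Θ₁ : Fin k → EuclideanSpace ℝ (Fin p), (∀ a, ‖Θ₀ a‖ ≤ R) → (∀ a, ‖Θ₁ a‖ ≤ R) →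
      |r Θ₀ - r Θ₁| ≤ κ * frobNorm (fun a => Θ₀ a - Θ₁ a))
    (hCR : ∀ θ ∈ C, ‖θ‖ ≤ R) {δ β Cq h D : ℝ}
    {T : Finset (EuclideanSpace ℝ (Fin p))} [Nonempty (Fin k → T)] (hT : ∀ x ∈ T, x ∈ C)
    (hTC : ∀ x ∈ C, ∃ y ∈ T, ‖x - y‖ ≤ δ) (hβ : 0 < β)
    (hcard : Real.log (Fintype.card (Fin k → T)) ≤ D) (e : Fin n → ℝ) (Y : Fin n → Fin p → ℝ)
    (hh : ∀ v, (n : ℝ)⁻¹ * ∑ i, |∑ j, sqrtOp S v j * Y i j| ≤ h * ‖v‖)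
    {W : Fin n → EuclideanSpace ℝ (Fin k ⊕ Fin kstar) → ℝ} (hWpos : ∀ i u, 0 < W i u)
    (hW : ∀ i u, |Real.log (W i u) + β * combinedLoss ℓ η (e i) u| ≤ Cq) :
    |designError ℓ η r S Θstar C e Y + Real.log (∑ m : Fin k → T,
      Real.exp (-(β * n * r fun a => m a)) *
        ∏ i, W i (∑ j, Y i j • loadings (sqrtOp S) (fun a => (m a : EuclideanSpace ℝ (Fin p))) Θstar j))
        / (β * n)| ≤
      κ * (k * δ) + K * (1 + K) * (k * δ) * h + (n * Cq + D) / (β * n) := by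
  have hn' : (0 : ℝ) < n := by exact_mod_cast hn
  -- Nonnegativity of `h` is read off at a unit vector, which exists because `p > 0`.
  have hh0 : 0 ≤ h := by
    have h1 := hh (EuclideanSpace.single ⟨0, hp⟩ 1)
    rw [PiLp.norm_single, norm_one, mul_one] at h1
    exact (mul_nonneg (by positivity) (Finset.sum_nonneg fun i _ => abs_nonneg _)).trans h1
  have hL := fun i => lipschitzWith_combinedLoss hℓ hη (e i)
  have hmain := abs_sInf_image_add_log_le (s := {Θ : Fin k → EuclideanSpace ℝ (Fin p) | ∀ a, Θ a ∈ C})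
    (f := empiricalRisk ℓ r (fun i => sqrtOp S (WithLp.toLp 2 (Y i)))
      (responses η Θstar (fun i => sqrtOp S (WithLp.toLp 2 (Y i))) e))
    (θ := fun (m : Fin k → T) a => (m a : EuclideanSpace ℝ (Fin p)))
    (w := fun m => Real.exp (-(β * n * r fun a => m a)) * ∏ i, W i (∑ j, Y i j •
      loadings (sqrtOp S) (fun a => (m a : EuclideanSpace ℝ (Fin p))) Θstar j))
    (ρ := κ * (k * δ) + K * (1 + K) * (k * δ) * h) (N := β * n) (D := n * Cq)
    (fun m a => hT _ (m a).2) (fun Θ hΘ => ?_)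
    (fun m => mul_pos (Real.exp_pos _) (Finset.prod_pos fun i _ => hWpos i _)) (by positivity)
    (fun m => ?_)
  · refine hmain.trans (add_le_add_right (div_le_div_of_nonneg_right ?_ (by positivity)) _)
    exact add_le_add_right hcard _
  · choose y hyT hy using fun a => hTC (Θ a) (hΘ a)
    refine ⟨fun a => ⟨y a, hyT a⟩, ?_⟩
    simp only [empiricalRisk_eq]
    have hr1 := (abs_le.mp (hr y Θ (fun a => hCR _ (hT _ (hyT a))) fun a => hCR _ (hΘ a))).2
    have hf : frobNorm (fun a => y a - Θ a) ≤ k * δ := frobNorm_le_of_forall fun a => by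
      rw [norm_sub_rev]; exact hy a
    have hr2 := mul_le_mul_of_nonneg_left hf hκ
    have hl : (n : ℝ)⁻¹ * ∑ i, combinedLoss ℓ η (e i) (∑ j, Y i j • loadings (sqrtOp S) y Θstar j) ≤
        (n : ℝ)⁻¹ * ∑ i, combinedLoss ℓ η (e i) (∑ j, Y i j • loadings (sqrtOp S) Θ Θstar j) +
          K * (1 + K) * (k * δ) * h := by
      have h1 : ∀ i, combinedLoss ℓ η (e i) (∑ j, Y i j • loadings (sqrtOp S) y Θstar j) ≤
          combinedLoss ℓ η (e i) (∑ j, Y i j • loadings (sqrtOp S) Θ Θstar j) +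
          K * (1 + K) * ∑ a, |∑ j, sqrtOp S (y a - Θ a) j * Y i j| := fun i => by
        have h2 := (hL i).dist_le_mul (∑ j, Y i j • loadings (sqrtOp S) y Θstar j)
          (∑ j, Y i j • loadings (sqrtOp S) Θ Θstar j)
        rw [Real.dist_eq, dist_eq_norm] at h2
        push_cast at h2
        have h3 := mul_le_mul_of_nonneg_left
          (norm_sum_loadings_sub_le (sqrtOp S) y Θ Θstar (Y i))
          (by positivity : (0 : ℝ) ≤ K * (1 + K))
        linarith [(abs_le.mp h2).2]
      have h4 : (n : ℝ)⁻¹ * ∑ i, (K * (1 + K) * ∑ a, |∑ j, sqrtOp S (y a - Θ a) j * Y i j| : ℝ) ≤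
          K * (1 + K) * (k * δ) * h := by
        rw [← Finset.mul_sum, Finset.sum_comm, mul_left_comm, mul_assoc (_ * _ : ℝ)]
        refine mul_le_mul_of_nonneg_left ?_ (by positivity)
        rw [Finset.mul_sum]
        refine (Finset.sum_le_sum fun a _ => (hh (y a - Θ a)).trans
          (mul_le_mul_of_nonneg_left (by rw [norm_sub_rev]; exact hy a : ‖y a - Θ a‖ ≤ δ) hh0)).trans
          (le_of_eq ?_)
        rw [Finset.sum_const, Finset.card_univ, Fintype.card_fin, nsmul_eq_mul]
        ring
      refine (mul_le_mul_of_nonneg_left (Finset.sum_le_sum fun i _ => h1 i)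
        (by positivity : 0 ≤ (n : ℝ)⁻¹)).trans ?_
      rw [Finset.sum_add_distrib, mul_add]
      linarith
    linarith
  · rw [Real.log_mul (Real.exp_pos _).ne' (Finset.prod_pos fun i _ => hWpos i _).ne', Real.log_exp,
      Real.log_prod fun i _ => (hWpos i _).ne']
    simp only [empiricalRisk_eq]
    have h1 : ∀ (s t : Fin n → ℝ) (x : ℝ), -(β * n * x) + ∑ i, s i + β * n * ((n : ℝ)⁻¹ * ∑ i, t i + x) =
        ∑ i, (s i + β * t i) := fun s t x => by
      rw [Finset.sum_add_distrib, ← Finset.mul_sum]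
      field_simp
      ring
    rw [h1]
    refine (Finset.abs_sum_le_sum_abs _ _).trans ((Finset.sum_le_sum fun i _ => hW i _).trans
      (le_of_eq (by simp)))

/-- The free energy is an intermediary: it is close to the training error in expectation under each
of the two laws, and its own law is nearly unchanged by the exchange. The factor `2` in
`designErrorBound` counts the two approximations. -/
theorem abs_integral_designError_sub_le (hn : 0 < n) (hp : 0 < p) {A : ℝ → ℝ} {μ γ : Measure ℝ}
    (hμ : ExpBounded A μ) (hγ : ExpBounded A γ) (hvar : ∫ x, x ^ 2 ∂μ = ∫ x, x ^ 2 ∂γ)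
    (hK : 0 < K) (hR : 0 < R) (hα : 0 < α) (hκ : 0 ≤ κ)
    (hℓ0 : ∀ u, 0 ≤ ℓ u) (hℓ : LipschitzWith K ℓ) (hη : LipschitzWith K η)
    (hr : ∀ Θ₀ Θ₁ : Fin k → EuclideanSpace ℝ (Fin p), (∀ a, ‖Θ₀ a‖ ≤ R) → (∀ a, ‖Θ₁ a‖ ≤ R) →
      |r Θ₀ - r Θ₁| ≤ κ * frobNorm (fun a => Θ₀ a - Θ₁ a))
    (hS : S.PosSemidef) (hSop : matrixOpNorm S ≤ K)
    (hΘstar : ∀ a, Θstar a ∈ delocalizedSet S R α) (hC : C.Nonempty)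
    (hCsub : C ⊆ delocalizedSet S R α) (e : Fin n → ℝ) {Cq : ℝ}
    (hCq : ∀ (Λ : ℝ≥0) (L : EuclideanSpace ℝ (Fin k ⊕ Fin kstar) → ℝ), 0 < Λ → LipschitzWith Λ L →
      ∃ W : EuclideanSpace ℝ (Fin k ⊕ Fin kstar) → ℝ,
        (∀ u w, RelSmooth (6 * Λ * ‖w‖) fun t => W (u + t • w)) ∧ ∀ u, |Real.log (W u) + L u| ≤ Cq)
    {B : ℝ} (hB : 0 ≤ B) {ψ : ℝ → ℝ} (hψ : SmoothBounded B ψ) {β : ℝ≥0} (hβ : 0 < β)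
    (hN : 1 ≤ β * (n : ℝ)) {δ : ℝ} (hδ : 0 < δ) :
    |(∫ Y, ψ (designError ℓ η r S Θstar C e Y) ∂Measure.pi (fun _ : Fin n => Measure.pi
        (fun _ : Fin p => μ))) - ∫ Y, ψ (designError ℓ η r S Θstar C e Y) ∂Measure.pi
        (fun _ : Fin n => Measure.pi (fun _ : Fin p => γ))| ≤
      designErrorBound A ((k + kstar : ℕ) : ℝ) B K R κ Cq k β δ (R * (p : ℝ) ^ (-α)) ((p : ℝ) / n) := by
  have hβ' : (0 : ℝ) < β := hβ
  have hn' : (0 : ℝ) < n := by exact_mod_cast hn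
  have hCR : ∀ θ ∈ C, ‖θ‖ ≤ R := fun θ h => (hCsub h).2
  obtain ⟨T, hT, hTC, hTcard⟩ := exists_net hR.le hδ C hCR
  have hTne : Nonempty T := by
    obtain ⟨θ, hθ⟩ := hC
    obtain ⟨y, hy, -⟩ := hTC θ hθ
    exact ⟨⟨y, hy⟩⟩
  have hMne : Nonempty (Fin k → T) := inferInstance
  rw [finrank_euclideanSpace_fin] at hTcard
  have hcard : Real.log (Fintype.card (Fin k → T)) ≤ k * (p * Real.log (1 + 2 * R / δ)) := by
    rw [Fintype.card_fun, Fintype.card_fin, Fintype.card_coe]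
    push_cast
    rw [Real.log_pow, ← Real.log_pow _ p]
    refine mul_le_mul_of_nonneg_left (Real.log_le_log ?_ hTcard) (Nat.cast_nonneg _)
    have : 0 < T.card := Finset.card_pos.mpr ⟨_, hTne.some.2⟩
    exact_mod_cast this
  have hT0 : ∀ v, ‖sqrtOp S v‖ ≤ Real.sqrt K * ‖v‖ := norm_sqrtOp_apply_le hS hSop
  have hA1 : 0 ≤ A (Real.sqrt K + 1) := hμ.nonneg (by positivity)
  obtain ⟨H, hH, hHint⟩ := exists_seminorm_bound (p := p) hn (Real.sqrt_nonneg K) hA1 (sqrtOp S) hT0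
  have hLL : ∀ i, LipschitzWith (β * (K * (1 + K))) fun u => (β : ℝ) * combinedLoss ℓ η (e i) u := by
    intro i
    refine LipschitzWith.of_dist_le_mul fun u v => ?_
    rw [Real.dist_eq, ← mul_sub, abs_mul, abs_of_pos hβ', ← Real.dist_eq]
    push_cast
    rw [mul_assoc]
    refine mul_le_mul_of_nonneg_left ?_ hβ'.le
    simpa using (lipschitzWith_combinedLoss hℓ hη (e i)).dist_le_mul u v
  choose W hWs hWL using fun i => hCq (β * (K * (1 + K))) _ (by positivity) (hLL i)
  have hWpos := fun i => weight_pos (hWs i)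
  set N := (β : ℝ) * n with hNdef
  set F : (Fin n → Fin p → ℝ) → ℝ := fun Y => -(Real.log (∑ m : Fin k → T,
      Real.exp (-(N * r fun a => m a)) *
        ∏ i, W i (∑ j, Y i j • loadings (sqrtOp S) (fun a => (m a : EuclideanSpace ℝ (Fin p))) Θstar j))
        / N) with hF
  have hclose : ∀ Y, |designError ℓ η r S Θstar C e Y - F Y| ≤ κ * (k * δ) +
      K * (1 + K) * (k * δ) * H Y + (n * Cq + k * (p * Real.log (1 + 2 * R / δ))) / N := fun Y => by
    have := abs_designError_add_log_le (Θstar := Θstar) hn hp hκ hℓ hη hr hCR hT hTC hβ' hcard e Y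
      (hH Y) hWpos hWL
    simpa only [hF, sub_neg_eq_add] using this
  set G := (p : ℝ) / n * Real.log 5 + (Real.log 2 + Real.sqrt K ^ 2 * (2 * A (Real.sqrt K + 1))) + 1
    with hG
  set Q := (Cq + k * ((p : ℝ) / n * Real.log (1 + 2 * R / δ))) / β with hQ
  have hQe : (n * Cq + k * (p * Real.log (1 + 2 * R / δ))) / N = Q := by
    simp only [hQ, hNdef]; field_simp
  rw [hQe] at hclose
  have hψc := hψ.continuous
  have hdc : Continuous fun Y : Fin n → Fin p → ℝ => designError ℓ η r S Θstar C e Y := by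
    have hc := (continuous_designError (n := n) (S := S) (Θstar := Θstar) hℓ0 hℓ hη hκ hr hC
      hCR).comp (by fun_prop : Continuous fun Y : Fin n → Fin p → ℝ => (Y, e))
    simpa only [Function.comp_def] using hc
  have hFc : Continuous F := by
    have hWc := fun i => continuous_weight (by positivity) (hWs i)
    have : Continuous fun Y : Fin n → Fin p → ℝ => Real.log (∑ m : Fin k → T,
      Real.exp (-(N * r fun a => m a)) * ∏ i, W i (∑ j, Y i j •
        loadings (sqrtOp S) (fun a => (m a : EuclideanSpace ℝ (Fin p))) Θstar j)) :=
      Continuous.log (by fun_prop) fun Y => (Finset.sum_pos (fun m _ => mul_pos (Real.exp_pos _)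
        (Finset.prod_pos fun i _ => hWpos i _)) Finset.univ_nonempty).ne'
    fun_prop
  have hpart : ∀ ρ : Measure ℝ, ExpBounded A ρ →
      |(∫ Y, ψ (designError ℓ η r S Θstar C e Y) ∂Measure.pi (fun _ : Fin n => Measure.pi
        (fun _ : Fin p => ρ))) - ∫ Y, ψ (F Y) ∂Measure.pi (fun _ : Fin n => Measure.pi
        (fun _ : Fin p => ρ))| ≤
      B * (κ * (k * δ) + K * (1 + K) * (k * δ) * (2 * G) + Q) := by
    intro ρ hρ
    have := hρ.prob
    obtain ⟨hi, hle⟩ := hHint ρ hρ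
    have hi1 : Integrable (fun Y => κ * (k * δ) + K * (1 + K) * (k * δ) * H Y)
        (Measure.pi (fun _ : Fin n => Measure.pi (fun _ : Fin p => ρ))) :=
      (integrable_const _).add (hi.const_mul _)
    have hb : ∀ g : (Fin n → Fin p → ℝ) → ℝ, Continuous g → Integrable (fun Y => ψ (g Y))
        (Measure.pi (fun _ : Fin n => Measure.pi (fun _ : Fin p => ρ))) := fun g hg =>
      Integrable.of_bound (hψc.comp hg).aestronglyMeasurable B
        (Eventually.of_forall fun Y => hψ.1 _)
    refine (abs_integral_sub_integral_le (hb _ hdc) (hb _ hFc)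
      ((hi1.add (integrable_const Q)).const_mul B) fun Y => ?_).trans ?_
    · exact (hψ.abs_sub_le _ _).trans (mul_le_mul_of_nonneg_left (hclose Y) hB)
    · rw [integral_const_mul]
      refine mul_le_mul_of_nonneg_left ?_ hB
      simp only [Pi.add_apply]
      rw [integral_add hi1 (integrable_const Q), integral_add (integrable_const _) (hi.const_mul _)]
      simp only [integral_const, probReal_univ, smul_eq_mul, one_mul]
      rw [integral_const_mul]
      have : (0 : ℝ) ≤ K * (1 + K) * (k * δ) := by positivity
      have := mul_le_mul_of_nonneg_left hle this
      linarith
  have hb1 : R * (p : ℝ) ^ (-α) ≤ R := by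
    refine mul_le_of_le_one_right hR.le (Real.rpow_le_one_of_one_le_of_nonpos ?_ (by linarith))
    exact_mod_cast hp
  have hb0 : 0 ≤ R * (p : ℝ) ^ (-α) := mul_nonneg hR.le (Real.rpow_nonneg (Nat.cast_nonneg _) _)
  have hsq : ∀ v : EuclideanSpace ℝ (Fin p), ‖v‖ ≤ R → ‖sqrtOp S v‖ ^ 2 ≤ K * R ^ 2 := fun v hv => by
    calc ‖sqrtOp S v‖ ^ 2 ≤ (Real.sqrt K * ‖v‖) ^ 2 := pow_le_pow_left₀ (norm_nonneg _) (hT0 v) 2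
      _ = K * ‖v‖ ^ 2 := by rw [mul_pow, Real.sq_sqrt K.coe_nonneg]
      _ ≤ _ := mul_le_mul_of_nonneg_left (pow_le_pow_left₀ (norm_nonneg _) hv 2) K.coe_nonneg
  have hswap := freeEnergy_swap (n := Fin n) (ι := Fin p) (κ := Fin k ⊕ Fin kstar)
    (M := Fin k → T) (N := N) (b := ((k + kstar : ℕ) : ℝ) * (R * (p : ℝ) ^ (-α)))
    (b₀ := ((k + kstar : ℕ) : ℝ) * R) (V := ((k + kstar : ℕ) : ℝ) * (K * R ^ 2)) hB hψ hN hμ hγ hvar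
    (by positivity) hWs (c := fun m => Real.exp (-(N * r fun a => m a))) (fun m => Real.exp_pos _)
    (a := fun m => loadings (sqrtOp S) (fun a => (m a : EuclideanSpace ℝ (Fin p))) Θstar)
    (by positivity) (mul_le_mul_of_nonneg_left hb1 (Nat.cast_nonneg _))
    (fun m j => by
      push_cast
      exact norm_loadings_le (fun a j => (hCsub (hT _ (m a).2)).1 j) (fun a j => (hΘstar a).1 j) j)
    (fun m => by
      push_cast
      exact sum_norm_loadings_sq_le (fun a => hsq _ (hCR _ (hT _ (m a).2)))
        (fun a => hsq _ (hΘstar a).2))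
  have hm := hpart μ hμ
  have hg := hpart γ hγ
  simp only [Fintype.card_sum, Fintype.card_fin] at hswap
  -- The number of rows cancels against `N = β n`.
  have hfin : ∀ x b : ℝ, (n : ℝ) * (x * b / N) = x * b / β := fun x b => by
    simp only [hNdef]; field_simp
  rw [hfin] at hswap
  push_cast at hswap ⊢
  unfold designErrorBound
  have a1 := abs_le.mp hm
  have a2 := abs_le.mp hg
  have a3 := abs_le.mp hswap
  simp only [← hG, ← hQ]
  rw [abs_le]
  constructor <;> linarith

end DesignError

/-! ### Smoothing bounded Lipschitz test functions -/

section Steklov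

/-- The average of `f` over `[x, x + h]`. -/
def steklov (h : ℝ) (f : ℝ → ℝ) (x : ℝ) : ℝ := h⁻¹ * ∫ t in x..(x + h), f t

variable {h : ℝ} {f : ℝ → ℝ}

theorem hasDerivAt_steklov (hf : Continuous f) (x : ℝ) :
    HasDerivAt (steklov h f) (h⁻¹ * (f (x + h) - f x)) x := by
  have hF : ∀ y, HasDerivAt (fun y => ∫ t in (0 : ℝ)..y, f t) (f y) y := fun y =>
    (hf.integral_hasStrictDerivAt 0 y).hasDerivAt
  have e : steklov h f = fun x => h⁻¹ * ((∫ t in (0 : ℝ)..(x + h), f t) - ∫ t in (0 : ℝ)..x, f t) := by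
    ext x
    rw [steklov, intervalIntegral.integral_interval_sub_left] <;>
      exact hf.intervalIntegrable _ _
  rw [e]
  exact (((hF (x + h)).comp_add_const x h).sub (hF x)).const_mul h⁻¹

theorem continuous_steklov (hf : Continuous f) : Continuous (steklov h f) :=
  continuous_iff_continuousAt.mpr fun x => (hasDerivAt_steklov hf x).continuousAt

theorem abs_steklov_sub_le (hh : 0 < h) (hf : Continuous f) {x c M : ℝ}
    (hb : ∀ t, x ≤ t → t ≤ x + h → |f t - c| ≤ M) : |steklov h f x - c| ≤ M := by
  have e : steklov h f x - c = h⁻¹ * ∫ t in x..(x + h), (f t - c) := by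
    rw [intervalIntegral.integral_sub (hf.intervalIntegrable _ _) intervalIntegrable_const, steklov,
      intervalIntegral.integral_const, smul_eq_mul]
    field_simp
    ring
  have h1 := intervalIntegral.norm_integral_le_of_norm_le_const (a := x) (b := x + h) (C := M)
    (f := fun t => f t - c) fun t ht => by
      rw [Set.uIoc_of_le (by linarith)] at ht
      exact hb t ht.1.le ht.2
  rw [e, abs_mul, abs_of_pos (by positivity), inv_mul_le_iff₀ hh, mul_comm]
  simpa [abs_of_pos hh] using h1

theorem abs_steklov_le (hh : 0 < h) (hf : Continuous f) {M : ℝ} (hb : ∀ t, |f t| ≤ M) (x : ℝ) :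
    |steklov h f x| ≤ M := by
  simpa using abs_steklov_sub_le (c := 0) hh hf (x := x) fun t _ _ => by simpa using hb t

theorem abs_steklov_sub_steklov_le (hh : 0 < h) {g : ℝ → ℝ} (hf : Continuous f) (hg : Continuous g)
    {M : ℝ} (hb : ∀ t, |f t - g t| ≤ M) (x : ℝ) : |steklov h f x - steklov h g x| ≤ M := by
  have e : steklov h f x - steklov h g x = steklov h (fun t => f t - g t) x := by
    simp only [steklov]
    rw [intervalIntegral.integral_sub (hf.intervalIntegrable _ _) (hg.intervalIntegrable _ _),
      mul_sub]
  rw [e]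
  exact abs_steklov_le hh (hf.sub hg) hb x

/-- Three successive averages give three derivatives, since the derivative of an average is a
difference quotient. The first average moves `ψ` by at most `ε / 3`; averaging contracts the sup
norm, so the other two move no further. -/
theorem exists_smoothBounded_approx {ψ : ℝ → ℝ} {M : ℝ} (hM : ∀ x, |ψ x| ≤ M) {L : ℝ≥0}
    (hL : LipschitzWith L ψ) {ε : ℝ} (hε : 0 < ε) :
    ∃ B φ, 0 ≤ B ∧ SmoothBounded B φ ∧ ∀ x, |φ x - ψ x| ≤ ε := by
  -- This gives `L * h ≤ ε / 3`; the `+ 1` avoids division by zero when `L = 0`.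
  set h := ε / (3 * (L + 1)) with hh
  have hh0 : 0 < h := by positivity
  have hM0 : 0 ≤ M := (abs_nonneg _).trans (hM 0)
  set f1 := steklov h ψ
  set f2 := steklov h f1
  have c0 := hL.continuous
  have c1 : Continuous f1 := continuous_steklov c0
  have c2 : Continuous f2 := continuous_steklov c1
  have b1 : ∀ x, |f1 x| ≤ M := abs_steklov_le hh0 c0 hM
  have b2 : ∀ x, |f2 x| ≤ M := abs_steklov_le hh0 c1 b1
  have b3 : ∀ x, |steklov h f2 x| ≤ M := abs_steklov_le hh0 c2 b2
  have hi : 0 < h⁻¹ := by positivity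
  have diff : ∀ (g g' : ℝ → ℝ), (∀ x, HasDerivAt g (g' x) x) →
      ∀ x, HasDerivAt (fun x => h⁻¹ * (g (x + h) - g x)) (h⁻¹ * (g' (x + h) - g' x)) x :=
    fun g g' hg x => (((hg (x + h)).comp_add_const x h).sub (hg x)).const_mul _
  have bd : ∀ (g : ℝ → ℝ) (A : ℝ), (∀ x, |g x| ≤ A) → ∀ x, |h⁻¹ * (g (x + h) - g x)| ≤ h⁻¹ * (2 * A) := by
    intro g A hg x
    rw [abs_mul, abs_of_pos hi]
    refine mul_le_mul_of_nonneg_left ((abs_sub _ _).trans ?_) hi.le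
    linarith [hg (x + h), hg x]
  have close1 : ∀ x, |f1 x - ψ x| ≤ ε / 3 := fun x =>
    abs_steklov_sub_le hh0 c0 fun t ht1 ht2 => by
      have := hL.dist_le_mul t x
      rw [Real.dist_eq, Real.dist_eq, abs_of_nonneg (by linarith : 0 ≤ t - x)] at this
      refine this.trans ((mul_le_mul_of_nonneg_left (by linarith : t - x ≤ h) L.coe_nonneg).trans ?_)
      rw [hh, mul_div_assoc', div_le_div_iff₀ (by positivity) (by norm_num)]
      nlinarith
  have close2 : ∀ x, |f2 x - f1 x| ≤ ε / 3 := abs_steklov_sub_steklov_le hh0 c1 c0 close1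
  have close3 : ∀ x, |steklov h f2 x - f2 x| ≤ ε / 3 := abs_steklov_sub_steklov_le hh0 c2 c1 close2
  have d1 : ∀ x, HasDerivAt (steklov h f2) (h⁻¹ * (f2 (x + h) - f2 x)) x := hasDerivAt_steklov c2
  have d2 := diff f2 _ (hasDerivAt_steklov c1)
  have d3 := diff _ _ (diff f1 _ (hasDerivAt_steklov c0))
  have B1 := bd f2 M b2
  have B2 := bd _ _ (bd f1 M b1)
  have B3 := bd _ _ (bd _ _ (bd ψ M hM))
  have p1 : 0 ≤ h⁻¹ * (2 * M) := by positivity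
  have p2 : 0 ≤ h⁻¹ * (2 * (h⁻¹ * (2 * M))) := by positivity
  have p3 : 0 ≤ h⁻¹ * (2 * (h⁻¹ * (2 * (h⁻¹ * (2 * M))))) := by positivity
  refine ⟨M + h⁻¹ * (2 * M) + h⁻¹ * (2 * (h⁻¹ * (2 * M))) +
    h⁻¹ * (2 * (h⁻¹ * (2 * (h⁻¹ * (2 * M))))), steklov h f2, by positivity,
    ⟨fun x => by linarith [b3 x], _, _, _, d1, d2, d3, fun x => ⟨?_, ?_, ?_⟩⟩, fun x => ?_⟩
  · exact (B1 x).trans (by linarith)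
  · exact (B2 x).trans (by linarith)
  · exact (B3 x).trans (by linarith)
  · have a1 := abs_le.mp (close1 x)
    have a2 := abs_le.mp (close2 x)
    have a3 := abs_le.mp (close3 x)
    rw [abs_le]
    constructor <;> linarith

end Steklov

/-! ### Moment bounds common to subgaussian and Gaussian entries -/

section Subgaussian

/-- The bound for the exponential moments of a subgaussian law with `ψ₂`-norm at most `K`. -/
def subgaussianMoment (K Λ : ℝ) : ℝ := 2 * Real.exp (4 * K ^ 2 * Λ ^ 2)

/-- The scale `2K` strictly exceeds the infimum defining the norm, so some admissible `t < 2K`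
exists and there is no need to know that the infimum is attained. -/
theorem subgaussian_integrable {Ω : Type*} [MeasurableSpace Ω] {P : Measure Ω} {X : Ω → ℝ}
    {μ : Measure ℝ} (hX : HasLaw X μ P) {K : ℝ≥0} (hK : 0 < K) (hsub : psi2Norm X P ≤ K) :
    Integrable (fun x => Real.exp (x ^ 2 / (2 * K) ^ 2)) μ ∧
      ∫ x, Real.exp (x ^ 2 / (2 * K : ℝ) ^ 2) ∂μ ≤ 2 := by
  have hK' : (0 : ℝ) < K := hK
  have hlt : psi2Norm X P < ENNReal.ofReal (2 * K) := by
    refine hsub.trans_lt ?_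
    rw [← ENNReal.ofReal_coe_nnreal, ENNReal.ofReal_lt_ofReal_iff (by positivity)]
    linarith
  rw [psi2Norm, iInf_lt_iff] at hlt
  obtain ⟨t, ht⟩ := hlt
  rw [iInf_lt_iff] at ht
  obtain ⟨⟨ht0, hle⟩, ht2⟩ := ht
  rw [ENNReal.ofReal_lt_ofReal_iff (by positivity)] at ht2
  have hm : ∀ s : ℝ, Measurable fun x : ℝ => Real.exp (x ^ 2 / s ^ 2) := fun s => by fun_prop
  have hl : ∫⁻ x, ENNReal.ofReal (Real.exp (x ^ 2 / (2 * K : ℝ) ^ 2)) ∂μ ≤ 2 := by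
    refine le_trans (lintegral_mono fun x => ?_)
      ((hX.lintegral_comp (hm t).ennreal_ofReal.aemeasurable).symm.le.trans hle)
    refine ENNReal.ofReal_le_ofReal (Real.exp_le_exp.mpr ?_)
    exact div_le_div_of_nonneg_left (sq_nonneg x) (by positivity)
      (pow_le_pow_left₀ ht0.le ht2.le 2)
  have hi : Integrable (fun x => Real.exp (x ^ 2 / (2 * K) ^ 2)) μ := by
    refine ⟨(hm _).aestronglyMeasurable, ?_⟩
    rw [hasFiniteIntegral_iff_ofReal (Eventually.of_forall fun x => (Real.exp_pos _).le)]
    exact hl.trans_lt (by simp)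
  refine ⟨hi, ?_⟩
  rw [integral_eq_lintegral_of_nonneg_ae (Eventually.of_forall fun x => (Real.exp_pos _).le)
    (hm _).aestronglyMeasurable]
  exact ENNReal.toReal_le_of_le_ofReal (by norm_num) (by simpa using hl)

/-- Completing the square, `Λ |x| ≤ K² Λ² + x² / (2K)²`. The second moment bound is `(2K)² · 2`,
from `s ≤ exp s`. -/
theorem expBounded_of_psi2Norm_le {Ω : Type*} [MeasurableSpace Ω] {P : Measure Ω}
    [IsProbabilityMeasure P] {X : Ω → ℝ} {μ : Measure ℝ} (hX : HasLaw X μ P) {K : ℝ≥0} (hK : 0 < K)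
    (hsub : psi2Norm X P ≤ K) (hmean : ∫ ω, X ω ∂P = 0) :
    ExpBounded (subgaussianMoment K) μ ∧ ∫ x, x ^ 2 ∂μ ≤ 8 * K ^ 2 := by
  have hK' : (0 : ℝ) < K := hK
  obtain ⟨hi, hle⟩ := subgaussian_integrable hX hK hsub
  have hp : IsProbabilityMeasure μ := hX.isProbabilityMeasure_iff.mp inferInstance
  have hb : ∀ Λ x : ℝ, Real.exp (Λ * |x|) ≤
      Real.exp (K ^ 2 * Λ ^ 2) * Real.exp (x ^ 2 / (2 * K) ^ 2) := fun Λ x => by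
    rw [← Real.exp_add, Real.exp_le_exp]
    have h1 : x ^ 2 / (2 * K) ^ 2 = (|x| / (2 * K)) ^ 2 := by rw [div_pow, sq_abs]
    have h2 : Λ * |x| = 2 * (K * Λ) * (|x| / (2 * K)) := by field_simp
    rw [h1, h2]
    nlinarith [sq_nonneg (K * Λ - |x| / (2 * K))]
  have hint : ∀ Λ : ℝ, Integrable (fun x => Real.exp (Λ * |x|)) μ := fun Λ =>
    (hi.const_mul (Real.exp (K ^ 2 * Λ ^ 2))).mono'
      (by fun_prop : Continuous fun x : ℝ => Real.exp (Λ * |x|)).aestronglyMeasurable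
      (Eventually.of_forall fun x => by
        rw [Real.norm_eq_abs, abs_of_pos (Real.exp_pos _)]; exact hb Λ x)
  have hE : ExpBounded (subgaussianMoment K) μ := by
    refine ⟨hp, fun Λ _ => hint Λ, fun Λ _ => ?_, ?_⟩
    · refine (integral_mono (hint Λ) (hi.const_mul _) (hb Λ)).trans ?_
      rw [integral_const_mul, subgaussianMoment, mul_comm 2 (Real.exp _)]
      refine mul_le_mul (Real.exp_le_exp.mpr ?_) hle
        (integral_nonneg fun _ => (Real.exp_pos _).le) (Real.exp_pos _).le
      nlinarith [sq_nonneg ((K : ℝ) * Λ)]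
    · have := hX.integral_comp (f := fun x => x) aestronglyMeasurable_id
      rw [← this]
      exact hmean
  refine ⟨hE, ?_⟩
  calc ∫ x, x ^ 2 ∂μ ≤ ∫ x, (2 * K : ℝ) ^ 2 * Real.exp (x ^ 2 / (2 * K) ^ 2) ∂μ := by
        refine integral_mono hE.integrable_sq (hi.const_mul _) fun x => ?_
        simp only
        rw [← div_le_iff₀' (by positivity)]
        linarith [Real.add_one_le_exp (x ^ 2 / (2 * K : ℝ) ^ 2)]
    _ ≤ (2 * K) ^ 2 * 2 := by
        rw [integral_const_mul]
        exact mul_le_mul_of_nonneg_left hle (by positivity)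
    _ = _ := by ring

/-- With variance at most `8 K²` the Gaussian exponent `v Λ² / 2` is at most `4 K² Λ²`. This fixes
the constant in `subgaussianMoment`, which then serves both laws. -/
theorem expBounded_gaussianReal {v : ℝ≥0} {K : ℝ} (hv : (v : ℝ) ≤ 8 * K ^ 2) :
    ExpBounded (subgaussianMoment K) (gaussianReal 0 v) ∧ ∫ x, x ^ 2 ∂(gaussianReal 0 v) = v := by
  have hexp : ∀ t : ℝ, ∫ x, Real.exp (t * x) ∂(gaussianReal 0 v) = Real.exp (v * t ^ 2 / 2) := by
    intro t
    have := mgf_gaussianReal (p := gaussianReal 0 v) (X := id) (μ := 0) (v := v) (by simp) t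
    simpa [mgf] using this
  have hi : ∀ t : ℝ, Integrable (fun x => Real.exp (t * x)) (gaussianReal 0 v) :=
    integrable_exp_mul_gaussianReal
  have hb : ∀ Λ x : ℝ, 0 ≤ Λ → Real.exp (Λ * |x|) ≤ Real.exp (Λ * x) + Real.exp (-Λ * x) := by
    intro Λ x hΛ
    have := Real.exp_abs_le (Λ * x)
    rwa [abs_mul, abs_of_nonneg hΛ, ← neg_mul] at this
  have hint : ∀ Λ : ℝ, 0 ≤ Λ → Integrable (fun x => Real.exp (Λ * |x|)) (gaussianReal 0 v) :=
    fun Λ hΛ => ((hi Λ).add (hi (-Λ))).mono'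
      (by fun_prop : Continuous fun x : ℝ => Real.exp (Λ * |x|)).aestronglyMeasurable
      (Eventually.of_forall fun x => by
        rw [Real.norm_eq_abs, abs_of_pos (Real.exp_pos _)]; exact hb Λ x hΛ)
  refine ⟨⟨inferInstance, hint, fun Λ hΛ => ?_, ?_⟩, ?_⟩
  · refine (integral_mono (hint Λ hΛ) ((hi Λ).add (hi (-Λ))) fun x => hb Λ x hΛ).trans ?_
    simp only [Pi.add_apply]
    rw [integral_add (hi Λ) (hi (-Λ)), hexp, hexp, neg_sq, ← two_mul, subgaussianMoment]
    refine mul_le_mul_of_nonneg_left (Real.exp_le_exp.mpr ?_) zero_le_two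
    nlinarith [mul_le_mul_of_nonneg_right hv (sq_nonneg Λ)]
  · exact integral_id_gaussianReal
  · have h1 := variance_id_gaussianReal (μ := 0) (v := v)
    rw [variance_eq_integral aemeasurable_id] at h1
    simpa using h1

end Subgaussian

/-! ### Joint laws of the two designs -/

section GaussianDesign

variable {n p : ℕ}

/-- By uniqueness of the positive square root, `√(v S) = √v √S`, and the scalar is absorbed in the
variance of the coordinates. -/
theorem map_sqrtOp_pi_gaussianReal {S : Matrix (Fin p) (Fin p) ℝ} (hS : S.PosSemidef) {v : ℝ≥0} :
    (Measure.pi fun _ : Fin p => gaussianReal 0 v).map (fun y => sqrtOp S (WithLp.toLp 2 y)) =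
      multivariateGaussian 0 ((v : ℝ) • S) := by
  have hsq : CFC.sqrt ((v : ℝ) • S) = Real.sqrt v • CFC.sqrt S := by
    have hS0 : 0 ≤ S := Matrix.nonneg_iff_posSemidef.mpr hS
    refine CFC.sqrt_unique ?_ (smul_nonneg (Real.sqrt_nonneg _) (CFC.sqrt_nonneg S))
    rw [smul_mul_smul_comm, CFC.sqrt_mul_sqrt_self S hS0, Real.mul_self_sqrt v.coe_nonneg]
  have hg : (fun y : ℝ => Real.sqrt v * y) = (Real.sqrt v * ·) := rfl
  have hpi : (Measure.pi fun _ : Fin p => gaussianReal 0 v) =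
      (Measure.pi fun _ : Fin p => gaussianReal 0 1).map (fun y j => Real.sqrt v * y j) := by
    have h1 : (gaussianReal 0 1).map (Real.sqrt v * ·) = gaussianReal 0 v := by
      rw [gaussianReal_map_const_mul, mul_zero]
      congr 1
      ext
      simp
    have := Measure.pi_map_pi (μ := fun _ : Fin p => gaussianReal 0 1)
      (f := fun _ x => Real.sqrt v * x) (hμ := fun i => by rw [h1]; infer_instance)
      fun _ => by fun_prop
    rw [this]
    simp only [h1]
  rw [multivariateGaussian, ← map_pi_eq_stdGaussian, hpi, Measure.map_map (by fun_prop) (by fun_prop),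
    Measure.map_map (by fun_prop) (by fun_prop)]
  congr 1
  ext1 y
  simp only [Function.comp_apply, zero_add, hsq, map_smul]
  have : WithLp.toLp 2 (fun j => Real.sqrt v * y j) = Real.sqrt v • WithLp.toLp 2 y := rfl
  rw [this, map_smul]
  rfl

theorem hasLaw_pi_pi {Ω : Type*} [MeasurableSpace Ω] {P : Measure Ω} {μ : Measure ℝ}
    [IsProbabilityMeasure μ] {X : Fin n → Fin p → Ω → ℝ} (hlaw : ∀ i j, HasLaw (X i j) μ P)
    (hind : iIndepFun (fun (ij : Fin n × Fin p) ω => X ij.1 ij.2 ω) P) :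
    HasLaw (fun ω i j => X i j ω) (Measure.pi fun _ : Fin n => Measure.pi fun _ : Fin p => μ) P := by
  have h1 := hind.hasLaw_pi (fun ij : Fin n × Fin p => hlaw ij.1 ij.2)
  have h2 := Measure.infinitePi_map_curry (fun (_ : Fin n) (_ : Fin p) => μ)
  simp only [Measure.infinitePi_eq_pi] at h2
  have h3 : HasLaw (MeasurableEquiv.curry (Fin n) (Fin p) ℝ) (Measure.pi fun _ : Fin n =>
      Measure.pi fun _ : Fin p => μ) (Measure.pi fun _ : Fin n × Fin p => μ) :=
    ⟨(MeasurableEquiv.curry (Fin n) (Fin p) ℝ).measurable.aemeasurable, h2⟩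
  exact h3.comp h1

/-- The `g i` need not be given as images of white vectors, but their joint law is such an image;
this suffices to compare expectations. -/
theorem hasLaw_pi_multivariateGaussian {Ω : Type*} [MeasurableSpace Ω] {P : Measure Ω}
    {S : Matrix (Fin p) (Fin p) ℝ} (hS : S.PosSemidef) {v : ℝ≥0}
    {g : Fin n → Ω → EuclideanSpace ℝ (Fin p)}
    (hlaw : ∀ i, HasLaw (g i) (multivariateGaussian 0 ((v : ℝ) • S)) P) (hind : iIndepFun g P) :
    HasLaw (fun ω i => g i ω) ((Measure.pi fun _ : Fin n => Measure.pi fun _ : Fin p =>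
      gaussianReal 0 v).map fun Y i => sqrtOp S (WithLp.toLp 2 (Y i))) P := by
  have h1 := hind.hasLaw_pi hlaw
  have h2 := Measure.pi_map_pi (μ := fun _ : Fin n => Measure.pi fun _ : Fin p => gaussianReal 0 v)
      (f := fun _ y => sqrtOp S (WithLp.toLp 2 y))
      (hμ := fun i => by rw [map_sqrtOp_pi_gaussianReal hS]; infer_instance)
      fun _ => by fun_prop
  simp only [map_sqrtOp_pi_gaussianReal hS] at h2
  rwa [h2]

theorem integral_comp_indepFun {Ω Y Z : Type*} [MeasurableSpace Ω] [MeasurableSpace Y]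
    [MeasurableSpace Z] {P : Measure Ω} [IsProbabilityMeasure P] {U : Ω → Y} {V : Ω → Z}
    {μ : Measure Y} {ρ : Measure Z} [IsProbabilityMeasure μ] [IsProbabilityMeasure ρ]
    (hU : HasLaw U μ P) (hV : HasLaw V ρ P) (hind : IndepFun U V P) {f : Y × Z → ℝ}
    (hf : Measurable f) {B : ℝ} (hB : ∀ q, |f q| ≤ B) :
    ∫ ω, f (U ω, V ω) ∂P = ∫ z, ∫ y, f (y, z) ∂μ ∂ρ := by
  have h := hind.hasLaw_prod hU hV
  have h1 := h.integral_comp (f := f) hf.aestronglyMeasurable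
  simp only [Function.comp_def] at h1
  rw [h1, integral_prod_symm]
  exact Integrable.of_bound hf.aestronglyMeasurable B (Eventually.of_forall hB)

end GaussianDesign

/-! ### From test functions to probabilities -/

section Comparison

/-- The piecewise linear function which vanishes up to `ρ` and equals one from `ρ + δ` on. -/
def ramp (ρ δ t : ℝ) : ℝ := max 0 (min 1 ((t - ρ) / δ))

theorem ramp_nonneg (ρ δ t : ℝ) : 0 ≤ ramp ρ δ t := le_max_left _ _

theorem ramp_le_one (ρ δ t : ℝ) : ramp ρ δ t ≤ 1 := max_le zero_le_one (min_le_left _ _)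

theorem abs_ramp_le (ρ δ t : ℝ) : |ramp ρ δ t| ≤ 1 := by
  rw [abs_of_nonneg (ramp_nonneg ρ δ t)]; exact ramp_le_one ρ δ t

theorem lipschitzWith_ramp (ρ : ℝ) {δ : ℝ} (hδ : 0 < δ) :
    LipschitzWith (Real.toNNReal δ⁻¹) (ramp ρ δ) := by
  have h : LipschitzWith (Real.toNNReal δ⁻¹) fun t => (t - ρ) / δ := by
    refine LipschitzWith.of_dist_le_mul fun s t => le_of_eq ?_
    rw [Real.coe_toNNReal _ (by positivity), Real.dist_eq, Real.dist_eq, ← sub_div, abs_div,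
      abs_of_pos hδ, sub_sub_sub_cancel_right, div_eq_inv_mul]
  exact (h.const_min 1).const_max 0

variable {Ω : ℕ → Type*} [∀ n, MeasurableSpace (Ω n)] {P : ∀ n, Measure (Ω n)}
  {U V : ∀ n, Ω n → ℝ}

/-- Asymptotic agreement of the expectations of bounded Lipschitz functions. -/
def AsympEqual (P : ∀ n, Measure (Ω n)) (U V : ∀ n, Ω n → ℝ) : Prop :=
  ∀ ψ : ℝ → ℝ, (∃ M : ℝ, ∀ t, |ψ t| ≤ M) → (∃ L : ℝ≥0, LipschitzWith L ψ) →
    Tendsto (fun n => |(∫ ω, ψ (U n ω) ∂(P n)) - ∫ ω, ψ (V n ω) ∂(P n)|) atTop (𝓝 0)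

theorem AsympEqual.symm (h : AsympEqual P U V) : AsympEqual P V U := fun ψ h1 h2 => by
  simpa only [abs_sub_comm] using h ψ h1 h2

theorem AsympEqual.neg (h : AsympEqual P U V) :
    AsympEqual P (fun n ω => -U n ω) (fun n ω => -V n ω) := by
  rintro ψ ⟨M, hM⟩ ⟨L, hL⟩
  refine h (fun t => ψ (-t)) ⟨M, fun t => hM _⟩ ⟨L, LipschitzWith.of_dist_le_mul fun s t => ?_⟩
  simpa using hL.dist_le_mul (-s) (-t)

variable [∀ n, IsProbabilityMeasure (P n)]

/-- The ramp lies between the indicators of `[ρ + δ, ∞)` and `[ρ, ∞)`. The margin `δ` is what allows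
a Lipschitz function in between. -/
theorem AsympEqual.eventually_ge_le (h : AsympEqual P U V) (hU : ∀ n, AEMeasurable (U n) (P n))
    (hV : ∀ n, AEMeasurable (V n) (P n)) (ρ : ℝ) {δ τ : ℝ} (hδ : 0 < δ) (hτ : 0 < τ) :
    ∀ᶠ n in atTop, (P n).real {ω | ρ + δ ≤ U n ω} ≤ (P n).real {ω | ρ ≤ V n ω} + τ := by
  have hlim := h (ramp ρ δ) ⟨1, abs_ramp_le ρ δ⟩ ⟨_, lipschitzWith_ramp ρ hδ⟩
  filter_upwards [hlim.eventually (gt_mem_nhds hτ)] with n hn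
  have hm := (lipschitzWith_ramp ρ hδ).continuous.measurable
  have hi : ∀ X : Ω n → ℝ, AEMeasurable X (P n) → Integrable (fun ω => ramp ρ δ (X ω)) (P n) :=
    fun X hX => Integrable.of_bound (hm.comp_aemeasurable hX).aestronglyMeasurable 1
      (Eventually.of_forall fun ω => abs_ramp_le ρ δ _)
  have h1 : (P n).real {ω | ρ + δ ≤ U n ω} ≤ ∫ ω, ramp ρ δ (U n ω) ∂(P n) := by
    have := mul_meas_ge_le_integral_of_nonneg (μ := P n) (f := fun ω => ramp ρ δ (U n ω))
      (Eventually.of_forall fun ω => ramp_nonneg _ _ _) (hi _ (hU n)) 1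
    rw [one_mul] at this
    refine (measureReal_mono fun ω (hω : ρ + δ ≤ U n ω) => ?_).trans this
    change (1 : ℝ) ≤ max 0 (min 1 ((U n ω - ρ) / δ))
    refine le_max_of_le_right (le_min le_rfl ?_)
    rw [le_div_iff₀ hδ]
    linarith
  -- Markov's inequality for `1 - ramp`, followed by passing to complements.
  have h2 : (P n).real {ω | V n ω < ρ} ≤ 1 - ∫ ω, ramp ρ δ (V n ω) ∂(P n) := by
    have := mul_meas_ge_le_integral_of_nonneg (μ := P n) (f := fun ω => 1 - ramp ρ δ (V n ω))
      (Eventually.of_forall fun ω => sub_nonneg.mpr (ramp_le_one _ _ _))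
      ((integrable_const 1).sub (hi _ (hV n))) 1
    rw [one_mul, integral_sub (integrable_const 1) (hi _ (hV n))] at this
    simp only [integral_const, probReal_univ, smul_eq_mul, mul_one] at this
    refine (measureReal_mono fun ω (hω : V n ω < ρ) => ?_).trans this
    have h0 : ramp ρ δ (V n ω) = 0 := max_eq_left ((min_le_right _ _).trans
      (div_nonpos_of_nonpos_of_nonneg (by linarith) hδ.le))
    simp [h0]
  have h3 : 1 ≤ (P n).real {ω | V n ω < ρ} + (P n).real {ω | ρ ≤ V n ω} := by
    have e : {ω | V n ω < ρ} ∪ {ω | ρ ≤ V n ω} = Set.univ := by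
      ext ω; simpa using lt_or_ge (V n ω) ρ
    have := measureReal_union_le (μ := P n) {ω | V n ω < ρ} {ω | ρ ≤ V n ω}
    rwa [e, probReal_univ] at this
  linarith [(abs_lt.mp hn).2]

theorem AsympEqual.eventually_le_le (h : AsympEqual P U V) (hU : ∀ n, AEMeasurable (U n) (P n))
    (hV : ∀ n, AEMeasurable (V n) (P n)) (ρ : ℝ) {δ τ : ℝ} (hδ : 0 < δ) (hτ : 0 < τ) :
    ∀ᶠ n in atTop, (P n).real {ω | U n ω ≤ ρ - δ} ≤ (P n).real {ω | V n ω ≤ ρ} + τ := by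
  filter_upwards [h.neg.eventually_ge_le (fun n => (hU n).neg) (fun n => (hV n).neg) (-ρ) hδ hτ]
    with n hn
  convert hn using 4
  · constructor <;> intro <;> linarith
  · simp

theorem AsympEqual.tendstoInProb (h : AsympEqual P U V) (hU : ∀ n, AEMeasurable (U n) (P n))
    (hV : ∀ n, AEMeasurable (V n) (P n)) {ρ : ℝ} (hVρ : TendstoInProb P V ρ) :
    TendstoInProb P U ρ := by
  intro δ hδ
  rw [Metric.tendsto_atTop']
  intro ε hε
  -- Each of the two tails of `U` costs `ε / 5` for the comparison and less than `ε / 5` for the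
  -- tail of `V`, in total less than `4 ε / 5`.
  have e1 := h.eventually_ge_le hU hV (ρ + δ / 2) (half_pos hδ) (by positivity : 0 < ε / 5)
  have e2 := h.eventually_le_le hU hV (ρ - δ / 2) (half_pos hδ) (by positivity : 0 < ε / 5)
  have e3 := (hVρ (δ / 2) (half_pos hδ)).eventually (gt_mem_nhds (by positivity : 0 < ε / 5))
  obtain ⟨N, hN⟩ := eventually_atTop.mp (e1.and (e2.and e3))
  refine ⟨N, fun n hn => ?_⟩
  obtain ⟨a1, a2, a3⟩ := hN n hn.le
  rw [Real.dist_eq, sub_zero, abs_of_nonneg measureReal_nonneg]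
  have s1 : (P n).real {ω | δ ≤ |U n ω - ρ|} ≤ (P n).real {ω | ρ + δ / 2 + δ / 2 ≤ U n ω} +
      (P n).real {ω | U n ω ≤ ρ - δ / 2 - δ / 2} := by
    refine (measureReal_mono fun ω (hω : δ ≤ |U n ω - ρ|) => ?_).trans (measureReal_union_le _ _)
    rcases le_abs'.mp hω with h | h
    · right; change U n ω ≤ ρ - δ / 2 - δ / 2; linarith
    · left; change ρ + δ / 2 + δ / 2 ≤ U n ω; linarith
  have s2 : (P n).real {ω | ρ + δ / 2 ≤ V n ω} ≤ (P n).real {ω | δ / 2 ≤ |V n ω - ρ|} :=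
    measureReal_mono fun ω (hω : ρ + δ / 2 ≤ V n ω) =>
      (by linarith : δ / 2 ≤ V n ω - ρ).trans (le_abs_self _)
  have s3 : (P n).real {ω | V n ω ≤ ρ - δ / 2} ≤ (P n).real {ω | δ / 2 ≤ |V n ω - ρ|} :=
    measureReal_mono fun ω (hω : V n ω ≤ ρ - δ / 2) =>
      (by linarith : δ / 2 ≤ -(V n ω - ρ)).trans (neg_le_abs _)
  linarith

end Comparison

/-! ### Choice of parameters and conclusion -/

/-- In the limit `b = 0`, `g = γ` the exchange term vanishes and `c1 * δ + c2 / β` remains. As `c2`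
contains the entropy `log (1 + 2R/δ)`, the net scale `δ` is fixed before the temperature. The growth
of the exchange constant with `β` is harmless because `n → ∞` comes last. -/
theorem exists_designErrorBound_lt {A : ℝ → ℝ} {q B K R κ Cq γ τ : ℝ} {k : ℕ}
    (hτ : 0 < τ) {b g : ℕ → ℝ} (hb : Tendsto b atTop (𝓝 0)) (hg : Tendsto g atTop (𝓝 γ)) :
    ∃ (β : ℝ≥0) (δ : ℝ), 0 < β ∧ 0 < δ ∧
      ∀ᶠ n in atTop, designErrorBound A q B K R κ Cq k β δ (b n) (g n) < τ := by
  set c1 := 2 * (B * (κ * k + K * (1 + K) * k *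
    (2 * (γ * Real.log 5 + (Real.log 2 + Real.sqrt K ^ 2 * (2 * A (Real.sqrt K + 1))) + 1)))) with hc1
  have h1 : Tendsto (fun δ : ℝ => c1 * δ) (𝓝[>] 0) (𝓝 0) := by
    have : Tendsto (fun δ : ℝ => c1 * δ) (𝓝 0) (𝓝 (c1 * 0)) := tendsto_id.const_mul c1
    rw [mul_zero] at this
    exact this.mono_left nhdsWithin_le_nhds
  obtain ⟨δ, hδ1, hδ⟩ := ((h1.eventually (gt_mem_nhds (half_pos hτ))).and
    self_mem_nhdsWithin).exists
  set c2 := 2 * (B * (Cq + k * (γ * Real.log (1 + 2 * R / δ)))) with hc2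
  have h2 : Tendsto (fun β : ℝ≥0 => c2 / (β : ℝ)) atTop (𝓝 0) :=
    (NNReal.tendsto_coe_atTop.mpr tendsto_id).const_div_atTop c2
  obtain ⟨β, hβ1, hβ⟩ := ((h2.eventually (gt_mem_nhds (half_pos hτ))).and
    (eventually_gt_atTop 0)).exists
  refine ⟨β, δ, hβ, hδ, ?_⟩
  have hβ' : (β : ℝ) ≠ 0 := by exact_mod_cast hβ.ne'
  have h3 : Tendsto (fun n => designErrorBound A q B K R κ Cq k β δ (b n) (g n)) atTop
      (𝓝 (designErrorBound A q B K R κ Cq k β δ 0 γ)) := by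
    have hc : Continuous fun z : ℝ × ℝ => designErrorBound A q B K R κ Cq k β δ z.1 z.2 := by
      unfold designErrorBound; fun_prop (disch := exact hβ')
    exact (hc.tendsto (0, γ)).comp (hb.prodMk_nhds hg)
  have h4 : designErrorBound A q B K R κ Cq k β δ 0 γ = c1 * δ + c2 / β := by
    rw [designErrorBound, hc1, hc2]
    field_simp
    ring
  exact h3.eventually (gt_mem_nhds (by rw [h4]; linarith))

theorem integrable_integral_of_abs_le {α β : Type*} [MeasurableSpace α] [MeasurableSpace β]
    {μ : Measure α} {ν : Measure β} [IsProbabilityMeasure μ] [IsProbabilityMeasure ν]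
    {f : α × β → ℝ} (hf : Measurable f) {B : ℝ} (hB : ∀ z, |f z| ≤ B) :
    Integrable (fun y => ∫ x, f (x, y) ∂μ) ν := by
  refine Integrable.of_bound (C := B)
    hf.stronglyMeasurable.integral_prod_left'.aestronglyMeasurable (Eventually.of_forall fun y => ?_)
  simpa using norm_integral_le_of_norm_le_const (μ := μ) (f := fun x => f (x, y))
    (Eventually.of_forall fun x => hB (x, y))

/-- Comparison of the two models for a fixed sample size. -/
theorem abs_integral_trainingError_sub_le {n p k kstar : ℕ} (hn : 0 < n) (hp : 0 < p)
    {ℓ : EuclideanSpace ℝ (Fin (k + 1)) → ℝ}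
    {η : EuclideanSpace ℝ (Fin (kstar + 1)) → ℝ}
    {r : (Fin k → EuclideanSpace ℝ (Fin p)) → ℝ} {S : Matrix (Fin p) (Fin p) ℝ}
    {Θstar : Fin kstar → EuclideanSpace ℝ (Fin p)} {C : Set (EuclideanSpace ℝ (Fin p))}
    {K : ℝ≥0} {R α κ : ℝ}
    (hK : 0 < K) (hR : 0 < R) (hα : 0 < α) (hκ : 0 ≤ κ)
    (hℓ0 : ∀ u, 0 ≤ ℓ u) (hℓ : LipschitzWith K ℓ) (hη : LipschitzWith K η)
    (hr : ∀ Θ₀ Θ₁ : Fin k → EuclideanSpace ℝ (Fin p), (∀ a, ‖Θ₀ a‖ ≤ R) → (∀ a, ‖Θ₁ a‖ ≤ R) →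
      |r Θ₀ - r Θ₁| ≤ κ * frobNorm (fun a => Θ₀ a - Θ₁ a))
    (hS : S.PosSemidef) (hSop : matrixOpNorm S ≤ K)
    (hΘstar : ∀ a, Θstar a ∈ delocalizedSet S R α) (hC : C.Nonempty)
    (hCsub : C ⊆ delocalizedSet S R α) {Cq : ℝ}
    (hCq : ∀ (Λ : ℝ≥0) (L : EuclideanSpace ℝ (Fin k ⊕ Fin kstar) → ℝ), 0 < Λ → LipschitzWith Λ L →
      ∃ W : EuclideanSpace ℝ (Fin k ⊕ Fin kstar) → ℝ,
        (∀ u w, RelSmooth (6 * Λ * ‖w‖) fun t => W (u + t • w)) ∧ ∀ u, |Real.log (W u) + L u| ≤ Cq)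
    {Ω : Type*} [MeasurableSpace Ω] {P : Measure Ω} [IsProbabilityMeasure P]
    {μ : Measure ℝ} {xbar : Fin n → Fin p → Ω → ℝ}
    (hxbar_law : ∀ i j, HasLaw (xbar i j) μ P)
    (hxbar_indep : iIndepFun (fun (ij : Fin n × Fin p) ω => xbar ij.1 ij.2 ω) P)
    (hxbar_mean : ∀ i j, ∫ ω, xbar i j ω ∂P = 0)
    (hxbar_subG : ∀ i j, psi2Norm (xbar i j) P ≤ (K : ℝ≥0∞))
    {π : Measure ℝ} {ε : Fin n → Ω → ℝ} (hε_law : ∀ i, HasLaw (ε i) π P) (hε_indep : iIndepFun ε P)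
    {g : Fin n → Ω → EuclideanSpace ℝ (Fin p)}
    (hg_law : ∀ i, HasLaw (g i) (multivariateGaussian 0 (Var[id; μ] • S)) P)
    (hg_indep : iIndepFun g P)
    (hxε : IndepFun (fun ω i j => xbar i j ω) (fun ω i => ε i ω) P)
    (hgε : IndepFun (fun ω i => g i ω) (fun ω i => ε i ω) P)
    {B : ℝ} (hB : 0 ≤ B) {ψ : ℝ → ℝ} (hψ : SmoothBounded B ψ) {β : ℝ≥0} (hβ : 0 < β)
    (hN : 1 ≤ β * (n : ℝ)) {δ : ℝ} (hδ : 0 < δ) :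
    |(∫ ω, ψ (trainingError ℓ r C (fun i => sqrtOp S (WithLp.toLp 2 fun j => xbar i j ω))
        (responses η Θstar (fun i => sqrtOp S (WithLp.toLp 2 fun j => xbar i j ω))
          (fun i => ε i ω))) ∂P) -
      ∫ ω, ψ (trainingError ℓ r C (fun i => g i ω)
        (responses η Θstar (fun i => g i ω) (fun i => ε i ω))) ∂P| ≤
      designErrorBound (subgaussianMoment K) ((k + kstar : ℕ) : ℝ) B K R κ Cq k β δ
        (R * (p : ℝ) ^ (-α)) ((p : ℝ) / n) := by
  have hCR : ∀ θ ∈ C, ‖θ‖ ≤ R := fun θ h => (hCsub h).2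
  -- All entries have the law `μ`, so one of them, available because `n, p > 0`, gives its moment
  -- bounds.
  obtain ⟨hμ, hμ2⟩ := expBounded_of_psi2Norm_le (hxbar_law ⟨0, hn⟩ ⟨0, hp⟩) hK
    (hxbar_subG ⟨0, hn⟩ ⟨0, hp⟩) (hxbar_mean ⟨0, hn⟩ ⟨0, hp⟩)
  have hμp := hμ.prob
  have hπp : IsProbabilityMeasure π := (hε_law ⟨0, hn⟩).isProbabilityMeasure_iff.mp inferInstance
  have hvar : Var[id; μ] = ∫ x, x ^ 2 ∂μ := by
    rw [variance_eq_integral aemeasurable_id]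
    simp [hμ.mean]
  obtain ⟨v, hv⟩ : ∃ v : ℝ≥0, (v : ℝ) = Var[id; μ] := ⟨⟨_, variance_nonneg _ _⟩, rfl⟩
  obtain ⟨hγ, hγ2⟩ := expBounded_gaussianReal (v := v) (K := K) (by rw [hv, hvar]; exact hμ2)
  simp only [← hv] at hg_law
  have hε := hε_indep.hasLaw_pi hε_law
  have hX := hasLaw_pi_pi hxbar_law hxbar_indep
  have hG := hasLaw_pi_multivariateGaussian hS hg_law hg_indep
  have hψc := hψ.continuous
  have hdc := continuous_designError (n := n) (S := S) (Θstar := Θstar) hℓ0 hℓ hη hκ hr hC hCR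
  have htc := continuous_trainingError_responses (n := n) (Θstar := Θstar) hℓ0 hℓ hη hκ hr hC hCR
  have hdm : Measurable fun q : (Fin n → Fin p → ℝ) × (Fin n → ℝ) =>
      ψ (designError ℓ η r S Θstar C q.2 q.1) := (hψc.comp hdc).measurable
  have htm : Measurable fun q : (Fin n → EuclideanSpace ℝ (Fin p)) × (Fin n → ℝ) =>
      ψ (trainingError ℓ r C q.1 (responses η Θstar q.1 q.2)) := (hψc.comp htc).measurable
  have hmap : Measurable fun (Y : Fin n → Fin p → ℝ) (i : Fin n) => sqrtOp S (WithLp.toLp 2 (Y i)) := by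
    fun_prop
  have : IsProbabilityMeasure ((Measure.pi fun _ : Fin n => Measure.pi fun _ : Fin p =>
      gaussianReal 0 v).map fun Y i => sqrtOp S (WithLp.toLp 2 (Y i))) :=
    Measure.isProbabilityMeasure_map hmap.aemeasurable
  have eX := integral_comp_indepFun hX hε hxε hdm (fun q => hψ.1 _)
  have eG := integral_comp_indepFun hG hε hgε htm (fun q => hψ.1 _)
  have eG2 : ∀ e : Fin n → ℝ, ∫ x, ψ (trainingError ℓ r C x (responses η Θstar x e))
      ∂((Measure.pi fun _ : Fin n => Measure.pi fun _ : Fin p => gaussianReal 0 v).map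
        fun Y i => sqrtOp S (WithLp.toLp 2 (Y i))) =
      ∫ Y, ψ (designError ℓ η r S Θstar C e Y)
        ∂(Measure.pi fun _ : Fin n => Measure.pi fun _ : Fin p => gaussianReal 0 v) := fun e => by
    have he : Measurable fun x : Fin n → EuclideanSpace ℝ (Fin p) => (x, e) := measurable_prodMk_right
    have hm := htm.comp he
    simp only [Function.comp_def] at hm
    exact integral_map hmap.aemeasurable hm.aestronglyMeasurable
  simp only [eG2] at eG
  have hI : ∀ ρ : Measure ℝ, IsProbabilityMeasure ρ → Integrable (fun e : Fin n → ℝ =>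
      ∫ Y, ψ (designError ℓ η r S Θstar C e Y)
        ∂(Measure.pi fun _ : Fin n => Measure.pi fun _ : Fin p => ρ)) (Measure.pi fun _ => π) := by
    intro ρ _
    exact integrable_integral_of_abs_le hdm fun _ => hψ.1 _
  -- Both expectations are now iterated integrals with the noise outside; the bound for fixed noise
  -- is uniform in `e`, so it integrates to itself.
  refine (le_of_eq (congrArg abs (congrArg₂ (· - ·) eX eG))).trans ?_
  refine (abs_integral_sub_integral_le (hI μ hμp) (hI _ inferInstance) (integrable_const _)
    fun e => abs_integral_designError_sub_le hn hp hμ hγ (by rw [hγ2, hv, hvar]) hK hR hα hκ hℓ0 hℓ hη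
      hr hS hSop hΘstar hC hCsub e hCq hB hψ hβ hN hδ).trans (le_of_eq ?_)
  simp

end

theorem corollary3p3
    -- fixed constants
    (k kstar : ℕ) (γ R α : ℝ) (K : ℝ≥0) (Kr : ℝ → ℝ)
    (hγ : 0 < γ) (hR : 0 < R) (hα : 0 < α) (hK : 0 < K) (hKr : ∀ B : ℝ, 0 ≤ B → 0 < Kr B)
    -- proportional asymptotics
    (p : ℕ → ℕ) (hp : Tendsto (fun n => (p n : ℝ) / (n : ℝ)) atTop (𝓝 γ))
    -- loss, labeling function and regularizer
    (ℓ : ℕ → EuclideanSpace ℝ (Fin (k + 1)) → ℝ)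
    (hℓ_nonneg : ∀ n u, 0 ≤ ℓ n u) (hℓ : ∀ n, LipschitzWith K (ℓ n))
    (η : ℕ → EuclideanSpace ℝ (Fin (kstar + 1)) → ℝ) (hη : ∀ n, LipschitzWith K (η n))
    (r : ∀ n, (Fin k → EuclideanSpace ℝ (Fin (p n))) → ℝ)
    (hr : ∀ n, ∀ B : ℝ, 0 < B → ∀ Θ₀ Θ₁ : Fin k → EuclideanSpace ℝ (Fin (p n)),
      frobNorm Θ₀ ≤ B → frobNorm Θ₁ ≤ B →
        |r n Θ₀ - r n Θ₁| ≤ Kr B * frobNorm (fun a => Θ₀ a - Θ₁ a))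
    -- the matrices `Σ`, true parameters and constraint sets
    (S : ∀ n, Matrix (Fin (p n)) (Fin (p n)) ℝ)
    (hS : ∀ n, (S n).PosSemidef) (hSop : ∀ n, matrixOpNorm (S n) ≤ K)
    (Θstar : ∀ n, Fin kstar → EuclideanSpace ℝ (Fin (p n)))
    (hΘstar : ∀ n a, Θstar n a ∈ delocalizedSet (S n) R α)
    (C : ∀ n, Set (EuclideanSpace ℝ (Fin (p n))))
    (hC_compact : ∀ n, IsCompact (C n)) (hC_nonempty : ∀ n, (C n).Nonempty)
    (hC_sub : ∀ n, C n ⊆ delocalizedSet (S n) R α)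
    -- probability spaces
    {Ω : ℕ → Type*} [∀ n, MeasurableSpace (Ω n)] (P : ∀ n, Measure (Ω n))
    [∀ n, IsProbabilityMeasure (P n)]
    -- i.i.d. centered subgaussian entries with common law `μ n`
    (μ : ℕ → Measure ℝ) (xbar : ∀ n, Fin n → Fin (p n) → Ω n → ℝ)
    (hxbar_law : ∀ n i j, HasLaw (xbar n i j) (μ n) (P n))
    (hxbar_indep : ∀ n, iIndepFun (fun (ij : Fin n × Fin (p n)) ω => xbar n ij.1 ij.2 ω) (P n))
    (hxbar_mean : ∀ n i j, ∫ ω, xbar n i j ω ∂(P n) = 0)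
    (hxbar_subG : ∀ n i j, psi2Norm (xbar n i j) (P n) ≤ (K : ℝ≥0∞))
    -- i.i.d. subgaussian noise with common law `π n`
    (π : ℕ → Measure ℝ) (ε : ∀ n, Fin n → Ω n → ℝ)
    (hε_law : ∀ n i, HasLaw (ε n i) (π n) (P n))
    (hε_indep : ∀ n, iIndepFun (ε n) (P n))
    (hε_subG : ∀ n i, psi2Norm (ε n i) (P n) ≤ (K : ℝ≥0∞))
    -- the features `x_i = Σ^{1/2} xbar_i`
    (x : ∀ n, Fin n → Ω n → EuclideanSpace ℝ (Fin (p n)))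
    (hx : ∀ n i ω, x n i ω = sqrtOp (S n) (WithLp.toLp 2 (fun j => xbar n i j ω)))
    -- the i.i.d. Gaussian features `g_i ∼ N(0, ν Σ)`, `ν` the variance of an entry of `xbar`
    (g : ∀ n, Fin n → Ω n → EuclideanSpace ℝ (Fin (p n)))
    (hg_law : ∀ n i, HasLaw (g n i) (multivariateGaussian 0 (Var[id; μ n] • S n)) (P n))
    (hg_indep : ∀ n, iIndepFun (g n) (P n))
    -- the noise is independent of the features in each of the two models
    (hxε : ∀ n, IndepFun (fun ω i j => xbar n i j ω) (fun ω i => ε n i ω) (P n))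
    (hgε : ∀ n, IndepFun (fun ω i => g n i ω) (fun ω i => ε n i ω) (P n))
    -- the training errors in the two models
    (errX errG : ∀ n, Ω n → ℝ)
    (herrX : ∀ n ω, errX n ω = trainingError (ℓ n) (r n) (C n) (fun i => x n i ω)
      (responses (η n) (Θstar n) (fun i => x n i ω) (fun i => ε n i ω)))
    (herrG : ∀ n ω, errG n ω = trainingError (ℓ n) (r n) (C n) (fun i => g n i ω)
      (responses (η n) (Θstar n) (fun i => g n i ω) (fun i => ε n i ω))) :
    (∀ ψ : ℝ → ℝ, (∃ M : ℝ, ∀ t, |ψ t| ≤ M) → (∃ L : ℝ≥0, LipschitzWith L ψ) →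
      Tendsto (fun n => |(∫ ω, ψ (errX n ω) ∂(P n)) - ∫ ω, ψ (errG n ω) ∂(P n)|)
        atTop (𝓝 0)) ∧
    (∀ ρ δ : ℝ, 0 < δ → ∀ τ : ℝ, 0 < τ → ∀ᶠ n in atTop,
      (P n).real {ω | ρ + δ ≤ errX n ω} ≤ (P n).real {ω | ρ ≤ errG n ω} + τ ∧
      (P n).real {ω | errX n ω ≤ ρ - δ} ≤ (P n).real {ω | errG n ω ≤ ρ} + τ) ∧
    (∀ ρ : ℝ, TendstoInProb P errX ρ ↔ TendstoInProb P errG ρ) := by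
  -- Matrices with `k` columns of norm at most `R` have Frobenius norm at most `k * R`; the `+ 1`
  -- makes the radius positive even when `k = 0`.
  set κ : ℝ := Kr (k * R + 1) with hκdef
  have hk0 : (0 : ℝ) ≤ k * R := by positivity
  have hκ : 0 ≤ κ := (hKr _ (by linarith)).le
  have hrR : ∀ n, ∀ Θ₀ Θ₁ : Fin k → EuclideanSpace ℝ (Fin (p n)), (∀ a, ‖Θ₀ a‖ ≤ R) →
      (∀ a, ‖Θ₁ a‖ ≤ R) → |r n Θ₀ - r n Θ₁| ≤ κ * frobNorm (fun a => Θ₀ a - Θ₁ a) :=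
    fun n Θ₀ Θ₁ h₀ h₁ => hr n _ (by linarith) Θ₀ Θ₁
      ((frobNorm_le_of_forall h₀).trans (by linarith)) ((frobNorm_le_of_forall h₁).trans (by linarith))
  have hCR : ∀ n, ∀ θ ∈ C n, ‖θ‖ ≤ R := fun n θ h => (hC_sub n h).2
  have hcont := fun n => continuous_trainingError_responses (n := n) (Θstar := Θstar n)
    (hℓ_nonneg n) (hℓ n) (hη n) hκ (hrR n) (hC_nonempty n) (hCR n)
  have hεm : ∀ n, AEMeasurable (fun ω i => ε n i ω) (P n) := fun n =>
    aemeasurable_pi_lambda _ fun i => (hε_law n i).aemeasurable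
  have hXm : ∀ n, AEMeasurable (errX n) (P n) := by
    intro n
    have hxm : AEMeasurable (fun ω i => x n i ω) (P n) := by
      refine aemeasurable_pi_lambda _ fun i => ?_
      simp only [hx]
      have hb : AEMeasurable (fun ω j => xbar n i j ω) (P n) :=
        aemeasurable_pi_lambda _ fun j => (hxbar_law n i j).aemeasurable
      have hc : Continuous fun v : Fin (p n) → ℝ => sqrtOp (S n) (WithLp.toLp 2 v) := by fun_prop
      exact hc.measurable.comp_aemeasurable hb
    have h := (hcont n).measurable.comp_aemeasurable (hxm.prodMk (hεm n))
    simp only [Function.comp_def, ← herrX] at h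
    exact h
  have hGm : ∀ n, AEMeasurable (errG n) (P n) := by
    intro n
    have hgm : AEMeasurable (fun ω i => g n i ω) (P n) :=
      aemeasurable_pi_lambda _ fun i => (hg_law n i).aemeasurable
    have h := (hcont n).measurable.comp_aemeasurable (hgm.prodMk (hεm n))
    simp only [Function.comp_def, ← herrG] at h
    exact h
  -- A positive limit `γ` of `p / n` excludes `p n = 0` for large `n`.
  have hp0 : ∀ᶠ n in atTop, 0 < n ∧ 0 < p n := by
    filter_upwards [eventually_gt_atTop 0, hp.eventually (lt_mem_nhds hγ)] with n hn hpn
    refine ⟨hn, Nat.pos_of_ne_zero fun h => ?_⟩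
    simp [h] at hpn
  have hptop : Tendsto (fun n => (p n : ℝ)) atTop atTop := by
    have h := hp.pos_mul_atTop hγ tendsto_natCast_atTop_atTop
    refine h.congr' ?_
    filter_upwards [eventually_gt_atTop 0] with n hn
    have : (n : ℝ) ≠ 0 := by exact_mod_cast hn.ne'
    field_simp
  have hb : Tendsto (fun n => R * (p n : ℝ) ^ (-α)) atTop (𝓝 0) := by
    simpa using ((tendsto_rpow_neg_atTop hα).comp hptop).const_mul R
  -- `Cq` depends only on `k + kstar`, so it is available before `β`, `δ` and `n` are chosen.
  obtain ⟨Cq, -, hCq⟩ := exists_smooth_weight (E := EuclideanSpace ℝ (Fin k ⊕ Fin kstar))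
  have hmain : AsympEqual P errX errG := by
    rintro ψ ⟨M, hM⟩ ⟨L, hL⟩
    rw [Metric.tendsto_atTop']
    intro τ hτ
    -- The budget is `τ / 4` for replacing `ψ` by `φ` in each model and `τ / 2` for comparing the
    -- models.
    obtain ⟨B, φ, hB, hφ, hφψ⟩ := exists_smoothBounded_approx hM hL (by positivity : 0 < τ / 4)
    obtain ⟨β, δ, hβ, hδ, hlt⟩ := exists_designErrorBound_lt (A := subgaussianMoment K)
      (q := ((k + kstar : ℕ) : ℝ)) (B := B) (K := K) (R := R) (κ := κ) (Cq := Cq) (k := k)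
      (half_pos hτ) hb hp
    have hβn : ∀ᶠ n : ℕ in atTop, 1 ≤ (β : ℝ) * n :=
      (tendsto_natCast_atTop_atTop.const_mul_atTop (by exact_mod_cast hβ)).eventually_ge_atTop 1
    obtain ⟨N, hN⟩ := eventually_atTop.mp (hp0.and (hlt.and hβn))
    refine ⟨N, fun n hn => ?_⟩
    obtain ⟨⟨hn0, hpn0⟩, hlt, hβn⟩ := hN n hn.le
    have hcmp := abs_integral_trainingError_sub_le hn0 hpn0 hK hR hα hκ (hℓ_nonneg n) (hℓ n) (hη n)
      (hrR n) (hS n) (hSop n) (hΘstar n) (hC_nonempty n) (hC_sub n) hCq (hxbar_law n)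
      (hxbar_indep n) (hxbar_mean n) (hxbar_subG n) (hε_law n) (hε_indep n) (hg_law n) (hg_indep n)
      (hxε n) (hgε n) hB hφ hβ hβn hδ
    simp only [← hx, ← herrX, ← herrG] at hcmp
    have hap : ∀ Z : Ω n → ℝ, AEMeasurable Z (P n) →
        |(∫ ω, φ (Z ω) ∂(P n)) - ∫ ω, ψ (Z ω) ∂(P n)| ≤ τ / 4 := fun Z hZ => by
      have h1 : Integrable (fun ω => φ (Z ω)) (P n) := Integrable.of_bound
        (hφ.continuous.measurable.comp_aemeasurable hZ).aestronglyMeasurable B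
        (Eventually.of_forall fun ω => hφ.1 _)
      have h2 : Integrable (fun ω => ψ (Z ω)) (P n) := Integrable.of_bound
        (hL.continuous.measurable.comp_aemeasurable hZ).aestronglyMeasurable M
        (Eventually.of_forall fun ω => hM _)
      refine (abs_integral_sub_integral_le h1 h2 (integrable_const (τ / 4)) fun ω => hφψ _).trans ?_
      simp
    rw [Real.dist_eq, sub_zero, abs_abs, abs_lt]
    have a1 := abs_le.mp (hap _ (hXm n))
    have a2 := abs_le.mp (hap _ (hGm n))
    have a3 := abs_le.mp hcmp
    constructor <;> linarith
  exact ⟨hmain, fun ρ δ hδ τ hτ => (hmain.eventually_ge_le hXm hGm ρ hδ hτ).and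
    (hmain.eventually_le_le hXm hGm ρ hδ hτ), fun ρ => ⟨hmain.symm.tendstoInProb hGm hXm,
    hmain.tendstoInProb hXm hGm⟩⟩
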